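/- **Setting.** For $F:\mathbb N\to\mathbb N\cup\{\infty\}$ let $[\mathcal K_Fx](j)=x(F(j))$ if $F(j)\in\mathbb N$ and $[\mathcal K_Fx](j)=0$ if $F(j)=\infty$. Let $\Omega_{\mathbb N}$ be the set of all such $F$ for which $\mathcal K_F$ is a bounded operator on $\ell^2(\mathbb N)$, let $\Lambda=\{a_{i,j}\}_{i,j\in\mathbb N}$ with $a_{i,j}(F)=1$ if $F(j)=i$ and $a_{i,j}(F)=0$ otherwise, and let $\mathcal M_H$ be the set of non-empty compact subsets of $\mathbb C$ with the Hausdorff metric $d_H$. Let $\Xi(F)=\mathrm{Sp}(\mathcal K_F)$, or let $\Xi(F)=\mathrm{Sp}_{\mathrm{ap}}(\mathcal K_F)=\{\lambda\in\mathbb C:\exists\, g_n\in\ell^2(\mathbb N),\ \|g_n\|=1,\ \|(\mathcal K_F-\lambda I)g_n\|\to0\}$. **Algorithms and towers.** For a computational problem $\{\Xi,\Omega,\mathcal M_H,\Lambda\}$, with $\Xi:\Omega\to\mathcal M_H$ and $\Lambda$ a countable family of maps $\Omega\to\mathbb C$, a *general algorithm* is a map $\Gamma:\Omega\to\mathcal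 M_H$ such that every $A\in\Omega$ has a non-empty finite set $\Lambda_\Gamma(A)\subset\Lambda$ with: if $f(A)=f(B)$ for all $f\in\Lambda_\Gamma(A)$, then $\Lambda_\Gamma(A)=\Lambda_\Gamma(B)$ and $\Gamma(A)=\Gamma(B)$. A *tower of height $k$* consists of maps $\Gamma_{n_k},\Gamma_{n_k,n_{k-1}},\dots,\Gamma_{n_k,\dots,n_1}:\Omega\to\mathcal M_H$, the $\Gamma_{n_k,\dots,n_1}$ being general algorithms, such that for every $A\in\Omega$ one has $\Xi(A)=\lim_{n_k\to\infty}\Gamma_{n_k}(A)$, …, $\Gamma_{n_k,\dots,n_2}(A)=\lim_{n_1\to\infty}\Gamma_{n_k,\dots,n_1}(A)$; for $k=0$ it is a general algorithm equal to $\Xi$. The tower is *arithmetic* if every $\Gamma_{n_k,\dots,n_1}(A)$ is a finite set of complex numbers, computed from $(n_k,\dots,n_1)$ by one BSS machine with an oracle for $\{f(A)\}_{f\in\Lambda}$ and, if all evaluations take values in $\mathbb Q+i\mathbb Q$, also by one oracle Turing machine. The type $\alpha$ of a tower is $G$ (no further restriction) or $A$ (arithmetic). $\mathrm{SCI}_\alpha$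 is the least height of a tower of type $\alpha$ ($\infty$ if there is none), and for $m\ge1$ the problem is in $\Delta_{m+1}^\alpha$ if $\mathrm{SCI}_\alpha\le m$. It is in $\Pi_m^\alpha$ if it is in $\Delta_{m+1}^\alpha$ and there are a tower of type $\alpha$ and height $m$ and sets $X_n(A)\in\mathcal M_H$ with $\Xi(A)\subset X_n(A)$ and $d_H(X_n(A),\Gamma_n(A))\le2^{-n}$ for all $A\in\Omega$ and $n\in\mathbb{N}$, where $\Gamma_n$ denotes $\Gamma_{n_m}$ with $n_m=n$. **Inexact input.** In the problem with *$\Delta_1$-information*, written $\{\Xi,\Omega,\mathcal M_H,\Lambda\}^{\Delta_1}$, the inputs are all families $(\tilde f_n)_{f\in\Lambda,\,n\in\mathbb N}$ of complex numbers such that for some $A\in\Omega$ one has $|\tilde f_n-f(A)|\le2^{-n}$ for all $f$ and $n$; the algorithm may read every $\tilde f_n$ and has to compute $\Xi(A)$. In the rational version, the $\tilde f_n$ are in $\mathbb Q+i\mathbb Q$. **Theorem.** For both choices of $\Xi$, $$\{\Xi,\Omega_{\mathbb N},\mathcal M_H,\Lambda\}\notin\Delta_3^G,\qquad \{\Xi,\Omega_{\mathbb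 N},\mathcal M_H,\Lambda\}\in\Pi_3^A,\qquad \{\Xi,\Omega_{\mathbb N},\mathcal M_H,\Lambda\}^{\Delta_1}\in\Pi_3^A,$$ the last one both for complex and for rational $\Delta_1$-information. That is, $\Xi(F)$ cannot be computed in two successive limits by any algorithm, even with exact input, but it can be computed by an arithmetic $\Pi_3$-tower, even with inexact input. Consequently $\mathrm{SCI}_G=\mathrm{SCI}_A=3$ for the problem with exact input and for the problem with $\Delta_1$-information. -/

import Mathlib

open Filter Topology

/-! ## Computational problems and the SCI hierarchy -/

/-- The space of non-empty compact subsets of `ℂ`, with Mathlib's Hausdorff metric. -/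
abbrev HausdorffSpace : Type := TopologicalSpace.NonemptyCompacts ℂ

/-- A computational problem `{Ξ, Ω, 𝓜_H, Λ}` with primary set `Ω` and evaluation set
`Λ = {f_i : Ω → ℂ}`, indexed by `I`: here `f_i A` is `eval A i`. -/
structure ComputationalProblem (Ω I : Type) where
  eval : Ω → I → ℂ
  Ξ : Ω → HausdorffSpace
  determined : ∀ A B : Ω, Ξ A ≠ Ξ B → ∃ i, eval A i ≠ eval B i

/-- General algorithms: each input `A` comes with a non-empty finite set `Q A` of evaluations that
are read, and an input that agrees with `A` on `Q A` has the same set and the same output. -/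
def IsGeneralAlgorithm {Ω I : Type} (P : ComputationalProblem Ω I) (Γ : Ω → HausdorffSpace) :
    Prop :=
  ∃ Q : Ω → Finset I, ∀ A, (Q A).Nonempty ∧
    ∀ B, (∀ i ∈ Q A, P.eval A i = P.eval B i) → Q A = Q B ∧ Γ A = Γ B

/-- Towers of algorithms of height `k`. The function `Γ_{n_k, …, n_j}` is `Γ [n_k, …, n_j]`, the
empty list giving the problem function; lists longer than `k` play no role. A tower of height `0`
is a general algorithm equal to the problem function. -/
structure IsTower {Ω I : Type} (P : ComputationalProblem Ω I) (k : ℕ)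
    (Γ : List ℕ → Ω → HausdorffSpace) : Prop where
  general : ∀ l : List ℕ, l.length = k → IsGeneralAlgorithm P (Γ l)
  top : ∀ A, Γ [] A = P.Ξ A
  limit : ∀ l : List ℕ, l.length < k → ∀ A,
    Tendsto (fun n : ℕ => Γ (l ++ [n]) A) atTop (𝓝 (Γ l A))

/-! ### Oracle Turing computability -/

/-- Partial recursive functionals: partial functions `ℕ → ℕ` computed by one and the same oracle
machine, uniformly in the oracle `g : ℕ → ℕ`. This is the uniform version of `Nat.RecursiveIn`. -/
inductive RecursiveFunctional : ((ℕ → ℕ) → ℕ →. ℕ) → Prop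
  | zero : RecursiveFunctional fun _ _ => Part.some 0
  | succ : RecursiveFunctional fun _ n => Part.some (n + 1)
  | left : RecursiveFunctional fun _ n => Part.some (Nat.unpair n).1
  | right : RecursiveFunctional fun _ n => Part.some (Nat.unpair n).2
  | oracle : RecursiveFunctional fun g n => Part.some (g n)
  | pair {f h : (ℕ → ℕ) → ℕ →. ℕ} (hf : RecursiveFunctional f) (hh : RecursiveFunctional h) :
      RecursiveFunctional fun g n => Nat.pair <$> f g n <*> h g n
  | comp {f h : (ℕ → ℕ) → ℕ →. ℕ} (hf : RecursiveFunctional f) (hh : RecursiveFunctional h) :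
      RecursiveFunctional fun g n => h g n >>= f g
  | prec {f h : (ℕ → ℕ) → ℕ →. ℕ} (hf : RecursiveFunctional f) (hh : RecursiveFunctional h) :
      RecursiveFunctional fun g p =>
        Nat.rec (f g (Nat.unpair p).1)
          (fun y IH => IH >>= fun i => h g (Nat.pair (Nat.unpair p).1 (Nat.pair y i)))
          (Nat.unpair p).2
  | rfind {f : (ℕ → ℕ) → ℕ →. ℕ} (hf : RecursiveFunctional f) :
      RecursiveFunctional fun g a =>
        Nat.rfind fun n => (fun m => decide (m = 0)) <$> f g (Nat.pair a n)

/-- The rational number `(a - b) / (d + 1)` named by the triple `(a, b, d)`. -/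
def ratOfCode (c : ℕ × ℕ × ℕ) : ℚ := ((c.1 : ℚ) - c.2.1) / (c.2.2 + 1)

/-- Finite codes for the elements of `ℚ + iℚ`. -/
abbrev GaussCode : Type := (ℕ × ℕ × ℕ) × (ℕ × ℕ × ℕ)

/-- The element of `ℚ + iℚ` with a given code. -/
noncomputable def gaussOfCode (c : GaussCode) : ℂ :=
  ((ratOfCode c.1 : ℚ) : ℂ) + ((ratOfCode c.2 : ℚ) : ℂ) * Complex.I

/-- The set `ℚ + iℚ`. -/
def gaussRationals : Set ℂ := {z | ∃ p q : ℚ, z = (p : ℂ) + (q : ℂ) * Complex.I}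

/-- All evaluations take values in `ℚ + iℚ`. -/
def ComputationalProblem.RationalValued {Ω I : Type} (P : ComputationalProblem Ω I) : Prop :=
  ∀ A i, P.eval A i ∈ gaussRationals

/-- The oracle tape `g` holds, at the code of the index `i`, a code of the value `f_i(A)`. -/
def IsOracleTape {Ω I : Type} [Encodable I] (P : ComputationalProblem Ω I) (A : Ω)
    (g : ℕ → ℕ) : Prop :=
  ∀ i : I, ∃ c : GaussCode, g (Encodable.encode i) = Encodable.encode c ∧
    gaussOfCode c = P.eval A i

/-- A single oracle Turing machine computes `Γ_{n_k, …, n_1}(A)` from `(n_k, …, n_1)` and any tape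
with the evaluations of `A`. The output is a list of elements of `ℚ + iℚ`, identified with the
finite set of its entries. -/
def IsTuringComputable {Ω I : Type} [Encodable I] (P : ComputationalProblem Ω I) (k : ℕ)
    (Γ : List ℕ → Ω → HausdorffSpace) : Prop :=
  ∃ Φ, RecursiveFunctional Φ ∧
    ∀ (A : Ω) (g : ℕ → ℕ), IsOracleTape P A g → ∀ l : List ℕ, l.length = k →
      ∃ L : List GaussCode, Encodable.encode L ∈ Φ g (Encodable.encode l) ∧
        (Γ l A : Set ℂ) = {z | ∃ c ∈ L, gaussOfCode c = z}

/-! ### Oracle machines over the reals (BSS machines) -/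

/-- Programs for a machine with real registers `x_0, x_1, x_2, …`, exact arithmetic, comparisons,
indirect addressing and an oracle with complex answers. Machine constants are rational. -/
inductive RealProgram : Type
  /-- `x_r := q` -/
  | const (r : ℕ) (q : ℚ)
  /-- `x_r := x_s + x_t` -/
  | add (r s t : ℕ)
  /-- `x_r := x_s - x_t` -/
  | sub (r s t : ℕ)
  /-- `x_r := x_s * x_t` -/
  | mul (r s t : ℕ)
  /-- `x_r := x_s / x_t` -/
  | div (r s t : ℕ)
  /-- `x_r := x_a`, where `a` is the address in `x_s` -/
  | load (r s : ℕ)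
  /-- `x_a := x_s`, where `a` is the address in `x_r` -/
  | store (r s : ℕ)
  /-- `x_r` and `x_s` receive the real and the imaginary part of the oracle's answer to the
  question whose number is in `x_t` -/
  | query (r s t : ℕ)
  /-- first `p`, then `q` -/
  | seq (p q : RealProgram)
  /-- if `0 < x_r` then `p` else `q` -/
  | ifPos (r : ℕ) (p q : RealProgram)
  /-- while `0 < x_r` do `p` -/
  | whilePos (r : ℕ) (p : RealProgram)

/-- `RealProgram.Runs o p x y`: with the oracle `o`, started with register contents `x`, the
program `p` halts with register contents `y`. -/
inductive RealProgram.Runs (o : ℕ → ℂ) : RealProgram → (ℕ → ℝ) → (ℕ → ℝ) → Prop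
  | const (r : ℕ) (q : ℚ) (x : ℕ → ℝ) : Runs o (.const r q) x (Function.update x r (q : ℝ))
  | add (r s t : ℕ) (x : ℕ → ℝ) : Runs o (.add r s t) x (Function.update x r (x s + x t))
  | sub (r s t : ℕ) (x : ℕ → ℝ) : Runs o (.sub r s t) x (Function.update x r (x s - x t))
  | mul (r s t : ℕ) (x : ℕ → ℝ) : Runs o (.mul r s t) x (Function.update x r (x s * x t))
  | div (r s t : ℕ) (x : ℕ → ℝ) (h : x t ≠ 0) :
      Runs o (.div r s t) x (Function.update x r (x s / x t))
  | load (r s a : ℕ) (x : ℕ → ℝ) (h : x s = (a : ℝ)) :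
      Runs o (.load r s) x (Function.update x r (x a))
  | store (r s a : ℕ) (x : ℕ → ℝ) (h : x r = (a : ℝ)) :
      Runs o (.store r s) x (Function.update x a (x s))
  | query (r s t m : ℕ) (x : ℕ → ℝ) (h : x t = (m : ℝ)) :
      Runs o (.query r s t) x (Function.update (Function.update x r (o m).re) s (o m).im)
  | seq (p q : RealProgram) (x y z : ℕ → ℝ) (hp : Runs o p x y) (hq : Runs o q y z) :
      Runs o (.seq p q) x z
  | ifTrue (r : ℕ) (p q : RealProgram) (x y : ℕ → ℝ) (h : 0 < x r) (hp : Runs o p x y) :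
      Runs o (.ifPos r p q) x y
  | ifFalse (r : ℕ) (p q : RealProgram) (x y : ℕ → ℝ) (h : x r ≤ 0) (hq : Runs o q x y) :
      Runs o (.ifPos r p q) x y
  | whileTrue (r : ℕ) (p : RealProgram) (x y z : ℕ → ℝ) (h : 0 < x r) (hp : Runs o p x y)
      (hw : Runs o (.whilePos r p) y z) : Runs o (.whilePos r p) x z
  | whileFalse (r : ℕ) (p : RealProgram) (x : ℕ → ℝ) (h : x r ≤ 0) :
      Runs o (.whilePos r p) x x

/-- The oracle that answers the question numbered by the code of `i` with `f_i(A)`. -/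
def ComputationalProblem.realOracle {Ω I : Type} [Encodable I] (P : ComputationalProblem Ω I)
    (A : Ω) (m : ℕ) : ℂ :=
  ((Encodable.decode m : Option I).map (P.eval A)).getD 0

/-- A single oracle program over the reals computes `Γ_{n_k, …, n_1}(A)`. It starts with
`n_k, …, n_1` in the first `k` registers and zeros elsewhere, and it halts with the number `N` of
output points in `x_0` and the points `x_{2j+1} + i x_{2j+2}`, `j < N`; this output is identified
with the finite set of these points. -/
def IsBSSComputable {Ω I : Type} [Encodable I] (P : ComputationalProblem Ω I) (k : ℕ)
    (Γ : List ℕ → Ω → HausdorffSpace) : Prop :=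
  ∃ p : RealProgram, ∀ (A : Ω) (l : List ℕ), l.length = k →
    ∃ (y : ℕ → ℝ) (N : ℕ),
      p.Runs (P.realOracle A) (fun r => ((l.getD r 0 : ℕ) : ℝ)) y ∧ y 0 = (N : ℝ) ∧
        (Γ l A : Set ℂ) = {z | ∃ j < N, z = ⟨y (2 * j + 1), y (2 * j + 2)⟩}

/-! ### The hierarchy -/

/-- Types of towers: general and arithmetic. -/
inductive TowerType : Type
  | general
  | arithmetic

/-- A tower of height `k` and of the given type. Arithmetic towers are computed by an oracle BSS
machine and, if all evaluations are in `ℚ + iℚ`, also by an oracle Turing machine. -/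
def IsTowerOfType {Ω I : Type} [Encodable I] :
    TowerType → ComputationalProblem Ω I → ℕ → (List ℕ → Ω → HausdorffSpace) → Prop
  | .general, P, k, Γ => IsTower P k Γ
  | .arithmetic, P, k, Γ =>
      IsTower P k Γ ∧ IsBSSComputable P k Γ ∧ (P.RationalValued → IsTuringComputable P k Γ)

/-- The Solvability Complexity Index: the least height of a tower, `⊤` if there is none. -/
noncomputable def SCI {Ω I : Type} [Encodable I] (α : TowerType) (P : ComputationalProblem Ω I) :
    ℕ∞ :=
  ⨅ k ∈ {k : ℕ | ∃ Γ, IsTowerOfType α P k Γ}, (k : ℕ∞)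

/-- `P ∈ Δ_m^α`. -/
def InDelta {Ω I : Type} [Encodable I] (α : TowerType) (P : ComputationalProblem Ω I) : ℕ → Prop
  | 0 => SCI α P = 0
  | 1 => ∃ Γ, IsTowerOfType α P 1 Γ ∧ ∀ A (n : ℕ), dist (Γ [n] A) (P.Ξ A) ≤ (1 / 2 : ℝ) ^ n
  | m + 2 => SCI α P ≤ ((m + 1 : ℕ) : ℕ∞)

/-- `P ∈ Π_m^α`, for the Hausdorff metric: convergence from above in the last limit, up to an
error of `2^{-n}`. -/
def InPi {Ω I : Type} [Encodable I] (α : TowerType) (P : ComputationalProblem Ω I) : ℕ → Prop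
  | 0 => InDelta α P 0
  | m + 1 => InDelta α P (m + 2) ∧
      ∃ (Γ : List ℕ → Ω → HausdorffSpace) (X : ℕ → Ω → HausdorffSpace),
        IsTowerOfType α P (m + 1) Γ ∧
        ∀ (A : Ω) (n : ℕ), (P.Ξ A : Set ℂ) ⊆ (X n A : Set ℂ) ∧
          dist (X n A) (Γ [n] A) ≤ (1 / 2 : ℝ) ^ n

/-! ### Inexact input -/

/-- The tuple `a = (a_{i,n})` of elements of `S` is `Δ₁`-information for `A`:
`|a_{i,n} - f_i(A)| ≤ 2^{-n}` for all `i` and `n`. -/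
def IsDeltaOneInfo {Ω I : Type} (P : ComputationalProblem Ω I) (S : Set ℂ) (A : Ω)
    (a : I × ℕ → ℂ) : Prop :=
  ∀ i n, a (i, n) ∈ S ∧ dist (a (i, n)) (P.eval A i) ≤ (1 / 2 : ℝ) ^ n

/-- The problem with `Δ₁`-information, the approximate evaluations being elements of `S`. -/
noncomputable def ComputationalProblem.inexact {Ω I : Type} (P : ComputationalProblem Ω I)
    (S : Set ℂ) : ComputationalProblem {a : I × ℕ → ℂ // ∃ A, IsDeltaOneInfo P S A a} (I × ℕ) where
  eval a := a.1
  Ξ a := P.Ξ a.2.choose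
  determined a b h := by
    by_contra hc
    push Not at hc
    exact h (by rw [Subtype.ext (funext hc)])

/-- The problem function of the inexact problem does not depend on the choice of `A`. -/
theorem ComputationalProblem.inexact_Ξ {Ω I : Type} (P : ComputationalProblem Ω I) (S : Set ℂ)
    (a : {a : I × ℕ → ℂ // ∃ A, IsDeltaOneInfo P S A a}) (A : Ω)
    (h : IsDeltaOneInfo P S A a.1) : (P.inexact S).Ξ a = P.Ξ A := by
  by_contra hne
  obtain ⟨i, hi⟩ := P.determined _ _ hne
  have lim : ∀ B, IsDeltaOneInfo P S B a.1 →
      Tendsto (fun n => a.1 (i, n)) atTop (𝓝 (P.eval B i)) := fun B hB =>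
    tendsto_iff_dist_tendsto_zero.2 (squeeze_zero (fun _ => dist_nonneg) (fun n => (hB i n).2)
      (tendsto_pow_atTop_nhds_zero_of_lt_one (by norm_num) (by norm_num)))
  exact hi (tendsto_nhds_unique (lim _ a.2.choose_spec) (lim _ h))

/-! ## The approximate point spectrum -/

/-- The approximate point spectrum of a bounded operator. -/
def approximatePointSpectrum {E : Type*} [NormedAddCommGroup E] [NormedSpace ℂ E]
    (T : E →L[ℂ] E) : Set ℂ :=
  {z | ∃ g : ℕ → E, (∀ n, ‖g n‖ = 1) ∧ Tendsto (fun n => ‖T (g n) - z • g n‖) atTop (𝓝 0)}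

theorem notMem_approximatePointSpectrum_iff {E : Type*} [NormedAddCommGroup E] [NormedSpace ℂ E]
    (T : E →L[ℂ] E) (z : ℂ) :
    z ∉ approximatePointSpectrum T ↔ ∃ c > 0, ∀ x, c * ‖x‖ ≤ ‖T x - z • x‖ := by
  constructor
  · intro h
    by_contra! hc
    apply h
    have key : ∀ n : ℕ, ∃ g : E, ‖g‖ = 1 ∧ ‖T g - z • g‖ ≤ 1 / ((n : ℝ) + 1) := by
      intro n
      obtain ⟨x, hx⟩ := hc (1 / ((n : ℝ) + 1)) (by positivity)
      have hx0 : x ≠ 0 := by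
        rintro rfl
        simp at hx
      have hpos : 0 < ‖x‖ := norm_pos_iff.2 hx0
      refine ⟨((‖x‖⁻¹ : ℝ) : ℂ) • x, ?_, ?_⟩
      · rw [norm_smul]
        simp [hpos.ne']
      · rw [map_smul, smul_comm z, ← smul_sub, norm_smul]
        simp only [Complex.norm_real, norm_inv, norm_norm]
        rw [inv_mul_le_iff₀ hpos, mul_comm]
        exact hx.le
    choose g hg using key
    exact ⟨g, fun n => (hg n).1, squeeze_zero (fun _ => norm_nonneg _) (fun n => (hg n).2)
      tendsto_one_div_add_atTop_nhds_zero_nat⟩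
  · rintro ⟨c, hc, h⟩ ⟨g, hg, hlim⟩
    have := ge_of_tendsto' hlim (fun n => by simpa [hg n] using h (g n))
    linarith

theorem isCompact_approximatePointSpectrum {E : Type*} [NormedAddCommGroup E] [NormedSpace ℂ E]
    (T : E →L[ℂ] E) : IsCompact (approximatePointSpectrum T) := by
  refine Metric.isCompact_of_isClosed_isBounded ?_ ?_
  · rw [← isOpen_compl_iff, Metric.isOpen_iff]
    intro z hz
    obtain ⟨c, hc, h⟩ := (notMem_approximatePointSpectrum_iff T z).1 hz
    refine ⟨c, hc, fun w hw => (notMem_approximatePointSpectrum_iff T w).2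
      ⟨c - dist w z, by simpa using hw, fun x => ?_⟩⟩
    have h2 : ‖T x - z • x‖ ≤ ‖T x - w • x‖ + ‖(w - z) • x‖ := by
      refine le_trans (le_of_eq ?_) (norm_add_le _ _)
      rw [sub_smul]
      congr 1
      abel
    rw [norm_smul] at h2
    rw [dist_eq_norm]
    linarith [h x]
  · refine (Metric.isBounded_closedBall (x := (0 : ℂ)) (r := ‖T‖)).subset ?_
    rintro z ⟨g, hg, hlim⟩
    have h1 : ∀ n, ‖z‖ - ‖T‖ ≤ ‖T (g n) - z • g n‖ := fun n => by
      have a1 := norm_sub_norm_le (z • g n) (T (g n))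
      have a2 := T.le_opNorm (g n)
      rw [norm_smul, hg n, norm_sub_rev] at a1
      rw [hg n] at a2
      linarith
    have := ge_of_tendsto' hlim h1
    simpa using this

theorem approximatePointSpectrum_nonempty {E : Type*} [NormedAddCommGroup E] [NormedSpace ℂ E]
    [CompleteSpace E] [Nontrivial E] (T : E →L[ℂ] E) : (approximatePointSpectrum T).Nonempty := by
  have hfr : (frontier (spectrum ℂ T)).Nonempty := by
    refine nonempty_frontier_iff.2 ⟨spectrum.nonempty T, fun hu => ?_⟩
    exact NormedSpace.unbounded_univ ℂ ℂ (hu ▸ spectrum.isBounded T)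
  obtain ⟨z, hz⟩ := hfr
  refine ⟨z, ?_⟩
  by_contra hn
  obtain ⟨c, hc, h⟩ := (notMem_approximatePointSpectrum_iff T z).1 hn
  have hzs : z ∈ spectrum ℂ T := (spectrum.isClosed T).frontier_subset hz
  have hz' : z ∈ closure (spectrum ℂ T)ᶜ := by
    rw [frontier_eq_closure_inter_closure] at hz
    exact hz.2
  obtain ⟨w, hw, hwz⟩ := Metric.mem_closure_iff.1 hz' (c / 2) (by linarith)
  have hunit : IsUnit (algebraMap ℂ (E →L[ℂ] E) w - T) := by
    simpa [spectrum.mem_iff] using hw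
  obtain ⟨u, hu⟩ := hunit
  have happ : ∀ v : ℂ, ∀ x, (algebraMap ℂ (E →L[ℂ] E) v - T) x = v • x - T x := fun v x => by
    simp [Algebra.algebraMap_eq_smul_one]
  have hlow : ∀ x, c / 2 * ‖x‖ ≤ ‖(u : E →L[ℂ] E) x‖ := by
    intro x
    rw [hu, happ, norm_sub_rev]
    have h2 : ‖T x - z • x‖ ≤ ‖T x - w • x‖ + ‖(w - z) • x‖ := by
      refine le_trans (le_of_eq ?_) (norm_add_le _ _)
      rw [sub_smul]
      congr 1
      abel
    rw [norm_smul] at h2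
    rw [dist_comm, dist_eq_norm] at hwz
    nlinarith [h x, norm_nonneg x]
  have hinv : ‖((u⁻¹ : (E →L[ℂ] E)ˣ) : E →L[ℂ] E)‖ ≤ 2 / c := by
    refine ContinuousLinearMap.opNorm_le_bound _ (by positivity) fun y => ?_
    have h3 := hlow (((u⁻¹ : (E →L[ℂ] E)ˣ) : E →L[ℂ] E) y)
    rw [← mul_apply_eq_comp, Units.mul_inv, one_apply_eq_self] at h3
    rw [div_mul_eq_mul_div, le_div_iff₀ hc]
    linarith
  have hpos : 0 < ‖((u⁻¹ : (E →L[ℂ] E)ˣ) : E →L[ℂ] E)‖ := Units.norm_pos _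
  have hnear : ‖(algebraMap ℂ (E →L[ℂ] E) z - T) - u‖ <
      ‖((u⁻¹ : (E →L[ℂ] E)ˣ) : E →L[ℂ] E)‖⁻¹ := by
    rw [hu, sub_sub_sub_cancel_right, ← map_sub, norm_algebraMap', ← dist_eq_norm]
    refine lt_of_lt_of_le hwz ?_
    rw [← inv_div]
    exact inv_anti₀ hpos hinv
  exact (spectrum.mem_iff.1 hzs) (u.ofNearby _ hnear).isUnit

/-! ## Koopman operators of discrete-space systems -/

/-- The Hilbert space `ℓ²(ℕ)`. -/
abbrev EllTwo : Type := lp (fun _ : ℕ => ℂ) 2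

/-- The Koopman action `x ↦ x ∘ F` on sequences, with value `0` where `F` is `∞`. -/
def koopmanAction (F : ℕ → ℕ∞) (x : ℕ → ℂ) (j : ℕ) : ℂ :=
  if F j = ⊤ then 0 else x (F j).toNat

/-- The maps `F : ℕ → ℕ ∪ {∞}` whose Koopman operator is a bounded operator on `ℓ²(ℕ)`. -/
def DiscreteSystem : Type :=
  {F : ℕ → ℕ∞ // ∃ K : EllTwo →L[ℂ] EllTwo, ∀ (x : EllTwo) (j : ℕ), K x j = koopmanAction F x j}

/-- The Koopman operator on `ℓ²(ℕ)`; it is determined by its action on sequences. -/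
noncomputable def koopman (F : DiscreteSystem) : EllTwo →L[ℂ] EllTwo := F.2.choose

instance ellTwo_nontrivial : Nontrivial EllTwo :=
  ⟨⟨lp.single 2 0 1, 0, fun h => by
    have := congrArg (fun x : EllTwo => x 0) h
    simp at this⟩⟩

/-- `Sp(K_F)` as a non-empty compact set. -/
noncomputable def koopmanSpectrum (F : DiscreteSystem) : HausdorffSpace where
  carrier := spectrum ℂ (koopman F)
  isCompact' := spectrum.isCompact _
  nonempty' := spectrum.nonempty _

/-- `Sp_ap(K_F)` as a non-empty compact set. -/
noncomputable def koopmanApproximatePointSpectrum (F : DiscreteSystem) : HausdorffSpace where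
  carrier := approximatePointSpectrum (koopman F)
  isCompact' := isCompact_approximatePointSpectrum _
  nonempty' := approximatePointSpectrum_nonempty _

open Classical in
/-- The evaluations `F ↦ δ_{F(j), i}`, indexed by `(i, j)`. -/
noncomputable def sample (F : DiscreteSystem) (ij : ℕ × ℕ) : ℂ :=
  if F.1 ij.2 = (ij.1 : ℕ∞) then 1 else 0

theorem sample_injective {F G : DiscreteSystem} (h : ∀ ij, sample F ij = sample G ij) : F = G := by
  have key : ∀ i j : ℕ, F.1 j = (i : ℕ∞) ↔ G.1 j = (i : ℕ∞) := by
    intro i j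
    have := h (i, j)
    unfold sample at this
    by_cases h1 : F.1 j = (i : ℕ∞) <;> by_cases h2 : G.1 j = (i : ℕ∞) <;> simp_all
  refine Subtype.ext (funext fun j => ?_)
  cases hF : F.1 j with
  | coe n => exact ((key n j).1 hF).symm
  | top =>
    cases hG : G.1 j with
    | coe n => exact absurd ((key n j).2 hG) (by simp [hF])
    | top => rfl

/-- Learning a set `Ξ F` from the samples of `F`. -/
noncomputable def sampleProblem (Ξ : DiscreteSystem → HausdorffSpace) :
    ComputationalProblem DiscreteSystem (ℕ × ℕ) where
  eval := sample
  Ξ := Ξ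
  determined F G hne := by
    by_contra hc
    push Not at hc
    exact hne (by rw [sample_injective hc])

/-! Lower bound. If two successive limits of locally constant functions separate a property from its
negation by a threshold, the property is a countable union of `G_δ` sets. Having infinitely many
finite columns is not such a property of Boolean matrices: Baire category and a construction by
finite extensions show this in `not_exists_open_frequentlyColumnFinite_iff`. A matrix is coded into
a partial injection of ℕ in which column `i` becomes a chain. The chain is finite, with at least
`2(i+1)` nodes, if the column is finite, and infinite in both directions otherwise; all other points
are sent to ∞. The Koopman operator is then an orthogonal sum of nilpotent Jordan blocks, bilateral
shifts and zeros.

Blocks of unbounded size put the whole open unit disc into the approximate point spectrum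
(`mem_approximatePointSpectrum_koopman_ofPartialInjection`). If there are only finitely many chains
of finite length, the spectrum has no point with `0 < |z| < 1`
(`notMem_spectrum_koopman_ofPartialInjection`). So the distance from `1/2` to Ξ(F) tells the two
cases apart, for both choices of Ξ, because `Sp_ap ⊆ Ξ ⊆ Sp`. Every sample of the coded system
depends on finitely many matrix entries, hence a tower of height two would decide the matrix
property in two limits. Exact input is a special inexact input, so the bound passes to the inexact
problems.

Upper bound. The spectrum of `T` consists of `Sp_ap(T)` and the conjugates of `Sp_ap(T*)`
(`mem_spectrum_iff_approximatePointSpectrum`). Take the grid points `z` of mesh `2^(-n-2)` for which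
some finitely supported `v` with Gaussian integer entries has `‖(T - z)v‖ < 2^(-n)‖v‖`, or the same
for the adjoint and the conjugate of `z`. They form a finite set, every point of Ξ(F) is within
`2^(-n)` of it, and as `n` grows it converges to Ξ(F). The second limit exhausts the vectors and
grid points. The innermost limit enlarges the window of matrix entries: columns of a bounded 0-1
matrix are finite, so each test is exact for large windows
(`HasBinaryMatrix.eventually_windowTest_iff`). The tests use integer arithmetic and are primitive
recursive in the bits read. Hence they run on oracle Turing machines and on BSS machines, and a bit
can be recovered from an approximation with error `1/4`. -/

/-! ## Koopman operators of partial maps -/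

/-- The map `ℕ → ℕ ∪ {∞}` of a partial map of `ℕ`. -/
def optionToENat (f : ℕ → Option ℕ) (j : ℕ) : ℕ∞ := (f j).elim ⊤ (fun i => (i : ℕ∞))

theorem koopmanAction_optionToENat (f : ℕ → Option ℕ) (x : ℕ → ℂ) (j : ℕ) :
    koopmanAction (optionToENat f) x j = (f j).elim 0 x := by
  unfold koopmanAction optionToENat
  cases f j <;> simp

theorem koopman_apply (F : DiscreteSystem) (x : EllTwo) (j : ℕ) :
    koopman F x j = koopmanAction F.1 x j := F.2.choose_spec x j

/-- Pulling back a summable family along a partial injection, with partial inverse `g`, does not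
increase its sum. -/
theorem summable_option_elim {f g : ℕ → Option ℕ} (hg : ∀ j i, f j = some i → g i = some j)
    {u : ℕ → ℝ} (hu : Summable u) (h0 : ∀ i, 0 ≤ u i) :
    Summable (fun j => (f j).elim 0 u) ∧ ∑' j, (f j).elim 0 u ≤ ∑' i, u i := by
  have key : ∀ s : Finset ℕ, ∑ j ∈ s, (f j).elim 0 u ≤ ∑' i, u i := by
    intro s
    have h1 : ∑ j ∈ s, (f j).elim 0 u =
        ∑ j ∈ s.filter (fun j => (f j).isSome), u ((f j).getD 0) := by
      rw [Finset.sum_filter]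
      refine Finset.sum_congr rfl fun j _ => ?_
      cases f j <;> simp
    -- The partial inverse `g` recovers `j` from its image, so the surviving terms are values of `u`
    -- at distinct indices.
    rw [h1, ← Finset.sum_image (g := fun j => (f j).getD 0) (f := u)]
    · exact hu.sum_le_tsum _ fun i _ => h0 i
    · intro a ha b hb hab
      simp only [Finset.coe_filter, Set.mem_ofPred_eq] at ha hb
      obtain ⟨i, hi⟩ := Option.isSome_iff_exists.1 ha.2
      obtain ⟨k, hk⟩ := Option.isSome_iff_exists.1 hb.2
      simp only [hi, hk, Option.getD_some] at hab
      have e1 := hg a i hi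
      have e2 := hg b k hk
      rw [hab, e2] at e1
      exact (Option.some.inj e1).symm
  have hs : Summable (fun j => (f j).elim 0 u) :=
    summable_of_sum_le (fun j => by cases f j <;> simp [h0]) key
  exact ⟨hs, hs.tsum_le_of_sum_le key⟩

/-- The Koopman operator of a partial injection is a contraction. -/
theorem exists_koopman_of_leftInverse {f g : ℕ → Option ℕ}
    (hg : ∀ j i, f j = some i → g i = some j) :
    ∃ K : EllTwo →L[ℂ] EllTwo, ‖K‖ ≤ 1 ∧ ∀ (x : EllTwo) (j : ℕ), K x j = (f j).elim 0 x := by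
  have hsum : ∀ x : EllTwo, Summable fun i => ‖x i‖ ^ (2 : ℝ) := fun x => by
    simpa using (lp.memℓp x).summable (by simp)
  have hcong : ∀ (x : EllTwo) (j : ℕ), ‖(f j).elim (0 : ℂ) x‖ ^ (2 : ℝ) =
      (f j).elim 0 (fun i => ‖x i‖ ^ (2 : ℝ)) := fun x j => by
    cases f j <;> simp
  have hmem : ∀ x : EllTwo, Memℓp (fun j => (f j).elim (0 : ℂ) x) 2 := fun x => by
    refine memℓp_gen ?_
    simp only [ENNReal.toReal_ofNat, hcong]
    exact (summable_option_elim hg (hsum x) fun _ => by positivity).1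
  let L : EllTwo →ₗ[ℂ] EllTwo :=
    { toFun := fun x => ⟨fun j => (f j).elim (0 : ℂ) x, hmem x⟩
      map_add' := fun x y => by
        ext j
        change (f j).elim (0 : ℂ) ⇑(x + y) = (f j).elim (0 : ℂ) x + (f j).elim (0 : ℂ) y
        rw [lp.coeFn_add]
        cases f j
        · exact (add_zero _).symm
        · rfl
      map_smul' := fun c x => by
        ext j
        change (f j).elim (0 : ℂ) ⇑(c • x) = c • (f j).elim (0 : ℂ) x
        rw [lp.coeFn_smul]
        cases f j
        · exact (smul_zero _).symm
        · rfl }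
  have hL : ∀ x, ‖L x‖ ≤ 1 * ‖x‖ := fun x => by
    rw [one_mul]
    have h2 : (0 : ℝ) < (2 : ENNReal).toReal := by simp
    refine (Real.rpow_le_rpow_iff (norm_nonneg _) (norm_nonneg _) h2).1 ?_
    rw [lp.norm_rpow_eq_tsum h2, lp.norm_rpow_eq_tsum h2]
    simp only [ENNReal.toReal_ofNat]
    have := (summable_option_elim hg (hsum x) fun _ => by positivity).2
    refine le_trans (le_of_eq (tsum_congr fun j => ?_)) this
    exact hcong x j
  exact ⟨L.mkContinuous 1 hL, L.mkContinuous_norm_le zero_le_one hL, fun x j => rfl⟩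

/-- The discrete system of a partial injection. -/
def DiscreteSystem.ofPartialInjection (f g : ℕ → Option ℕ)
    (hg : ∀ j i, f j = some i → g i = some j) : DiscreteSystem :=
  ⟨optionToENat f, by
    obtain ⟨K, -, hK⟩ := exists_koopman_of_leftInverse hg
    exact ⟨K, fun x j => by rw [hK, koopmanAction_optionToENat]⟩⟩

/-- The iterates of a partial map. -/
def optionIterate {α : Type} (f : α → Option α) : ℕ → α → Option α
  | 0, j => some j
  | n + 1, j => (f j).bind (optionIterate f n)

theorem optionIterate_succ' {α : Type} (f : α → Option α) (n : ℕ) (j : α) :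
    optionIterate f (n + 1) j = (optionIterate f n j).bind f := by
  induction n generalizing j with
  | zero => cases h : f j <;> simp [optionIterate, h]
  | succ n ih =>
    rw [optionIterate]
    cases h : f j with
    | none => simp [optionIterate, h]
    | some k => simp [optionIterate, h, ← ih]

theorem pow_apply_of_optionIterate {f : ℕ → Option ℕ} {K : EllTwo →L[ℂ] EllTwo}
    (hK : ∀ (x : EllTwo) (j : ℕ), K x j = (f j).elim 0 x) (n : ℕ) (x : EllTwo) (j : ℕ) :
    (K ^ n) x j = (optionIterate f n j).elim 0 x := by
  induction n generalizing j with
  | zero => simp [optionIterate]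
  | succ n ih =>
    rw [pow_succ', mul_apply_eq_comp, hK, optionIterate]
    cases f j with
    | none => simp
    | some k => exact ih k

/-- If `m` inverts `k` on both sides of a power of `k`, then the spectrum of `k` has no points `z`
with `0 < |z|` and `|z| ‖m‖ < 1`. -/
theorem isUnit_sub_algebraMap_of_pow_mul {A : Type*} [NormedRing A] [NormedAlgebra ℂ A]
    [CompleteSpace A] {k m : A} {N : ℕ} (h1 : k ^ (N + 1) * m = k ^ N)
    (h2 : m * k ^ (N + 1) = k ^ N) {z : ℂ} (hz : z ≠ 0) (hm : ‖z • m‖ < 1) :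
    IsUnit (k - algebraMap ℂ A z) := by
  obtain ⟨u, hu⟩ := isUnit_one_sub_of_norm_lt_one hm
  set d := k - algebraMap ℂ A z with hd
  have hcd : Commute k d := (Commute.refl k).sub_right (Algebra.commutes z k).symm
  obtain ⟨q, hq, hcq⟩ : ∃ q, k ^ N - algebraMap ℂ A (z ^ N) = d * q ∧ Commute d q := by
    have hcz : Commute k (algebraMap ℂ A z) := (Algebra.commutes z k).symm
    refine ⟨∑ i ∈ Finset.range N, k ^ i * algebraMap ℂ A z ^ (N - 1 - i), ?_, ?_⟩
    · rw [map_pow, hd, hcz.mul_geom_sum₂]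
    · refine Commute.sum_right _ _ _ fun i _ => Commute.mul_right ?_ ?_
      · exact (hcd.symm).pow_right i
      · exact Commute.pow_right (Algebra.commutes z d).symm _
  -- By `h1`, `d k^N m = k^(N+1) m - z k^N m = k^N (1 - z m) = k^N u`; `e2` is the mirror image.
  have e1 : k ^ N = d * (k ^ N * m * ↑u⁻¹) := by
    have : k ^ N * (u : A) = d * (k ^ N * m) := by
      rw [hu, ← mul_assoc, ← (hcd.pow_left N).eq, mul_assoc, hd, sub_mul, mul_sub, mul_sub, mul_one,
        ← mul_assoc, ← pow_succ, h1, Algebra.smul_def]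
    rw [← mul_assoc, ← this, Units.mul_inv_cancel_right]
  have e2 : k ^ N = (↑u⁻¹ * m * k ^ N) * d := by
    have : (u : A) * k ^ N = m * k ^ N * d := by
      rw [hu, hd, mul_sub, mul_assoc m, ← pow_succ, h2, sub_mul, one_mul, ← Algebra.commutes,
        Algebra.smul_def, mul_assoc]
    rw [mul_assoc, mul_assoc, ← mul_assoc m, ← this, Units.inv_mul_cancel_left]
  have hzN : z ^ N ≠ 0 := pow_ne_zero _ hz
  -- Both `k^N` and `k^N - z^N` are multiples of `d` on either side, hence so is the invertible
  -- scalar `z^N`.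
  have f1 : d * (k ^ N * m * ↑u⁻¹ - q) = algebraMap ℂ A (z ^ N) := by
    rw [mul_sub, ← e1, ← hq]; abel
  have f2 : (↑u⁻¹ * m * k ^ N - q) * d = algebraMap ℂ A (z ^ N) := by
    rw [sub_mul, ← e2, ← hcq.eq, ← hq]; abel
  have hun : IsUnit (algebraMap ℂ A (z ^ N)) := (IsUnit.mk0 _ hzN).map (algebraMap ℂ A)
  obtain ⟨v, hv⟩ := hun
  refine isUnit_iff_exists.2 ?_
  have r1 : d * ((k ^ N * m * ↑u⁻¹ - q) * ↑v⁻¹) = 1 := by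
    rw [← mul_assoc, f1, ← hv, Units.mul_inv]
  have r2 : (↑v⁻¹ * (↑u⁻¹ * m * k ^ N - q)) * d = 1 := by
    rw [mul_assoc, f2, ← hv, Units.inv_mul]
  exact ⟨_, r1, by rw [← left_inv_eq_right_inv r2 r1]; exact r2⟩

/-- If after `N` steps no point dies and only points with a preimage are alive, then the spectrum of
the Koopman operator of the partial injection has no point with `0 < |z| < 1`. -/
theorem notMem_spectrum_koopman_ofPartialInjection {f g : ℕ → Option ℕ}
    (hg : ∀ j i, f j = some i → g i = some j) (hf : ∀ j i, g j = some i → f i = some j) {N : ℕ}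
    (h1 : ∀ j, (optionIterate f N j).isSome → (optionIterate f (N + 1) j).isSome)
    (h2 : ∀ j, (optionIterate f N j).isSome → (g j).isSome) {z : ℂ} (hz : z ≠ 0) (hz1 : ‖z‖ < 1) :
    z ∉ spectrum ℂ (koopman (.ofPartialInjection f g hg)) := by
  set K := koopman (.ofPartialInjection f g hg) with hKdef
  have hK : ∀ (x : EllTwo) (j : ℕ), K x j = (f j).elim 0 x := fun x j => by
    rw [hKdef, koopman_apply]
    exact koopmanAction_optionToENat f x j
  -- `M` is the Koopman operator of the inverse partial map. It inverts `K` wherever `f^N` is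
  -- defined, and elsewhere both sides of `e1` and `e2` vanish.
  obtain ⟨M, hM1, hM⟩ := exists_koopman_of_leftInverse hf
  have e1 : K ^ (N + 1) * M = K ^ N := by
    ext x j
    rw [mul_apply_eq_comp, pow_apply_of_optionIterate hK, pow_apply_of_optionIterate hK]
    have := h1 j
    rw [optionIterate_succ'] at this ⊢
    cases h : optionIterate f N j with
    | none => simp
    | some k =>
      rw [h] at this
      obtain ⟨i, hi⟩ := Option.isSome_iff_exists.1 (this rfl)
      simp only [Option.bind_some] at hi
      simp [hi, hM, hg k i hi]
  have e2 : M * K ^ (N + 1) = K ^ N := by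
    ext x j
    rw [mul_apply_eq_comp, hM, pow_apply_of_optionIterate hK]
    cases h : g j with
    | none =>
      cases h' : optionIterate f N j with
      | none => simp
      | some k => simpa [h, h'] using h2 j
    | some i =>
      simp only [Option.elim_some]
      rw [pow_apply_of_optionIterate hK, optionIterate, hf j i h]
      simp
  have := isUnit_sub_algebraMap_of_pow_mul e1 e2 hz (by
    rw [norm_smul]
    nlinarith [norm_nonneg z, norm_nonneg M])
  rw [spectrum.mem_iff, not_not, ← neg_sub]
  exact this.neg

/-- A partial injection with points that have no preimage and live arbitrarily long has the open
unit disc in its approximate point spectrum. -/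
theorem mem_approximatePointSpectrum_koopman_ofPartialInjection {f g : ℕ → Option ℕ}
    (hg : ∀ j i, f j = some i → g i = some j) (hf : ∀ j i, g j = some i → f i = some j)
    (h : ∀ n, ∃ j, g j = none ∧ (optionIterate f n j).isSome) {z : ℂ} (hz : ‖z‖ < 1) :
    z ∈ approximatePointSpectrum (koopman (.ofPartialInjection f g hg)) := by
  set K := koopman (.ofPartialInjection f g hg) with hKdef
  have hK : ∀ (x : EllTwo) (j : ℕ), K x j = (f j).elim 0 x := fun x j => by
    rw [hKdef, koopman_apply]
    exact koopmanAction_optionToENat f x j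
  have hKsingle : ∀ i, K (lp.single 2 i 1) = (g i).elim 0 (fun j => lp.single 2 j 1) := fun i => by
    ext j
    rw [hK]
    cases hj : f j with
    | none =>
      cases hi : g i with
      | none => simp
      | some k =>
        have : k ≠ j := by
          rintro rfl
          simp [hf i k hi] at hj
        simp [lp.single_apply, this.symm]
    | some k =>
      have h1 := hg j k hj
      by_cases hki : k = i
      · subst hki
        simp [h1, lp.single_apply]
      · cases hi : g i with
        | none => simp [lp.single_apply, hki]
        | some l =>
          have : j ≠ l := by
            rintro rfl
            have := hf i j hi
            rw [hj] at this
            exact hki (Option.some.inj this)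
          simp [lp.single_apply, hki, this]
  by_contra hcon
  obtain ⟨c, hc, hlow⟩ := (notMem_approximatePointSpectrum_iff _ _).1 hcon
  obtain ⟨n, hn⟩ := exists_pow_lt_of_lt_one hc hz
  obtain ⟨j, hj, hlife⟩ := h n
  -- Basis vectors along the orbit of a point `j` without preimage: `K` moves them one step back and
  -- kills `e 0`. So `∑ z^k e_k` up to `k = n` is an eigenvector up to the error `-z^(n+1) e_n`.
  set e : ℕ → EllTwo := fun k => (optionIterate f k j).elim 0 (fun i => lp.single 2 i 1) with he
  have hKe : ∀ k, k < n → K (e (k + 1)) = e k := by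
    intro k hk
    have hsome : ∀ m, m ≤ n → (optionIterate f m j).isSome := by
      intro m hm
      refine Nat.decreasingInduction' (fun k _ _ ih => ?_) hm hlife
      rw [optionIterate_succ'] at ih
      cases h' : optionIterate f k j <;> simp_all
    obtain ⟨a, ha⟩ := Option.isSome_iff_exists.1 (hsome (k + 1) hk)
    obtain ⟨b, hb⟩ := Option.isSome_iff_exists.1 (hsome k hk.le)
    have hab : f b = some a := by
      rw [optionIterate_succ', hb] at ha
      exact ha
    simp [he, ha, hb, hKsingle, hg b a hab]
  have hKe0 : K (e 0) = 0 := by simp [he, optionIterate, hKsingle, hj]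
  have hsum : ∀ m, m ≤ n → K (∑ k ∈ Finset.range (m + 1), z ^ k • e k) -
      z • ∑ k ∈ Finset.range (m + 1), z ^ k • e k = - (z ^ (m + 1) • e m) := by
    intro m
    induction m with
    | zero => intro _; simp [hKe0]
    | succ m ih =>
      intro hm
      rw [Finset.sum_range_succ, map_add, smul_add, add_sub_add_comm, ih (by omega), map_smul,
        hKe m (by omega), smul_smul, ← pow_succ']
      abel
  have hlow' := hlow (∑ k ∈ Finset.range (n + 1), z ^ k • e k)
  rw [hsum n le_rfl, norm_neg, norm_smul, norm_pow] at hlow'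
  have he1 : ‖e n‖ ≤ 1 := by
    simp only [he]
    cases optionIterate f n j <;> simp [lp.norm_single]
  -- The orbit never returns to `j`, which has no preimage, so the coordinate at `j` is exactly `1`.
  have hx1 : 1 ≤ ‖∑ k ∈ Finset.range (n + 1), z ^ k • e k‖ := by
    refine le_trans (le_of_eq ?_) (lp.norm_apply_le_norm (by simp) _ j)
    have hzero : ∀ k, (e (k + 1)) j = 0 := by
      intro k
      simp only [he]
      cases hk : optionIterate f (k + 1) j with
      | none => simp
      | some i =>
        have : i ≠ j := by
          rintro rfl
          rw [optionIterate_succ'] at hk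
          cases hb : optionIterate f k i with
          | none => simp [hb] at hk
          | some b =>
            rw [hb] at hk
            simp [hg b i hk] at hj
        simp [lp.single_apply, this.symm]
    rw [Finset.sum_range_succ', lp.coeFn_add, Pi.add_apply, lp.coeFn_sum, Finset.sum_apply,
      Finset.sum_eq_zero fun k _ => by simp [hzero]]
    simp [he, optionIterate, lp.single_apply]
  have : ‖z‖ ^ (n + 1) ≤ ‖z‖ ^ n := pow_le_pow_of_le_one (norm_nonneg z) hz.le (by omega)
  have hp : 0 ≤ ‖z‖ ^ (n + 1) := by positivity
  nlinarith

/-! ## Infinitely many finite columns: a set that is not a countable union of `G_δ` sets -/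

/-- The `i`-th column of `a` has finitely many non-zero entries. -/
def ColumnFinite (a : ℕ × ℕ → Bool) (i : ℕ) : Prop := {t | a (i, t) = true}.Finite

/-- Infinitely many columns are finite. -/
def FrequentlyColumnFinite (a : ℕ × ℕ → Bool) : Prop := ∃ᶠ i in atTop, ColumnFinite a i

theorem isOpen_exists_ge_entry (i n : ℕ) :
    IsOpen {a : ℕ × ℕ → Bool | ∃ t ≥ n, a (i, t) = true} := by
  have : {a : ℕ × ℕ → Bool | ∃ t ≥ n, a (i, t) = true} =
      ⋃ t ≥ n, (fun a : ℕ × ℕ → Bool => a (i, t)) ⁻¹' {true} := by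
    ext a; simp
  rw [this]
  exact isOpen_biUnion fun t _ => (isOpen_discrete _).preimage (continuous_apply _)

theorem exists_finset_agree_of_mem_isOpen {U : Set (ℕ × ℕ → Bool)} (hU : IsOpen U)
    {a : ℕ × ℕ → Bool} (ha : a ∈ U) :
    ∃ s : Finset (ℕ × ℕ), ∀ b, (∀ p ∈ s, b p = a p) → b ∈ U := by
  obtain ⟨s, u, hu, hsub⟩ := isOpen_pi_iff.1 hU a ha
  exact ⟨s, fun b hb => hsub fun p hp => by rw [hb p hp]; exact (hu p hp).2⟩

/-- A basic open set fixes finitely many entries and leaves room for a later `true` in the column.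
By Baire, generic matrices therefore have only infinite columns. -/
theorem dense_exists_ge_entry (i n : ℕ) :
    Dense {a : ℕ × ℕ → Bool | ∃ t ≥ n, a (i, t) = true} := by
  rw [dense_iff_inter_open]
  rintro U hU ⟨a, ha⟩
  obtain ⟨s, hs⟩ := exists_finset_agree_of_mem_isOpen hU ha
  obtain ⟨t, ht⟩ := Infinite.exists_notMem_finset (s.image Prod.snd ∪ Finset.range n)
  simp only [Finset.mem_union, Finset.mem_image, Finset.mem_range, not_or, not_exists, not_and,
    not_lt] at ht
  refine ⟨Function.update a (i, t) true, hs _ fun p hp => ?_, t, ht.2, by simp⟩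
  rw [Function.update_of_ne]
  rintro rfl
  exact ht.1 _ hp rfl

/-- One step of the diagonal argument: a `G_δ` set of matrices with infinitely many finite columns
can be avoided by fixing finitely many entries, when finitely many columns are prescribed. -/
theorem exists_avoid_of_subset_frequentlyColumnFinite {U : ℕ → Set (ℕ × ℕ → Bool)}
    (hU : ∀ m, IsOpen (U m)) (hP : ∀ a, (∀ m, a ∈ U m) → FrequentlyColumnFinite a)
    (a₀ : ℕ × ℕ → Bool) (k : ℕ) (s : Finset (ℕ × ℕ)) :
    ∃ (a₁ : ℕ × ℕ → Bool) (s₁ : Finset (ℕ × ℕ)), s ⊆ s₁ ∧ (∀ p ∈ s, a₁ p = a₀ p) ∧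
      (∀ p : ℕ × ℕ, p.1 < k → a₁ p = a₀ p) ∧ ColumnFinite a₁ k ∧
      ∀ b, (∀ p ∈ s₁, b p = a₁ p) → (∀ p : ℕ × ℕ, p.1 < k → b p = a₁ p) → ∃ m, b ∉ U m := by
  classical
  let φ : (ℕ × ℕ → Bool) → (ℕ × ℕ → Bool) := fun a p => if p.1 < k ∨ p ∈ s then a₀ p else a p
  have hφ : Continuous φ := by
    refine continuous_pi fun p => ?_
    by_cases hp : p.1 < k ∨ p ∈ s
    · simp only [φ, hp, if_true]; exact continuous_const
    · simp only [φ, hp, if_false]; exact continuous_apply p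
  -- Otherwise Baire gives a matrix `a` with all columns infinite and `φ a` in every `U m`. Then `φ
  -- a` has a finite column beyond the first `k`, although `φ` alters only finitely many entries
  -- there.
  have hnd : ∃ m, ¬ Dense (φ ⁻¹' U m) := by
    by_contra! hd
    have h1 : Dense (⋂ m, φ ⁻¹' U m) :=
      dense_iInter_of_isOpen_nat (fun m => (hU m).preimage hφ) hd
    have h1' : IsGδ (⋂ m, φ ⁻¹' U m) := .iInter_of_isOpen fun m => (hU m).preimage hφ
    have h2 : Dense (⋂ q : ℕ × ℕ, {a : ℕ × ℕ → Bool | ∃ t ≥ q.2, a (q.1, t) = true}) :=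
      dense_iInter_of_isOpen (fun q => isOpen_exists_ge_entry _ _)
        fun q => dense_exists_ge_entry _ _
    have h2' : IsGδ (⋂ q : ℕ × ℕ, {a : ℕ × ℕ → Bool | ∃ t ≥ q.2, a (q.1, t) = true}) :=
      .iInter_of_isOpen fun q => isOpen_exists_ge_entry _ _
    obtain ⟨a, ha1, ha2⟩ := (h1.inter_of_Gδ h1' h2' h2).nonempty
    simp only [Set.mem_iInter, Set.mem_preimage] at ha1 ha2
    obtain ⟨i, hi, hfin⟩ := frequently_atTop.1 (hP (φ a) ha1) k
    have hinf : {t | a (i, t) = true}.Infinite := by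
      intro hf
      obtain ⟨n, hn⟩ := hf.bddAbove
      obtain ⟨t, ht, hat⟩ := ha2 (i, n + 1)
      have := hn hat
      omega
    refine hinf ((hfin.union (s.image Prod.snd).finite_toSet).subset fun t ht => ?_)
    by_cases hts : (i, t) ∈ s
    · right
      simp only [Finset.coe_image, Set.mem_image]
      exact ⟨(i, t), hts, rfl⟩
    · left
      simp only [φ, Set.mem_ofPred_eq]
      rw [if_neg (by simp [hts]; omega)]
      exact ht
  obtain ⟨m, hm⟩ := hnd
  obtain ⟨a, ha⟩ : ((closure (φ ⁻¹' U m))ᶜ).Nonempty := by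
    rw [Set.nonempty_compl]
    exact fun h => hm (dense_iff_closure_eq.2 h)
  obtain ⟨τ, hτ⟩ := exists_finset_agree_of_mem_isOpen isClosed_closure.isOpen_compl ha
  -- Prescribed entries take precedence over the neighbourhood `τ`; zeros elsewhere make column `k`
  -- finite.
  refine ⟨fun p => if p.1 < k ∨ p ∈ s then a₀ p else if p ∈ τ then a p else false, s ∪ τ,
    Finset.subset_union_left, fun p hp => by simp [hp], fun p hp => by simp [hp], ?_, ?_⟩
  · refine ((s ∪ τ).image Prod.snd).finite_toSet.subset fun t ht => ?_
    simp only [Finset.coe_image, Set.mem_image]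
    refine ⟨(k, t), ?_, rfl⟩
    by_contra hn
    simp only [Finset.coe_union, Set.mem_union, Finset.mem_coe, not_or] at hn
    simp [hn.1, hn.2] at ht
  · intro b hb hbk
    refine ⟨m, fun hbU => ?_⟩
    -- `b` may differ from `a` at places of `τ` that are prescribed. Resetting them puts `b'` in the
    -- neighbourhood of `a`, and `φ` undoes the reset.
    let b' : ℕ × ℕ → Bool := fun p => if p ∈ τ then a p else b p
    have hb' : φ b' = b := by
      funext p
      by_cases hp : p.1 < k ∨ p ∈ s
      · simp only [φ, hp, if_true]
        rcases hp with hp | hp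
        · simpa [hp] using (hbk p hp).symm
        · simpa [hp] using (hb p (by simp [hp])).symm
      · by_cases hpτ : p ∈ τ
        · simpa [φ, b', hp, hpτ] using (hb p (by simp [hpτ])).symm
        · simp [φ, b', hp, hpτ]
    refine hτ b' (fun p hp => by simp [b', hp]) (subset_closure ?_)
    rw [Set.mem_preimage, hb']
    exact hbU

/-- The set of matrices with infinitely many finite columns is not a countable union of
countable intersections of open sets. -/
theorem not_exists_open_frequentlyColumnFinite_iff :
    ¬ ∃ U : ℕ → ℕ → Set (ℕ × ℕ → Bool), (∀ n m, IsOpen (U n m)) ∧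
      ∀ a, FrequentlyColumnFinite a ↔ ∃ n, ∀ m, a ∈ U n m := by
  rintro ⟨U, hU, hP⟩
  choose nextA nextS hsub hagree hcol hfin havoid using fun n =>
    exists_avoid_of_subset_frequentlyColumnFinite (hU n) (fun a ha => (hP a).2 ⟨n, ha⟩)
  -- Stage `n` leaves the `n`-th `G_δ` set for good and makes column `n` finite. Later stages keep
  -- the columns up to `n` and the finitely many frozen entries.
  let st : ℕ → (ℕ × ℕ → Bool) × Finset (ℕ × ℕ) := fun n =>
    Nat.rec (fun _ => false, ∅) (fun n p => (nextA n p.1 n p.2, nextS n p.1 n p.2)) n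
  have hst : ∀ n, st (n + 1) = (nextA n (st n).1 n (st n).2, nextS n (st n).1 n (st n).2) :=
    fun n => rfl
  have hSmono : Monotone fun n => (st n).2 := monotone_nat_of_le_succ fun n => by
    rw [hst]; exact hsub _ _ _ _
  have hS : ∀ n m, n ≤ m → ∀ p ∈ (st n).2, (st m).1 p = (st n).1 p := by
    intro n m hnm
    induction m, hnm using Nat.le_induction with
    | base => exact fun _ _ => rfl
    | succ m hnm ih =>
      intro p hp
      rw [← ih p hp, hst]
      exact hagree _ _ _ _ p (hSmono hnm hp)
  have hC : ∀ n m, n ≤ m → ∀ p : ℕ × ℕ, p.1 < n → (st m).1 p = (st n).1 p := by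
    intro n m hnm
    induction m, hnm using Nat.le_induction with
    | base => exact fun _ _ => rfl
    | succ m hnm ih =>
      intro p hp
      rw [← ih p hp, hst]
      exact hcol _ _ _ _ p (by omega)
  -- Column `i` is final from stage `i + 1` on.
  let a : ℕ × ℕ → Bool := fun p => (st (p.1 + 1)).1 p
  have haC : ∀ n (p : ℕ × ℕ), p.1 < n → a p = (st n).1 p := fun n p hp =>
    (hC (p.1 + 1) n hp p (by omega)).symm
  have haS : ∀ n, ∀ p ∈ (st n).2, a p = (st n).1 p := fun n p hp => by
    rcases le_total n (p.1 + 1) with h | h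
    · exact hS n _ h p hp
    · exact haC n p h
  have hafin : ∀ i, ColumnFinite a i := fun i => by
    have := hfin i (st i).1 i (st i).2
    have e : {t | a (i, t) = true} = {t | nextA i (st i).1 i (st i).2 (i, t) = true} := by
      ext t
      have : a (i, t) = nextA i (st i).1 i (st i).2 (i, t) := rfl
      simp [this]
    rw [ColumnFinite, e]
    exact this
  obtain ⟨n, hn⟩ := (hP a).1 (Frequently.of_forall hafin)
  obtain ⟨m, hm⟩ := havoid n (st n).1 n (st n).2 a
    (fun p hp => haS (n + 1) p hp) (fun p hp => haC (n + 1) p (by omega))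
  exact hm (hn m)

/-- A property of matrices that is decided by two successive limits of locally constant real
functions is not the property to have infinitely many finite columns. -/
theorem not_exists_two_limits_frequentlyColumnFinite
    (g : ℕ → ℕ → (ℕ × ℕ → Bool) → ℝ) (h : ℕ → (ℕ × ℕ → Bool) → ℝ) (r : (ℕ × ℕ → Bool) → ℝ)
    (hg : ∀ n m, IsLocallyConstant (g n m))
    (h1 : ∀ n a, Tendsto (fun m => g n m a) atTop (𝓝 (h n a)))
    (h2 : ∀ a, Tendsto (fun n => h n a) atTop (𝓝 (r a))) (c : ℝ)
    (hr : ∀ a, FrequentlyColumnFinite a → r a < c)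
    (hr' : ∀ a, ¬ FrequentlyColumnFinite a → c < r a) : False := by
  -- `q` codes a pair `(n, M)`. For fixed `N`, the intersection over `q` says that for every `n ≥ N`
  -- the values `g n m a` are below `c` for arbitrarily large `m`. This `∃∀∃` condition is
  -- equivalent to `r a < c`, as `r` never takes the value `c`.
  refine not_exists_open_frequentlyColumnFinite_iff ⟨fun N q =>
    {a | N ≤ q.unpair.1 → ∃ m ≥ q.unpair.2, g q.unpair.1 m a < c}, ?_, ?_⟩
  · intro N q
    by_cases hq : N ≤ q.unpair.1
    · have : {a | N ≤ q.unpair.1 → ∃ m ≥ q.unpair.2, g q.unpair.1 m a < c} =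
          ⋃ m ≥ q.unpair.2, g q.unpair.1 m ⁻¹' Set.Iio c := by
        ext a; simp [hq]
      beta_reduce
      rw [this]
      exact isOpen_biUnion fun m _ => hg _ m _
    · simp [hq]
  · intro a
    constructor
    · intro ha
      obtain ⟨N, hN⟩ := eventually_atTop.1 ((h2 a).eventually (gt_mem_nhds (hr a ha)))
      refine ⟨N, fun q hq => ?_⟩
      obtain ⟨M, hM⟩ := eventually_atTop.1 ((h1 q.unpair.1 a).eventually (gt_mem_nhds (hN _ hq)))
      exact ⟨max M q.unpair.2, le_max_right _ _, hM _ (le_max_left _ _)⟩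
    · rintro ⟨N, hN⟩
      by_contra ha
      obtain ⟨N', hN'⟩ := eventually_atTop.1 ((h2 a).eventually (lt_mem_nhds (hr' a ha)))
      obtain ⟨M, hM⟩ := eventually_atTop.1
        ((h1 (max N N') a).eventually (lt_mem_nhds (hN' _ (le_max_right _ _))))
      have := hN (Nat.pair (max N N') M)
      simp only [Nat.unpair_pair, Set.mem_ofPred_eq] at this
      obtain ⟨m, hm, hlt⟩ := this (le_max_left _ _)
      exact absurd (hM m hm) (not_lt.2 hlt.le)

/-! ## Discrete systems made of chains -/

open Classical in
/-- The partial map with a given functional graph. -/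
noncomputable def partialMapOfRel (R : ℕ → ℕ → Prop) (j : ℕ) : Option ℕ :=
  if h : ∃ i, R j i then some h.choose else none

theorem partialMapOfRel_eq_some {R : ℕ → ℕ → Prop} (hR : ∀ j i i', R j i → R j i' → i = i')
    (j i : ℕ) : partialMapOfRel R j = some i ↔ R j i := by
  unfold partialMapOfRel
  split_ifs with h
  · rw [Option.some_inj]
    exact ⟨fun e => e ▸ h.choose_spec, fun hi => hR j _ _ h.choose_spec hi⟩
  · simpa using fun hi => h ⟨i, hi⟩

theorem optionIterate_partialMapOfRel_isSome_succ {R : ℕ → ℕ → Prop}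
    (hR : ∀ j i i', R j i → R j i' → i = i') (n j : ℕ) :
    (optionIterate (partialMapOfRel R) (n + 1) j).isSome ↔
      ∃ i, R j i ∧ (optionIterate (partialMapOfRel R) n i).isSome := by
  rw [optionIterate]
  constructor
  · intro h
    cases hj : partialMapOfRel R j with
    | none => simp [hj] at h
    | some i => exact ⟨i, (partialMapOfRel_eq_some hR j i).1 hj, by simpa [hj] using h⟩
  · rintro ⟨i, hi, h⟩
    rw [(partialMapOfRel_eq_some hR j i).2 hi]
    exact h

/-- The active times in the `i`-th column: those up to `i` and those with a non-zero entry. -/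
def ActiveTime (a : ℕ × ℕ → Bool) (i t : ℕ) : Prop := t ≤ i ∨ a (i, t) = true

/-- Consecutive active times. -/
def ConsecutiveTimes (a : ℕ × ℕ → Bool) (i t t' : ℕ) : Prop :=
  ActiveTime a i t ∧ ActiveTime a i t' ∧ t < t' ∧ ∀ u, t < u → u < t' → ¬ ActiveTime a i u

theorem ConsecutiveTimes.right_unique {a : ℕ × ℕ → Bool} {i t u v : ℕ}
    (h : ConsecutiveTimes a i t u) (h' : ConsecutiveTimes a i t v) : u = v := by
  by_contra hne
  rcases lt_or_gt_of_ne hne with hlt | hlt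
  · exact h'.2.2.2 u h.2.2.1 hlt h.2.1
  · exact h.2.2.2 v h'.2.2.1 hlt h'.2.1

theorem ConsecutiveTimes.left_unique {a : ℕ × ℕ → Bool} {i t u v : ℕ}
    (h : ConsecutiveTimes a i u t) (h' : ConsecutiveTimes a i v t) : u = v := by
  by_contra hne
  rcases lt_or_gt_of_ne hne with hlt | hlt
  · exact h.2.2.2 v hlt h'.2.2.1 h'.1
  · exact h'.2.2.2 u hlt h.2.2.1 h.1

theorem exists_consecutiveTimes_of_lt {a : ℕ × ℕ → Bool} {i t u : ℕ} (ht : ActiveTime a i t)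
    (hu : ActiveTime a i u) (htu : t < u) : ∃ v, ConsecutiveTimes a i t v := by
  classical
  have hex : ∃ v, t < v ∧ ActiveTime a i v := ⟨u, htu, hu⟩
  exact ⟨Nat.find hex, ht, (Nat.find_spec hex).2, (Nat.find_spec hex).1,
    fun w hw hlt hact => Nat.find_min hex hlt ⟨hw, hact⟩⟩

theorem exists_consecutiveTimes_left {a : ℕ × ℕ → Bool} {i t : ℕ} (ht : ActiveTime a i t)
    (h0 : 0 < t) : ∃ v, ConsecutiveTimes a i v t := by
  classical
  have hz : ActiveTime a i 0 := Or.inl (Nat.zero_le i)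
  refine ⟨Nat.findGreatest (ActiveTime a i) (t - 1), ?_, ht, ?_, fun w hw hlt hact => ?_⟩
  · exact Nat.findGreatest_spec (Nat.zero_le _) hz
  · exact lt_of_le_of_lt (Nat.findGreatest_le _) (by omega)
  · exact Nat.findGreatest_is_greatest hw (by omega) hact

/-- The node of `ℕ` with a given column, time and side of the chain. -/
noncomputable def chainNode : ℕ × ℕ × Bool ≃ ℕ :=
  Classical.choice nonempty_equiv_of_countable

/-- The edges of the chain of each column: the active times downwards on one side, and then upwards
on the other side. -/
inductive ChainEdge (a : ℕ × ℕ → Bool) : ℕ → ℕ → Prop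
  | up (i t t' : ℕ) (h : ConsecutiveTimes a i t t') :
      ChainEdge a (chainNode (i, t, true)) (chainNode (i, t', true))
  | down (i t t' : ℕ) (h : ConsecutiveTimes a i t t') :
      ChainEdge a (chainNode (i, t', false)) (chainNode (i, t, false))
  | turn (i : ℕ) : ChainEdge a (chainNode (i, 0, false)) (chainNode (i, 0, true))

theorem chainEdge_iff (a : ℕ × ℕ → Bool) (p q : ℕ × ℕ × Bool) :
    ChainEdge a (chainNode p) (chainNode q) ↔ p.1 = q.1 ∧
      ((p.2.2 = true ∧ q.2.2 = true ∧ ConsecutiveTimes a p.1 p.2.1 q.2.1) ∨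
        (p.2.2 = false ∧ q.2.2 = false ∧ ConsecutiveTimes a p.1 q.2.1 p.2.1) ∨
        (p.2.2 = false ∧ q.2.2 = true ∧ p.2.1 = 0 ∧ q.2.1 = 0)) := by
  constructor
  · intro h
    generalize hx : chainNode p = x at h
    generalize hy : chainNode q = y at h
    cases h with
    | up i t t' h =>
      obtain rfl := chainNode.injective hx
      obtain rfl := chainNode.injective hy
      simp [h]
    | down i t t' h =>
      obtain rfl := chainNode.injective hx
      obtain rfl := chainNode.injective hy
      simp [h]
    | turn i =>
      obtain rfl := chainNode.injective hx
      obtain rfl := chainNode.injective hy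
      simp
  · obtain ⟨i, t, σ⟩ := p
    obtain ⟨i', t', σ'⟩ := q
    rintro ⟨rfl, ⟨rfl, rfl, h⟩ | ⟨rfl, rfl, h⟩ | ⟨rfl, rfl, rfl, rfl⟩⟩
    · exact .up _ _ _ h
    · exact .down _ _ _ h
    · exact .turn _

theorem ChainEdge.right_unique {a : ℕ × ℕ → Bool} (j i i' : ℕ) (h : ChainEdge a j i)
    (h' : ChainEdge a j i') : i = i' := by
  obtain ⟨⟨c, t, σ⟩, rfl⟩ := chainNode.surjective j
  obtain ⟨⟨c₁, t₁, σ₁⟩, rfl⟩ := chainNode.surjective i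
  obtain ⟨⟨c₂, t₂, σ₂⟩, rfl⟩ := chainNode.surjective i'
  rw [chainEdge_iff] at h h'
  obtain ⟨rfl, h⟩ := h
  obtain ⟨rfl, h'⟩ := h'
  rcases h with ⟨rfl, rfl, h⟩ | ⟨rfl, rfl, h⟩ | ⟨rfl, rfl, rfl, rfl⟩ <;>
    rcases h' with ⟨h1, rfl, h'⟩ | ⟨h1, rfl, h'⟩ | ⟨h1, rfl, h2, rfl⟩ <;>
    simp_all
  · exact h.right_unique h'
  · exact h.left_unique h'
  · exact absurd h.2.2.1 (by simp)
  · exact absurd h'.2.2.1 (by simp)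

theorem ChainEdge.left_unique {a : ℕ × ℕ → Bool} (j i i' : ℕ) (h : ChainEdge a i j)
    (h' : ChainEdge a i' j) : i = i' := by
  obtain ⟨⟨c, t, σ⟩, rfl⟩ := chainNode.surjective j
  obtain ⟨⟨c₁, t₁, σ₁⟩, rfl⟩ := chainNode.surjective i
  obtain ⟨⟨c₂, t₂, σ₂⟩, rfl⟩ := chainNode.surjective i'
  rw [chainEdge_iff] at h h'
  obtain ⟨rfl, h⟩ := h
  obtain ⟨rfl, h'⟩ := h'
  rcases h with ⟨rfl, rfl, h⟩ | ⟨rfl, rfl, h⟩ | ⟨rfl, rfl, rfl, rfl⟩ <;>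
    rcases h' with ⟨rfl, h1, h'⟩ | ⟨rfl, h1, h'⟩ | ⟨rfl, h1, rfl, h2⟩ <;>
    simp_all
  · exact h.left_unique h'
  · exact absurd h.2.2.1 (by simp)
  · exact h.right_unique h'
  · exact absurd h'.2.2.1 (by simp)

/-- Whether two times are consecutive active times is visible in the column up to the later one.
Linking consecutive active times, rather than marking where a column ends, is what makes the coding
local. -/
theorem chainEdge_congr {a b : ℕ × ℕ → Bool} (p q : ℕ × ℕ × Bool)
    (h : ∀ u ≤ max p.2.1 q.2.1, a (p.1, u) = b (p.1, u)) :
    ChainEdge a (chainNode p) (chainNode q) ↔ ChainEdge b (chainNode p) (chainNode q) := by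
  have hact : ∀ u ≤ max p.2.1 q.2.1, (ActiveTime a p.1 u ↔ ActiveTime b p.1 u) := fun u hu => by
    rw [ActiveTime, ActiveTime, h u hu]
  have hcons : ∀ t t', t ≤ max p.2.1 q.2.1 → t' ≤ max p.2.1 q.2.1 →
      (ConsecutiveTimes a p.1 t t' ↔ ConsecutiveTimes b p.1 t t') := fun t t' ht ht' => by
    unfold ConsecutiveTimes
    rw [hact t ht, hact t' ht']
    refine and_congr_right fun _ => and_congr_right fun _ => and_congr_right fun _ =>
      forall_congr' fun u => forall_congr' fun _ => ?_
    refine forall_congr' fun hu => ?_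
    rw [hact u (by omega)]
  rw [chainEdge_iff, chainEdge_iff, hcons _ _ (le_max_left _ _) (le_max_right _ _),
    hcons _ _ (le_max_right _ _) (le_max_left _ _)]

/-- The system of chains of a matrix. -/
noncomputable def chainSystem (a : ℕ × ℕ → Bool) : DiscreteSystem :=
  .ofPartialInjection (partialMapOfRel (ChainEdge a)) (partialMapOfRel fun j i => ChainEdge a i j)
    fun j i h => (partialMapOfRel_eq_some ChainEdge.left_unique i j).2
      ((partialMapOfRel_eq_some ChainEdge.right_unique j i).1 h)

theorem chainSystem_apply_eq_coe (a : ℕ × ℕ → Bool) (j i : ℕ) :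
    (chainSystem a).1 j = (i : ℕ∞) ↔ ChainEdge a j i := by
  rw [← partialMapOfRel_eq_some ChainEdge.right_unique]
  change optionToENat _ j = _ ↔ _
  unfold optionToENat
  cases partialMapOfRel (ChainEdge a) j with
  | none => simp
  | some k => simp

/-- Continuity of the coding: each sample is decided by finitely many entries of one column. -/
theorem eventually_sample_chainSystem_eq (a : ℕ × ℕ → Bool) (ij : ℕ × ℕ) :
    ∀ᶠ b in 𝓝 a, sample (chainSystem b) ij = sample (chainSystem a) ij := by
  obtain ⟨p, hp⟩ := chainNode.surjective ij.2
  obtain ⟨q, hq⟩ := chainNode.surjective ij.1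
  have hev : ∀ᶠ b in 𝓝 a, ∀ u ∈ Finset.range (max p.2.1 q.2.1 + 1), b (p.1, u) = a (p.1, u) := by
    rw [Finset.eventually_all]
    exact fun u _ => ((continuous_apply (p.1, u)).tendsto a).eventually
      (IsOpen.mem_nhds (isOpen_discrete {a (p.1, u)}) rfl)
  filter_upwards [hev] with b hb
  refine if_congr ?_ rfl rfl
  rw [chainSystem_apply_eq_coe, chainSystem_apply_eq_coe, ← hp, ← hq,
    chainEdge_congr p q fun u hu => hb u (Finset.mem_range.2 (by omega))]

/-! ### Lifetimes of points on finite and infinite chains -/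

section Life

variable {a : ℕ × ℕ → Bool}

theorem active_of_chainEdge {p q : ℕ × ℕ × Bool}
    (h : ChainEdge a (chainNode p) (chainNode q)) :
    p.1 = q.1 ∧ ActiveTime a p.1 p.2.1 ∧ ActiveTime a q.1 q.2.1 := by
  rw [chainEdge_iff] at h
  obtain ⟨h0, ⟨-, -, h⟩ | ⟨-, -, h⟩ | ⟨-, -, h, h'⟩⟩ := h
  · exact ⟨h0, h.1, h0 ▸ h.2.1⟩
  · exact ⟨h0, h.2.1, h0 ▸ h.1⟩
  · exact ⟨h0, by rw [h]; exact Or.inl (Nat.zero_le _), by rw [h']; exact Or.inl (Nat.zero_le _)⟩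

theorem exists_active_gt {i : ℕ} (h : ¬ ColumnFinite a i) (t : ℕ) :
    ∃ u, t < u ∧ ActiveTime a i u := by
  by_contra! hc
  refine h ((Set.finite_Iic t).subset fun u hu => ?_)
  by_contra hlt
  exact hc u (by simpa using hlt) (Or.inr hu)

theorem exists_bound_active {i : ℕ} (h : ColumnFinite a i) : ∃ T, ∀ t, ActiveTime a i t → t ≤ T := by
  obtain ⟨T, hT⟩ := h.bddAbove
  refine ⟨max i T, fun t ht => ?_⟩
  rcases ht with ht | ht
  · omega
  · have := hT ht
    omega

/-- Together with `exists_chainEdge_left`: the chain of an infinite column is infinite in both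
directions, so the map is a bijection on it. -/
theorem exists_chainEdge_right {i t : ℕ} {σ : Bool} (h : ¬ ColumnFinite a i)
    (ht : ActiveTime a i t) :
    ∃ q : ℕ × ℕ × Bool, ChainEdge a (chainNode (i, t, σ)) (chainNode q) := by
  obtain ⟨u, htu, hu⟩ := exists_active_gt h t
  cases σ with
  | true =>
    obtain ⟨v, hv⟩ := exists_consecutiveTimes_of_lt ht hu htu
    exact ⟨_, .up _ _ _ hv⟩
  | false =>
    rcases Nat.eq_zero_or_pos t with rfl | h0
    · exact ⟨_, .turn _⟩
    · obtain ⟨v, hv⟩ := exists_consecutiveTimes_left ht h0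
      exact ⟨_, .down _ _ _ hv⟩

theorem exists_chainEdge_left {i t : ℕ} {σ : Bool} (h : ¬ ColumnFinite a i)
    (ht : ActiveTime a i t) : ∃ j, ChainEdge a j (chainNode (i, t, σ)) := by
  obtain ⟨u, htu, hu⟩ := exists_active_gt h t
  cases σ with
  | false =>
    obtain ⟨v, hv⟩ := exists_consecutiveTimes_of_lt ht hu htu
    exact ⟨_, .down _ _ _ hv⟩
  | true =>
    rcases Nat.eq_zero_or_pos t with rfl | h0
    · exact ⟨_, .turn _⟩
    · obtain ⟨v, hv⟩ := exists_consecutiveTimes_left ht h0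
      exact ⟨_, .up _ _ _ hv⟩

theorem isSome_iterate_of_not_columnFinite {i : ℕ} (h : ¬ ColumnFinite a i) (n : ℕ) {t : ℕ}
    {σ : Bool} (ht : ActiveTime a i t) :
    (optionIterate (partialMapOfRel (ChainEdge a)) n (chainNode (i, t, σ))).isSome := by
  induction n generalizing t σ with
  | zero => rfl
  | succ n ih =>
    rw [optionIterate_partialMapOfRel_isSome_succ ChainEdge.right_unique]
    obtain ⟨⟨i', u, τ⟩, hq⟩ := exists_chainEdge_right (σ := σ) h ht
    obtain ⟨rfl, -, hu⟩ := active_of_chainEdge hq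
    exact ⟨_, hq, ih hu⟩

/-- On the ascending side the time grows at every step and stays at most `T`. On the descending side
there are at most `t` steps down, one turn, and `T` steps up. -/
theorem le_of_isSome_iterate_of_bound {i T : ℕ} (hT : ∀ t, ActiveTime a i t → t ≤ T) (n : ℕ)
    {t : ℕ} {σ : Bool} (ht : ActiveTime a i t)
    (h : (optionIterate (partialMapOfRel (ChainEdge a)) n (chainNode (i, t, σ))).isSome) :
    n ≤ if σ then T - t else T + 1 + t := by
  induction n generalizing t σ with
  | zero => exact Nat.zero_le _
  | succ n ih =>
    rw [optionIterate_partialMapOfRel_isSome_succ ChainEdge.right_unique] at h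
    obtain ⟨j, hj, hs⟩ := h
    obtain ⟨⟨i', u, τ⟩, rfl⟩ := chainNode.surjective j
    obtain ⟨rfl, -, hu⟩ := active_of_chainEdge hj
    have h1 := ih hu hs
    rw [chainEdge_iff] at hj
    obtain ⟨-, ⟨rfl, rfl, hc⟩ | ⟨rfl, rfl, hc⟩ | ⟨rfl, rfl, rfl, rfl⟩⟩ := hj
    · have h2 : t < u := hc.2.2.1
      have h3 : u ≤ T := hT _ hu
      simp only [if_true] at h1 ⊢
      omega
    · have h2 : u < t := hc.2.2.1
      simp only [Bool.false_eq_true, if_false] at h1 ⊢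
      omega
    · simp at h1 ⊢
      omega

/-- This is why all times up to `i` are declared active: the chain of column `i` is long even if the
column is zero. -/
theorem isSome_iterate_of_add_le {i : ℕ} (n : ℕ) {t : ℕ} (h : t + n ≤ i) :
    (optionIterate (partialMapOfRel (ChainEdge a)) n (chainNode (i, t, true))).isSome := by
  induction n generalizing t with
  | zero => rfl
  | succ n ih =>
    rw [optionIterate_partialMapOfRel_isSome_succ ChainEdge.right_unique]
    refine ⟨chainNode (i, t + 1, true), .up _ _ _ ⟨Or.inl (by omega), Or.inl (by omega), by omega,
      fun u h1 h2 => by omega⟩, ih (by omega)⟩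

theorem isSome_iterate_of_isSome_succ {α : Type} {f : α → Option α} {n : ℕ} {j : α}
    (h : (optionIterate f (n + 1) j).isSome) : (optionIterate f n j).isSome := by
  rw [optionIterate_succ'] at h
  cases h' : optionIterate f n j <;> simp_all

/-- The orbit descends to time `0`, turns, and then has at least `i` steps upwards before it. -/
theorem isSome_iterate_down {i n : ℕ} (t : ℕ) (ht : ActiveTime a i t) (hn : n ≤ i) :
    (optionIterate (partialMapOfRel (ChainEdge a)) n (chainNode (i, t, false))).isSome := by
  induction t using Nat.strong_induction_on with
  | _ t ih =>
    refine isSome_iterate_of_isSome_succ ?_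
    rw [optionIterate_partialMapOfRel_isSome_succ ChainEdge.right_unique]
    rcases Nat.eq_zero_or_pos t with rfl | h0
    · exact ⟨_, .turn _, isSome_iterate_of_add_le n (by omega)⟩
    · obtain ⟨v, hv⟩ := exists_consecutiveTimes_left ht h0
      exact ⟨_, .down _ _ _ hv, ih v hv.2.2.1 hv.1⟩

/-- A finite chain starts at the last active time on the descending side. This node has no preimage,
and in column `i` it survives at least `i` steps. -/
theorem mem_approximatePointSpectrum_chainSystem (ha : FrequentlyColumnFinite a) {z : ℂ}
    (hz : ‖z‖ < 1) : z ∈ approximatePointSpectrum (koopman (chainSystem a)) := by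
  classical
  refine mem_approximatePointSpectrum_koopman_ofPartialInjection _ (fun j i h => ?_) (fun n => ?_) hz
  · exact (partialMapOfRel_eq_some ChainEdge.right_unique i j).2
      ((partialMapOfRel_eq_some ChainEdge.left_unique j i).1 h)
  · obtain ⟨i, hi, hfin⟩ := frequently_atTop.1 ha n
    obtain ⟨T, hT⟩ := exists_bound_active hfin
    have h0 : ActiveTime a i 0 := Or.inl (Nat.zero_le i)
    have hlast : ActiveTime a i (Nat.findGreatest (ActiveTime a i) T) :=
      Nat.findGreatest_spec (Nat.zero_le T) h0
    refine ⟨chainNode (i, Nat.findGreatest (ActiveTime a i) T, false), ?_,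
      isSome_iterate_down _ hlast hi⟩
    rw [Option.eq_none_iff_forall_ne_some]
    intro j hj
    rw [partialMapOfRel_eq_some ChainEdge.left_unique] at hj
    obtain ⟨⟨i', u, τ⟩, rfl⟩ := chainNode.surjective j
    rw [chainEdge_iff] at hj
    obtain ⟨rfl, ⟨-, h, -⟩ | ⟨-, -, hc⟩ | ⟨-, h, -, -⟩⟩ := hj
    · simp at h
    · exact Nat.findGreatest_is_greatest hc.2.2.1 (hT _ hc.2.1) hc.2.1
    · simp at h

/-- Only finitely many chains are finite, with a common bound `T` on their active times. Their nodes
survive at most `T + 1 + T` steps, so after `2T + 2` steps only nodes of two-sided infinite chains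
are alive. -/
theorem notMem_spectrum_chainSystem (ha : ¬ FrequentlyColumnFinite a) {z : ℂ} (hz : z ≠ 0)
    (hz1 : ‖z‖ < 1) : z ∉ spectrum ℂ (koopman (chainSystem a)) := by
  rw [FrequentlyColumnFinite, not_frequently, eventually_atTop] at ha
  obtain ⟨k, hk⟩ := ha
  obtain ⟨T, hT⟩ : ∃ T, ∀ i < k, ColumnFinite a i → ∀ t, ActiveTime a i t → t ≤ T := by
    have : ∀ i, ∃ T, ColumnFinite a i → ∀ t, ActiveTime a i t → t ≤ T := fun i => by
      by_cases h : ColumnFinite a i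
      · obtain ⟨T, hT⟩ := exists_bound_active h
        exact ⟨T, fun _ => hT⟩
      · exact ⟨0, fun h' => absurd h' h⟩
    choose T hT using this
    exact ⟨(Finset.range k).sup T, fun i hi hfin t ht => (hT i hfin t ht).trans
      (Finset.le_sup (Finset.mem_range.2 hi))⟩
  have key : ∀ i t σ, (optionIterate (partialMapOfRel (ChainEdge a)) (2 * T + 2)
      (chainNode (i, t, σ))).isSome → ¬ ColumnFinite a i ∧ ActiveTime a i t := by
    intro i t σ h
    have hact : ActiveTime a i t := by
      rw [optionIterate_partialMapOfRel_isSome_succ ChainEdge.right_unique] at h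
      obtain ⟨j, hj, -⟩ := h
      obtain ⟨q, rfl⟩ := chainNode.surjective j
      exact (active_of_chainEdge hj).2.1
    refine ⟨fun hfin => ?_, hact⟩
    have hik : i < k := by
      by_contra hge
      exact hk i (by omega) hfin
    have h1 := le_of_isSome_iterate_of_bound (hT i hik hfin) _ hact h
    have h2 := hT i hik hfin t hact
    split_ifs at h1 <;> omega
  refine notMem_spectrum_koopman_ofPartialInjection (N := 2 * T + 2) _ (fun j i h => ?_) (fun j h => ?_)
    (fun j h => ?_) hz hz1
  · exact (partialMapOfRel_eq_some ChainEdge.right_unique i j).2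
      ((partialMapOfRel_eq_some ChainEdge.left_unique j i).1 h)
  · obtain ⟨⟨i, t, σ⟩, rfl⟩ := chainNode.surjective j
    obtain ⟨h1, h2⟩ := key i t σ h
    exact isSome_iterate_of_not_columnFinite h1 _ h2
  · obtain ⟨⟨i, t, σ⟩, rfl⟩ := chainNode.surjective j
    obtain ⟨h1, h2⟩ := key i t σ h
    obtain ⟨j, hj⟩ := exists_chainEdge_left (σ := σ) h1 h2
    exact Option.isSome_iff_exists.2 ⟨j, (partialMapOfRel_eq_some ChainEdge.left_unique _ _).2 hj⟩

end Life

/-! ## Lower bounds for the height of towers -/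

/-- The distance to a fixed point is 1-Lipschitz for the Hausdorff metric; it turns limits of sets
into limits of real numbers. -/
theorem tendsto_infDist_nonemptyCompacts (x : ℂ) {u : ℕ → HausdorffSpace} {C : HausdorffSpace}
    (h : Tendsto u atTop (𝓝 C)) :
    Tendsto (fun n => Metric.infDist x (u n : Set ℂ)) atTop (𝓝 (Metric.infDist x (C : Set ℂ))) := by
  rw [tendsto_iff_dist_tendsto_zero] at h ⊢
  refine squeeze_zero (fun _ => dist_nonneg) (fun n => ?_) h
  have hne : ∀ A B : HausdorffSpace, Metric.hausdorffEDist (A : Set ℂ) (B : Set ℂ) ≠ ⊤ := fun A B =>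
    Metric.hausdorffEDist_ne_top_of_nonempty_of_bounded A.nonempty B.nonempty
      A.isCompact.isBounded B.isCompact.isBounded
  have h1 : ∀ A B : HausdorffSpace,
      Metric.infDist x (A : Set ℂ) ≤ Metric.infDist x (B : Set ℂ) + dist A B := fun A B => by
    rw [dist_comm]
    exact Metric.infDist_le_infDist_add_hausdorffDist (hne B A)
  rw [Real.dist_eq, abs_le]
  have a1 := h1 (u n) C
  have a2 := h1 C (u n)
  rw [dist_comm] at a2
  constructor <;> linarith

/-- Ignoring the new innermost index adds a limit of a constant sequence. -/
theorem IsTower.exists_succ {Ω I : Type} {P : ComputationalProblem Ω I} {k : ℕ}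
    {Γ : List ℕ → Ω → HausdorffSpace} (h : IsTower P k Γ) : ∃ Γ', IsTower P (k + 1) Γ' := by
  refine ⟨fun l => Γ (l.take k), fun l hl => h.general _ (by simp [hl]), fun A => by simpa using h.top A,
    fun l hl A => ?_⟩
  rcases Nat.lt_succ_iff_lt_or_eq.1 hl with hl | hl
  · have e : ∀ n, (l ++ [n]).take k = l ++ [n] := fun n => List.take_of_length_le (by simp; omega)
    simp only [e]
    rw [List.take_of_length_le hl.le]
    exact h.limit l hl A
  · have e : ∀ n, (l ++ [n]).take k = l := fun n => by
      rw [List.take_append_of_le_length hl.ge, List.take_of_length_le hl.le]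
    simp only [e]
    rw [List.take_of_length_le hl.le]
    exact tendsto_const_nhds

theorem IsTower.exists_of_le {Ω I : Type} {P : ComputationalProblem Ω I} {k m : ℕ} (hkm : k ≤ m)
    {Γ : List ℕ → Ω → HausdorffSpace} (h : IsTower P k Γ) : ∃ Γ', IsTower P m Γ' := by
  induction m, hkm using Nat.le_induction with
  | base => exact ⟨Γ, h⟩
  | succ m _ ih => exact ih.elim fun _ h' => h'.exists_succ

/-- Exact input is a special case of inexact input. -/
theorem IsTower.exists_of_inexact {Ω I : Type} {P : ComputationalProblem Ω I} {S : Set ℂ}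
    (hS : ∀ A i, P.eval A i ∈ S) {k : ℕ} {Γ} (h : IsTower (P.inexact S) k Γ) :
    ∃ Γ', IsTower P k Γ' := by
  classical
  have hinfo : ∀ A, IsDeltaOneInfo P S A (fun p : I × ℕ => P.eval A p.1) := fun A i n =>
    ⟨hS A i, by simp⟩
  let ι : Ω → {a : I × ℕ → ℂ // ∃ A, IsDeltaOneInfo P S A a} := fun A => ⟨_, A, hinfo A⟩
  refine ⟨fun l A => Γ l (ι A), fun l hl => ?_, fun A => ?_, fun l hl A => h.limit l hl (ι A)⟩
  · obtain ⟨Q, hQ⟩ := h.general l hl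
    refine ⟨fun A => (Q (ι A)).image Prod.fst, fun A => ⟨(hQ (ι A)).1.image _, fun B hB => ?_⟩⟩
    obtain ⟨h1, h2⟩ := (hQ (ι A)).2 (ι B) fun i hi => hB i.1 (Finset.mem_image_of_mem _ hi)
    exact ⟨congrArg (Finset.image Prod.fst) h1, h2⟩
  · rw [h.top]
    exact P.inexact_Ξ S (ι A) A (hinfo A)

theorem IsTowerOfType.isTower {Ω I : Type} [Encodable I] {α : TowerType}
    {P : ComputationalProblem Ω I} {k : ℕ} {Γ : List ℕ → Ω → HausdorffSpace}
    (h : IsTowerOfType α P k Γ) : IsTower P k Γ := by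
  cases α with
  | general => exact h
  | arithmetic => exact h.1

theorem SCI_le {Ω I : Type} [Encodable I] {α : TowerType}
    {P : ComputationalProblem Ω I} {k : ℕ} {Γ : List ℕ → Ω → HausdorffSpace}
    (h : IsTowerOfType α P k Γ) : SCI α P ≤ k :=
  iInf₂_le k ⟨Γ, h⟩

theorem lt_SCI {Ω I : Type} [Encodable I] {P : ComputationalProblem Ω I} {k : ℕ}
    (h : ¬ ∃ Γ, IsTower P k Γ) (α : TowerType) : ((k + 1 : ℕ) : ℕ∞) ≤ SCI α P := by
  refine le_iInf₂ fun m hm => ?_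
  obtain ⟨Γ, hΓ⟩ := hm
  rw [Nat.cast_le]
  by_contra hlt
  exact h (hΓ.isTower.exists_of_le (by omega))

/-- The output depends on finitely many samples, and each of them is locally constant in the matrix.
-/
theorem IsGeneralAlgorithm.isLocallyConstant_chainSystem {Ξ : DiscreteSystem → HausdorffSpace}
    {Γ : DiscreteSystem → HausdorffSpace} (h : IsGeneralAlgorithm (sampleProblem Ξ) Γ) :
    IsLocallyConstant fun a => Γ (chainSystem a) := by
  obtain ⟨Q, hQ⟩ := h
  rw [IsLocallyConstant.iff_eventually_eq]
  intro a
  have : ∀ᶠ b in 𝓝 a, ∀ ij ∈ Q (chainSystem a),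
      sample (chainSystem b) ij = sample (chainSystem a) ij := by
    rw [Finset.eventually_all]
    exact fun ij _ => eventually_sample_chainSystem_eq a ij
  filter_upwards [this] with b hb
  exact ((hQ (chainSystem a)).2 (chainSystem b) fun ij hij => (hb ij hij).symm).2.symm

theorem approximatePointSpectrum_subset_spectrum {E : Type*} [NormedAddCommGroup E]
    [NormedSpace ℂ E] (T : E →L[ℂ] E) : approximatePointSpectrum T ⊆ spectrum ℂ T := by
  intro z hz
  rw [spectrum.mem_iff]
  rintro ⟨u, hu⟩
  by_contra
  refine (notMem_approximatePointSpectrum_iff T z).2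
    ⟨(‖((u⁻¹ : (E →L[ℂ] E)ˣ) : E →L[ℂ] E)‖ + 1)⁻¹, by positivity, fun x => ?_⟩ hz
  have h1 : ((u⁻¹ : (E →L[ℂ] E)ˣ) : E →L[ℂ] E) ((u : E →L[ℂ] E) x) = x := by
    rw [← mul_apply_eq_comp, Units.inv_mul, one_apply_eq_self]
  have h2 : (u : E →L[ℂ] E) x = z • x - T x := by
    rw [hu]; simp [Algebra.algebraMap_eq_smul_one]
  have h3 := ((u⁻¹ : (E →L[ℂ] E)ˣ) : E →L[ℂ] E).le_opNorm ((u : E →L[ℂ] E) x)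
  rw [h1, h2, norm_sub_rev] at h3
  rw [inv_mul_le_iff₀ (by positivity)]
  nlinarith [norm_nonneg (T x - z • x)]

theorem not_exists_isTower_two {Ξ : DiscreteSystem → HausdorffSpace}
    (hlow : ∀ F, approximatePointSpectrum (koopman F) ⊆ (Ξ F : Set ℂ))
    (hup : ∀ F, (Ξ F : Set ℂ) ⊆ spectrum ℂ (koopman F)) :
    ¬ ∃ Γ, IsTower (sampleProblem Ξ) 2 Γ := by
  rintro ⟨Γ, h⟩
  refine not_exists_two_limits_frequentlyColumnFinite
    (fun n m a => Metric.infDist (1 / 2 : ℂ) (Γ [n, m] (chainSystem a) : Set ℂ))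
    (fun n a => Metric.infDist (1 / 2 : ℂ) (Γ [n] (chainSystem a) : Set ℂ))
    (fun a => Metric.infDist (1 / 2 : ℂ) (Ξ (chainSystem a) : Set ℂ))
    (fun n m => ?_) (fun n a => ?_) (fun a => ?_) (1 / 4) (fun a ha => ?_) (fun a ha => ?_)
  · exact (h.general [n, m] rfl).isLocallyConstant_chainSystem.comp
      (fun C : HausdorffSpace => Metric.infDist (1 / 2 : ℂ) (C : Set ℂ))
  · exact tendsto_infDist_nonemptyCompacts _ (h.limit [n] (by simp) (chainSystem a))
  · have := h.limit [] (by simp) (chainSystem a)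
    rw [h.top] at this
    exact tendsto_infDist_nonemptyCompacts _ this
  · have hmem : (1 / 2 : ℂ) ∈ (Ξ (chainSystem a) : Set ℂ) :=
      hlow _ (mem_approximatePointSpectrum_chainSystem ha (by norm_num))
    rw [Metric.infDist_zero_of_mem hmem]
    norm_num
  · refine lt_of_lt_of_le (by norm_num : (1 / 4 : ℝ) < 1 / 3)
      ((Metric.le_infDist (Ξ (chainSystem a)).nonempty).2 fun w hw => ?_)
    have hw' := hup _ hw
    by_contra hlt
    rw [not_le, dist_eq_norm] at hlt
    have h1 := norm_sub_norm_le (1 / 2 : ℂ) w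
    have h2 := norm_sub_norm_le w (1 / 2 : ℂ)
    rw [norm_sub_rev] at h2
    have h3 : ‖(1 / 2 : ℂ)‖ = 1 / 2 := by norm_num
    rw [h3] at h1 h2
    refine notMem_spectrum_chainSystem ha (fun h0 => ?_) (by linarith) hw'
    rw [h0, sub_zero, h3] at hlt
    linarith

/-! ## Primitive recursive functions on machines over the reals -/

/-- The program `p`, with output register `o`, computes `f` from the registers `ins`. It changes no
register below `b` other than `o`, and no register from `R` on. -/
def RealProgram.Computes {n : ℕ} (p : RealProgram) (f : List.Vector ℕ n → ℕ) (ins : Fin n → ℕ)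
    (o b R : ℕ) : Prop :=
  ∀ (orc : ℕ → ℂ) (x : ℕ → ℝ) (v : List.Vector ℕ n), (∀ i, x (ins i) = (v.get i : ℝ)) →
    ∃ y, p.Runs orc x y ∧ y o = (f v : ℝ) ∧ ∀ r, r ≠ o → (r < b ∨ R ≤ r) → y r = x r

/-- A function is computed by machines over the reals, for all choices of registers. -/
def RealComputable {n : ℕ} (f : List.Vector ℕ n → ℕ) : Prop :=
  ∀ (ins : Fin n → ℕ) (o b : ℕ), (∀ i, ins i < b) → o < b →
    ∃ p R, RealProgram.Computes p f ins o b R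

theorem realComputable_zero : RealComputable (fun _ : List.Vector ℕ 0 => 0) :=
  fun _ o _ _ _ => ⟨.const o 0, 0, fun _ x _ _ => ⟨_, .const o 0 x, by simp, fun r hr _ => by
    simp [Function.update_of_ne hr]⟩⟩

theorem realComputable_succ : RealComputable (fun v : List.Vector ℕ 1 => v.head.succ) := by
  intro ins o b hins ho
  refine ⟨.seq (.const b 1) (.add o (ins 0) b), b + 1, fun orc x v hv =>
    ⟨_, .seq _ _ _ _ _ (.const b 1 x) (.add o (ins 0) b _), ?_, fun r hr hb => ?_⟩⟩
  · have := hins 0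
    rw [Function.update_self, Function.update_self, Function.update_of_ne (by omega), hv 0]
    simp [List.Vector.get_zero]
  · rw [Function.update_of_ne hr, Function.update_of_ne (by omega)]

theorem realComputable_get {n : ℕ} (i : Fin n) :
    RealComputable (fun v : List.Vector ℕ n => v.get i) := by
  intro ins o b hins ho
  refine ⟨.seq (.const b 0) (.add o (ins i) b), b + 1, fun orc x v hv =>
    ⟨_, .seq _ _ _ _ _ (.const b 0 x) (.add o (ins i) b _), ?_, fun r hr hb => ?_⟩⟩
  · have := hins i
    rw [Function.update_self, Function.update_self, Function.update_of_ne (by omega), hv i]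
    simp
  · rw [Function.update_of_ne hr, Function.update_of_ne (by omega)]

/-- Several functions of the same arguments are computed into consecutive registers. -/
theorem exists_program_tuple {n m : ℕ} {g : Fin m → List.Vector ℕ n → ℕ}
    (hg : ∀ i, RealComputable (g i)) (ins : Fin n → ℕ) (b : ℕ) (hins : ∀ i, ins i < b) (k : ℕ)
    (hk : k ≤ m) : ∃ p R, ∀ (orc : ℕ → ℂ) (x : ℕ → ℝ) (v : List.Vector ℕ n),
      (∀ i, x (ins i) = (v.get i : ℝ)) →
      ∃ y, RealProgram.Runs orc p x y ∧ (∀ i : Fin m, i.1 < k → y (b + i) = (g i v : ℝ)) ∧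
        ∀ r, (r < b ∨ R ≤ r) → y r = x r := by
  induction k with
  | zero =>
    refine ⟨.const b 0, b + 1, fun orc x v _ => ⟨_, .const b 0 x, fun i hi => by omega, fun r hr => ?_⟩⟩
    rw [Function.update_of_ne (by omega)]
  | succ k ih =>
    obtain ⟨p, R, hp⟩ := ih (by omega)
    obtain ⟨q, R', hq⟩ := hg ⟨k, hk⟩ ins (b + k) (b + m) (fun i => by have := hins i; omega) (by omega)
    refine ⟨.seq p q, max (max R R') (b + m), fun orc x v hv => ?_⟩
    obtain ⟨y, hy1, hy2, hy3⟩ := hp orc x v hv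
    obtain ⟨w, hw1, hw2, hw3⟩ := hq orc y v fun i => by rw [hy3 _ (Or.inl (hins i)), hv]
    refine ⟨w, .seq _ _ _ _ _ hy1 hw1, fun i hi => ?_, fun r hr => ?_⟩
    · rcases Nat.lt_succ_iff_lt_or_eq.1 hi with h | h
      · rw [hw3 _ (by omega) (Or.inl (by omega)), hy2 i h]
      · obtain ⟨i, hi'⟩ := i
        subst h
        exact hw2
    · rw [hw3 r (by omega) (by omega), hy3 r (by omega)]

/-- The intermediate values occupy `b, …, b + n - 1`, and `f` then runs with its work space from `b
+ n` on. For this reason `RealComputable` quantifies over the registers. -/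
theorem RealComputable.comp {m n : ℕ} {f : List.Vector ℕ n → ℕ} {g : Fin n → List.Vector ℕ m → ℕ}
    (hf : RealComputable f) (hg : ∀ i, RealComputable (g i)) :
    RealComputable (fun v => f (List.Vector.ofFn fun i => g i v)) := by
  intro ins o b hins ho
  obtain ⟨p, R, hp⟩ := exists_program_tuple hg ins b hins n le_rfl
  obtain ⟨q, R', hq⟩ := hf (fun i => b + i) o (b + n) (fun i => by omega) (by omega)
  refine ⟨.seq p q, max R (max R' (b + n)), fun orc x v hv => ?_⟩
  obtain ⟨y, hy1, hy2, hy3⟩ := hp orc x v hv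
  obtain ⟨w, hw1, hw2, hw3⟩ := hq orc y (List.Vector.ofFn fun i => g i v) fun i => by
    rw [hy2 i i.2]; simp
  refine ⟨w, .seq _ _ _ _ _ hy1 hw1, hw2, fun r hr hb => ?_⟩
  rw [hw3 r hr (by omega), hy3 r (by omega)]

/-- A counting loop: the body is repeated while the register `c` counts down to zero. -/
theorem exists_runs_while {orc : ℕ → ℂ} {p : RealProgram} {c : ℕ} {Inv : ℕ → (ℕ → ℝ) → Prop} (n : ℕ)
    (hc : ∀ k ≤ n, ∀ x, Inv k x → x c = ((n - k : ℕ) : ℝ))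
    (hstep : ∀ k < n, ∀ x, Inv k x → ∃ y, p.Runs orc x y ∧ Inv (k + 1) y)
    {x : ℕ → ℝ} (hx : Inv 0 x) : ∃ y, (RealProgram.whilePos c p).Runs orc x y ∧ Inv n y := by
  suffices H : ∀ d k, k + d = n → ∀ x, Inv k x →
      ∃ y, (RealProgram.whilePos c p).Runs orc x y ∧ Inv n y from H n 0 (by omega) x hx
  intro d
  induction d with
  | zero =>
    intro k hk x hx
    obtain rfl : k = n := by omega
    exact ⟨x, .whileFalse _ _ _ (by rw [hc k le_rfl x hx]; simp), hx⟩
  | succ d ih =>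
    intro k hk x hx
    obtain ⟨y, hy1, hy2⟩ := hstep k (by omega) x hx
    obtain ⟨w, hw1, hw2⟩ := ih (k + 1) (by omega) y hy2
    refine ⟨w, .whileTrue _ _ _ _ _ ?_ hy1 hw1, hw2⟩
    rw [hc k (by omega) x hx, Nat.cast_pos]
    omega

theorem RealComputable.prec {n : ℕ} {f : List.Vector ℕ n → ℕ} {g : List.Vector ℕ (n + 2) → ℕ}
    (hf : RealComputable f) (hg : RealComputable g) :
    RealComputable (fun v : List.Vector ℕ (n + 1) =>
      v.head.rec (f v.tail) fun y IH => g (y ::ᵥ IH ::ᵥ v.tail)) := by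
  intro ins o b hins ho
  -- registers: `b` counts up, `b + 1` holds the value, `b + 2` counts down, `b + 3` holds `1`,
  -- `b + 4` holds `0`, `b + 5` receives the next value
  obtain ⟨p, R, hp⟩ := hf (fun i => ins i.succ) (b + 1) (b + 6)
    (fun i => by have := hins i.succ; omega) (by omega)
  obtain ⟨q, R', hq⟩ := hg (Fin.cons b (Fin.cons (b + 1) fun i => ins i.succ)) (b + 5) (b + 6)
    (fun i => by
      refine Fin.cases ?_ (fun i => ?_) i
      · simp
      · refine Fin.cases ?_ (fun i => ?_) i
        · simp
        · have := hins i.succ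
          simp only [Fin.cons_succ]
          omega) (by omega)
  let body : RealProgram := .seq q (.seq (.add (b + 1) (b + 5) (b + 4))
    (.seq (.add b b (b + 3)) (.sub (b + 2) (b + 2) (b + 3))))
  refine ⟨.seq p (.seq (.const b 0) (.seq (.const (b + 3) 1) (.seq (.const (b + 4) 0)
    (.seq (.add (b + 2) (ins 0) (b + 4)) (.seq (.whilePos (b + 2) body)
      (.add o (b + 1) (b + 4))))))), max R (max R' (b + 6)), fun orc x v hv => ?_⟩
  obtain ⟨y, hy1, hy2, hy3⟩ := hp orc x v.tail fun i => by rw [hv, List.Vector.get_tail_succ]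
  let val : ℕ → ℕ := fun k =>
    Nat.rec (motive := fun _ => ℕ) (f v.tail) (fun y IH => g (y ::ᵥ IH ::ᵥ v.tail)) k
  let Inv : ℕ → (ℕ → ℝ) → Prop := fun k s => s b = (k : ℝ) ∧ s (b + 1) = ((val k : ℕ) : ℝ) ∧
    s (b + 2) = ((v.head - k : ℕ) : ℝ) ∧ s (b + 3) = 1 ∧ s (b + 4) = 0 ∧
    ∀ r, (r < b ∨ max R (max R' (b + 6)) ≤ r) → s r = x r
  have hloop := exists_runs_while (orc := orc) (p := body) (c := b + 2) (Inv := Inv) v.head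
    (fun k _ s hs => hs.2.2.1) (fun k hk s hs => by
      obtain ⟨h0, h1, h2, h3, h4, h5⟩ := hs
      obtain ⟨w, hw1, hw2, hw3⟩ := hq orc s (k ::ᵥ val k ::ᵥ v.tail) (fun i => by
        refine Fin.cases ?_ (fun i => ?_) i
        · simpa using h0
        · refine Fin.cases ?_ (fun i => ?_) i
          · exact h1
          · simp only [Fin.cons_succ, List.Vector.get_cons_succ]
            rw [h5 _ (Or.inl (hins _)), hv, List.Vector.get_tail_succ])
      refine ⟨_, .seq _ _ _ _ _ hw1 (.seq _ _ _ _ _ (.add _ _ _ _) (.seq _ _ _ _ _ (.add _ _ _ _)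
        (.sub _ _ _ _))), ?_⟩
      have hwb : ∀ i, i < 5 → w (b + i) = s (b + i) := fun i hi =>
        hw3 _ (by omega) (Or.inl (by omega))
      have e0 := hwb 0 (by omega)
      have e2 := hwb 2 (by omega)
      have e3 := hwb 3 (by omega)
      have e4 := hwb 4 (by omega)
      rw [add_zero] at e0
      refine ⟨?_, ?_, ?_, ?_, ?_, fun r hr => ?_⟩
      · simp [e0, e3, h0, h3]
      · simp [e4, h4, hw2, val]
      · simp [e2, e3, h2, h3]
        rw [Nat.cast_sub (by omega), Nat.cast_sub (by omega)]
        push_cast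
        ring
      · simp [e3, h3]
      · simp [e4, h4]
      · rw [Function.update_of_ne (by omega), Function.update_of_ne (by omega),
          Function.update_of_ne (by omega), hw3 _ (by omega) (by omega), h5 r hr])
    (x := Function.update (Function.update (Function.update (Function.update y b ((0 : ℚ) : ℝ))
      (b + 3) ((1 : ℚ) : ℝ)) (b + 4) ((0 : ℚ) : ℝ)) (b + 2)
        (x (ins 0))) (by
      refine ⟨?_, ?_, ?_, ?_, ?_, fun r hr => ?_⟩
      · simp
      · simp [hy2, val]
      · simp [hv, List.Vector.get_zero]
      · simp
      · simp
      · rw [Function.update_of_ne (by omega), Function.update_of_ne (by omega),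
          Function.update_of_ne (by omega), Function.update_of_ne (by omega),
          hy3 _ (by omega) (by omega)])
  obtain ⟨w, hw1, h0, h1, h2, h3, h4, h5⟩ := hloop
  have hins0 : Function.update (Function.update (Function.update y b ((0 : ℚ) : ℝ))
      (b + 3) ((1 : ℚ) : ℝ)) (b + 4) ((0 : ℚ) : ℝ) (ins 0) + Function.update (Function.update
      (Function.update y b ((0 : ℚ) : ℝ)) (b + 3) ((1 : ℚ) : ℝ)) (b + 4) ((0 : ℚ) : ℝ) (b + 4) =
      x (ins 0) := by
    have := hins 0
    rw [Function.update_of_ne (by omega), Function.update_of_ne (by omega),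
      Function.update_of_ne (by omega), Function.update_self, hy3 _ (by omega) (Or.inl (by omega))]
    simp
  rw [← hins0] at hw1
  exact ⟨_, .seq _ _ _ _ _ hy1 (.seq _ _ _ _ _ (.const _ _ _) (.seq _ _ _ _ _ (.const _ _ _)
    (.seq _ _ _ _ _ (.const _ _ _) (.seq _ _ _ _ _ (.add _ _ _ _) (.seq _ _ _ _ _ hw1
      (.add _ _ _ _)))))), by simp [h1, h4, val],
      fun r hr hb => by rw [Function.update_of_ne hr, h5 r hb]⟩

/-- `Nat.Primrec'` generates the primitive recursive functions on vectors by just the operations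
treated above. -/
theorem realComputable_of_primrec {n : ℕ} {f : List.Vector ℕ n → ℕ} (hf : Primrec f) :
    RealComputable f := by
  have h := Nat.Primrec'.of_prim hf
  clear hf
  induction h with
  | zero => exact realComputable_zero
  | succ => exact realComputable_succ
  | get i => exact realComputable_get i
  | comp _ _ _ ihf ihg => exact ihf.comp ihg
  | prec _ _ ihf ihg => exact ihf.prec ihg

/-! ## Algorithms that read a finite window of a binary sequence -/

/-- The first `n` bits of `β` as a binary number. -/
def windowCode (β : ℕ → Bool) : ℕ → ℕ
  | 0 => 0
  | n + 1 => windowCode β n + if β n then 2 ^ n else 0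

theorem windowCode_lt (β : ℕ → Bool) (n : ℕ) : windowCode β n < 2 ^ n := by
  induction n with
  | zero => simp [windowCode]
  | succ n ih =>
    rw [windowCode, pow_succ]
    split_ifs <;> omega

theorem testBit_windowCode (β : ℕ → Bool) (n k : ℕ) :
    (windowCode β n).testBit k = (decide (k < n) && β k) := by
  induction n with
  | zero => simp [windowCode]
  | succ n ih =>
    rw [windowCode]
    cases hb : β n with
    | false =>
      simp only [Bool.false_eq_true, if_false, add_zero, ih]
      rcases lt_trichotomy k n with h | rfl | h
      · simp [h, Nat.lt_succ_of_lt h]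
      · simp [hb]
      · simp [show ¬ k < n by omega, show ¬ k < n + 1 by omega]
    | true =>
      simp only [if_true]
      rw [add_comm]
      rcases lt_trichotomy k n with h | rfl | h
      · rw [Nat.testBit_two_pow_add_gt h, ih]
        simp [h, Nat.lt_succ_of_lt h]
      · rw [Nat.testBit_two_pow_add_eq, ih]
        simp [hb]
      · have h1 := windowCode_lt β n
        have h2 : 2 ^ n + windowCode β n < 2 ^ k :=
          lt_of_lt_of_le (by rw [pow_succ]; omega) (Nat.pow_le_pow_right (by norm_num) h)
        rw [Nat.testBit_lt_two_pow h2]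
        simp [show ¬ k < n + 1 by omega]

theorem windowCode_congr {β γ : ℕ → Bool} {n : ℕ} (h : ∀ k < n, β k = γ k) :
    windowCode β n = windowCode γ n := by
  induction n with
  | zero => rfl
  | succ n ih => rw [windowCode, windowCode, ih fun k hk => h k (by omega), h n (by omega)]

/-- `P` is an input model for binary sequences: the bit `k` is `1` if and only if the real part of
the evaluation `q k` exceeds `1/2`. -/
structure IsBinaryModel {Ω I : Type} [Encodable I] (P : ComputationalProblem Ω I)
    (β : Ω → ℕ → Bool) (q : ℕ → I) : Prop where
  primrec : Primrec fun k => Encodable.encode (q k)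
  bit : ∀ A k, β A k = true ↔ 1 / 2 < (P.eval A (q k)).re

/-- The functions `Γ_{n₃, n₂, n₁}` are given by a function of the indices and of the first `n₁`
bits. -/
def IsWindowOutput {Ω : Type} (β : Ω → ℕ → Bool) (out : ℕ × ℕ × ℕ × ℕ → List GaussCode)
    (Γ : List ℕ → Ω → HausdorffSpace) : Prop :=
  ∀ A n₃ n₂ n₁, (Γ [n₃, n₂, n₁] A : Set ℂ) =
    {z | ∃ c ∈ out (n₃, n₂, n₁, windowCode (β A) n₁), gaussOfCode c = z}

theorem exists_eq_of_length_eq_three {l : List ℕ} (h : l.length = 3) : ∃ a b c, l = [a, b, c] :=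
  List.length_eq_three.1 h

section

variable {Ω I : Type} [Encodable I] {P : ComputationalProblem Ω I} {β : Ω → ℕ → Bool} {q : ℕ → I}
  {out : ℕ × ℕ × ℕ × ℕ → List GaussCode} {Γ : List ℕ → Ω → HausdorffSpace}

theorem IsBinaryModel.isGeneralAlgorithm (hP : IsBinaryModel P β q) (hΓ : IsWindowOutput β out Γ)
    {l : List ℕ} (hl : l.length = 3) : IsGeneralAlgorithm P (Γ l) := by
  classical
  obtain ⟨n₃, n₂, n₁, rfl⟩ := exists_eq_of_length_eq_three hl
  -- One evaluation more than needed keeps the set non-empty for `n₁ = 0`. The set does not depend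
  -- on the input.
  refine ⟨fun _ => (Finset.range (n₁ + 1)).image q, fun A =>
    ⟨(Finset.nonempty_range_iff.2 (by omega)).image _, fun B hB => ⟨rfl, SetLike.coe_injective ?_⟩⟩⟩
  rw [hΓ, hΓ, windowCode_congr fun k hk => ?_]
  rw [Bool.eq_iff_iff, hP.bit, hP.bit,
    hB (q k) (Finset.mem_image_of_mem _ (Finset.mem_range.2 (by omega)))]

/-! ### Turing machines -/

theorem RecursiveFunctional.of_eq {f h : (ℕ → ℕ) → ℕ →. ℕ} (hf : RecursiveFunctional f)
    (H : ∀ g n, f g n = h g n) : RecursiveFunctional h :=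
  (funext fun g => funext fun n => H g n : f = h) ▸ hf

theorem recursiveFunctional_of_primrec {f : ℕ → ℕ} (hf : Primrec f) :
    RecursiveFunctional fun _ n => Part.some (f n) := by
  have h := Primrec.nat_iff.1 hf
  clear hf
  induction h with
  | zero => exact .zero
  | succ => exact .succ
  | left => exact .left
  | right => exact .right
  | pair _ _ ihf ihg =>
    exact (RecursiveFunctional.pair ihf ihg).of_eq fun _ _ => by simp [Seq.seq]
  | comp _ _ ihf ihg =>
    exact (RecursiveFunctional.comp ihf ihg).of_eq fun _ _ => by simp
  | @prec f g _ _ ihf ihg =>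
    refine (RecursiveFunctional.prec ihf ihg).of_eq fun _ n => ?_
    simp only [Nat.unpaired]
    induction n.unpair.2 with
    | zero => rfl
    | succ m ih =>
      dsimp only at ih ⊢
      rw [ih]
      simp

theorem RecursiveFunctional.comp_some {f h : (ℕ → ℕ) → ℕ → ℕ}
    (hf : RecursiveFunctional fun g n => Part.some (f g n))
    (hh : RecursiveFunctional fun g n => Part.some (h g n)) :
    RecursiveFunctional fun g n => Part.some (f g (h g n)) := by
  exact (RecursiveFunctional.comp hf hh).of_eq fun _ _ => by simp

theorem RecursiveFunctional.pair_some {f h : (ℕ → ℕ) → ℕ → ℕ}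
    (hf : RecursiveFunctional fun g n => Part.some (f g n))
    (hh : RecursiveFunctional fun g n => Part.some (h g n)) :
    RecursiveFunctional fun g n => Part.some (Nat.pair (f g n) (h g n)) := by
  exact (RecursiveFunctional.pair hf hh).of_eq fun _ _ => by simp [Seq.seq]

/-- Whether the number with a given code has real part greater than `1/2`. -/
def codeBit (m : ℕ) : Bool :=
  ((Encodable.decode m : Option GaussCode).map fun c =>
    decide (2 * c.1.2.1 + c.1.2.2 + 1 < 2 * c.1.1)).getD false

theorem primrec_codeBit : Primrec codeBit := by
  refine Primrec.option_getD.comp (Primrec.option_map Primrec.decode ?_) (Primrec.const false)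
  refine PrimrecPred.decide (Primrec.nat_lt.comp ?_ ?_)
  · exact Primrec.succ.comp (Primrec.nat_add.comp (Primrec.nat_double.comp
      (Primrec.fst.comp (Primrec.snd.comp (Primrec.fst.comp Primrec.snd))))
      (Primrec.snd.comp (Primrec.snd.comp (Primrec.fst.comp Primrec.snd))))
  · exact Primrec.nat_double.comp (Primrec.fst.comp (Primrec.fst.comp Primrec.snd))

theorem gaussOfCode_eq (c : GaussCode) : gaussOfCode c =
    ⟨((c.1.1 : ℝ) - c.1.2.1) / (c.1.2.2 + 1), ((c.2.1 : ℝ) - c.2.2.1) / (c.2.2.2 + 1)⟩ := by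
  unfold gaussOfCode ratOfCode
  have h : ∀ r : ℚ, (r : ℂ) = ((r : ℝ) : ℂ) := fun r => by simp
  rw [h, h]
  apply Complex.ext
  · simp only [Complex.add_re, Complex.ofReal_re, Complex.mul_re, Complex.I_re, Complex.I_im,
      Complex.ofReal_im]
    push_cast
    ring
  · simp only [Complex.add_im, Complex.ofReal_re, Complex.mul_im, Complex.I_re, Complex.I_im,
      Complex.ofReal_im]
    push_cast
    ring

theorem codeBit_encode (c : GaussCode) :
    codeBit (Encodable.encode c) = true ↔ 1 / 2 < (gaussOfCode c).re := by
  rw [gaussOfCode_eq, codeBit, Encodable.encodek]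
  simp only [Option.map_some, Option.getD_some, decide_eq_true_eq]
  rw [lt_div_iff₀ (by positivity), ← Nat.cast_lt (α := ℝ)]
  push_cast
  constructor <;> intro h <;> linarith

theorem primrec_two_pow : Primrec fun n : ℕ => 2 ^ n :=
  (Primrec.nat_rec₁ 1 ((Primrec.nat_double.comp Primrec.snd).to₂ :
    Primrec₂ fun (_ : ℕ) (r : ℕ) => 2 * r)).of_eq fun n => by
    induction n with
    | zero => rfl
    | succ n ih => simp only [pow_succ, ← ih]; ring

/-- The code of the window of a sequence is computed from a tape that holds the sequence. -/
theorem recursiveFunctional_windowCode {qc : ℕ → ℕ} (hq : Primrec qc) :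
    RecursiveFunctional fun g n => Part.some (windowCode (fun k => codeBit (g (qc k))) n) := by
  -- `m` pairs the argument `⟨0, ⟨y, IH⟩⟩` of the recursion step with the oracle's answer to the
  -- `y`-th question; the parameter `0` is a dummy.
  let s : ℕ → ℕ := fun m => m.unpair.1.unpair.2.unpair.2 +
    if codeBit m.unpair.2 = true then 2 ^ m.unpair.1.unpair.2.unpair.1 else 0
  have u1 : Primrec fun n : ℕ => n.unpair.1 := Primrec.fst.comp Primrec.unpair
  have u2 : Primrec fun n : ℕ => n.unpair.2 := Primrec.snd.comp Primrec.unpair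
  have hs : Primrec s := by
    refine Primrec.nat_add.comp (u2.comp (u2.comp u1)) (Primrec.ite ?_ ?_ (Primrec.const 0))
    · exact Primrec.eq.comp (primrec_codeBit.comp u2) (Primrec.const true)
    · exact primrec_two_pow.comp (u1.comp (u2.comp u1))
  have hstep : RecursiveFunctional fun g m =>
      Part.some (s (Nat.pair m (g (qc m.unpair.2.unpair.1)))) :=
    (recursiveFunctional_of_primrec hs).comp_some
      ((recursiveFunctional_of_primrec Primrec.id).pair_some
        (RecursiveFunctional.oracle.comp_some
          (recursiveFunctional_of_primrec (hq.comp (u1.comp u2)))))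
  have hprec := RecursiveFunctional.prec RecursiveFunctional.zero hstep
  have hin := recursiveFunctional_of_primrec
    (Primrec₂.natPair.comp (Primrec.const 0) Primrec.id : Primrec fun n : ℕ => Nat.pair 0 n)
  refine (RecursiveFunctional.comp hprec hin).of_eq fun g n => ?_
  simp only [Part.bind_eq_bind, Part.bind_some, Nat.unpair_pair, s]
  induction n with
  | zero => rfl
  | succ n ih =>
    dsimp only at ih ⊢
    rw [ih, Part.bind_some, windowCode]

theorem IsBinaryModel.isTuringComputable (hP : IsBinaryModel P β q) (hΓ : IsWindowOutput β out Γ)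
    (hout : Primrec out) : IsTuringComputable P 3 Γ := by
  let idx : ℕ → ℕ → ℕ := fun i m => ((Encodable.decode m : Option (List ℕ)).getD []).getD i 0
  have hidx : ∀ i, Primrec (idx i) := fun i =>
    (Primrec.list_getD 0).comp (Primrec.option_getD.comp Primrec.decode (Primrec.const []))
      (Primrec.const i)
  let F : ℕ → ℕ := fun m => Encodable.encode
    (out (idx 0 m.unpair.1, idx 1 m.unpair.1, idx 2 m.unpair.1, m.unpair.2))
  have u1 : Primrec fun n : ℕ => n.unpair.1 := Primrec.fst.comp Primrec.unpair
  have u2 : Primrec fun n : ℕ => n.unpair.2 := Primrec.snd.comp Primrec.unpair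
  have hF : Primrec F := Primrec.encode.comp (hout.comp
    (((hidx 0).comp u1).pair (((hidx 1).comp u1).pair (((hidx 2).comp u1).pair u2))))
  refine ⟨_, (recursiveFunctional_of_primrec hF).comp_some
    ((recursiveFunctional_of_primrec Primrec.id).pair_some
      ((recursiveFunctional_windowCode hP.primrec).comp_some
        (recursiveFunctional_of_primrec (hidx 2)))), fun A g hg l hl => ?_⟩
  obtain ⟨n₃, n₂, n₁, rfl⟩ := exists_eq_of_length_eq_three hl
  refine ⟨out (n₃, n₂, n₁, windowCode (β A) n₁), ?_, hΓ A n₃ n₂ n₁⟩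
  -- A tape may hold any code of each value. The bit depends on the value alone, so the output is
  -- the same for all tapes.
  have hW : windowCode (fun k => codeBit (g (Encodable.encode (q k)))) n₁ =
      windowCode (β A) n₁ := windowCode_congr fun k _ => by
    obtain ⟨c, hc1, hc2⟩ := hg (q k)
    rw [hc1, Bool.eq_iff_iff, codeBit_encode, hc2, hP.bit]
  simp [F, idx, hW]

/-! ### Machines over the reals -/

/-- The real and imaginary parts of a code, given by six natural numbers. -/
def codeEntry : Fin 6 → GaussCode → ℕ :=
  ![fun c => c.1.1, fun c => c.1.2.1, fun c => c.1.2.2, fun c => c.2.1, fun c => c.2.2.1,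
    fun c => c.2.2.2]

theorem primrec_codeEntry (i : Fin 6) : Primrec (codeEntry i) := by
  have h1 : Primrec fun c : GaussCode => c.1 := Primrec.fst
  have h2 : Primrec fun c : GaussCode => c.2 := Primrec.snd
  fin_cases i
  · exact Primrec.fst.comp h1
  · exact Primrec.fst.comp (Primrec.snd.comp h1)
  · exact Primrec.snd.comp (Primrec.snd.comp h1)
  · exact Primrec.fst.comp h2
  · exact Primrec.fst.comp (Primrec.snd.comp h2)
  · exact Primrec.snd.comp (Primrec.snd.comp h2)

/-- Reads the first `x₂` bits, and puts the binary number with these bits into `x₃`. -/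
theorem exists_program_readWindow (hP : IsBinaryModel P β q) :
    ∃ p : RealProgram, ∀ (A : Ω) (n₃ n₂ n₁ : ℕ) (x : ℕ → ℝ), x 0 = n₃ → x 1 = n₂ → x 2 = n₁ →
      ∃ y, p.Runs (P.realOracle A) x y ∧ y 0 = n₃ ∧ y 1 = n₂ ∧ y 2 = n₁ ∧
        y 3 = windowCode (β A) n₁ := by
  obtain ⟨p, R, hp⟩ := realComputable_of_primrec
    (hP.primrec.comp (Primrec.vector_head : Primrec (@List.Vector.head ℕ 0)))
    (fun _ => 4) 9 20 (fun _ => by norm_num) (by norm_num)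
  -- Registers: `3` the number read so far, `4` the position `k`, `5` the countdown, `6` one, `7`
  -- zero, `8` the power `2^k`, `9` the question, `10` and `11` the answer, `12` one half.
  let body : RealProgram := .seq p (.seq (.query 10 11 9) (.seq (.sub 10 10 12)
    (.seq (.ifPos 10 (.add 3 3 8) (.add 3 3 7)) (.seq (.add 8 8 8) (.seq (.add 4 4 6)
      (.sub 5 5 6))))))
  refine ⟨.seq (.seq (.const 3 0) (.seq (.const 4 0) (.seq (.const 6 1) (.seq (.const 7 0)
    (.seq (.const 8 1) (.seq (.const 12 (1 / 2)) (.add 5 2 7))))))) (.whilePos 5 body),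
    fun A n₃ n₂ n₁ x h0 h1 h2 => ?_⟩
  let Inv : ℕ → (ℕ → ℝ) → Prop := fun k s => s 0 = (n₃ : ℝ) ∧ s 1 = (n₂ : ℝ) ∧ s 2 = (n₁ : ℝ) ∧
    s 3 = (windowCode (β A) k : ℝ) ∧ s 4 = (k : ℝ) ∧ s 5 = ((n₁ - k : ℕ) : ℝ) ∧ s 6 = 1 ∧ s 7 = 0 ∧
    s 8 = 2 ^ k ∧ s 12 = 1 / 2
  obtain ⟨x', hx', hI⟩ : ∃ x', RealProgram.Runs (P.realOracle A) (.seq (.const 3 0)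
      (.seq (.const 4 0) (.seq (.const 6 1) (.seq (.const 7 0) (.seq (.const 8 1)
      (.seq (.const 12 (1 / 2)) (.add 5 2 7))))))) x x' ∧ Inv 0 x' := by
    refine ⟨_, .seq _ _ _ _ _ (.const _ _ _) (.seq _ _ _ _ _ (.const _ _ _) (.seq _ _ _ _ _
      (.const _ _ _) (.seq _ _ _ _ _ (.const _ _ _) (.seq _ _ _ _ _ (.const _ _ _) (.seq _ _ _ _ _
      (.const _ _ _) (.add _ _ _ _)))))), ?_, ?_, ?_, ?_, ?_, ?_, ?_, ?_, ?_, ?_⟩ <;>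
    simp [h0, h1, h2, windowCode]
  have hloop := exists_runs_while (orc := P.realOracle A) (p := body) (c := 5) (Inv := Inv) n₁
    (fun k _ s hs => hs.2.2.2.2.2.1) (fun k hk s hs => by
      obtain ⟨e0, e1, e2, e3, e4, e5, e6, e7, e8, e12⟩ := hs
      obtain ⟨w, hw1, hw2, hw3⟩ := hp (P.realOracle A) s (k ::ᵥ .nil) (fun i => by
        rw [e4, Subsingleton.elim i 0]; simp)
      have hws : ∀ r, r < 20 → r ≠ 9 → w r = s r := fun r hr h9 => hw3 r h9 (Or.inl hr)
      have horc : P.realOracle A (Encodable.encode (q k)) = P.eval A (q k) := by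
        simp [ComputationalProblem.realOracle]
      have hbit := hP.bit A k
      by_cases hb : β A k = true
      · refine ⟨_, .seq _ _ _ _ _ hw1 (.seq _ _ _ _ _ (.query _ _ _ (Encodable.encode (q k)) _ hw2)
          (.seq _ _ _ _ _ (.sub _ _ _ _) (.seq _ _ _ _ _ (.ifTrue _ _ _ _ _ ?_ (.add _ _ _ _))
            (.seq _ _ _ _ _ (.add _ _ _ _) (.seq _ _ _ _ _ (.add _ _ _ _) (.sub _ _ _ _)))))), ?_⟩
        · simp [hws, e12, horc]
          simpa using hbit.1 hb
        · refine ⟨?_, ?_, ?_, ?_, ?_, ?_, ?_, ?_, ?_, ?_⟩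
          · simp [hws, e0]
          · simp [hws, e1]
          · simp [hws, e2]
          · simp [hws, e3, e8, windowCode, hb]
          · simp [hws, e4, e6]
          · simp [hws, e5, e6]
            rw [Nat.cast_sub (by omega), Nat.cast_sub (by omega)]
            push_cast
            ring
          · simp [hws, e6]
          · simp [hws, e7]
          · simp [hws, e8]
            ring
          · simp [hws, e12]
      · refine ⟨_, .seq _ _ _ _ _ hw1 (.seq _ _ _ _ _ (.query _ _ _ (Encodable.encode (q k)) _ hw2)
          (.seq _ _ _ _ _ (.sub _ _ _ _) (.seq _ _ _ _ _ (.ifFalse _ _ _ _ _ ?_ (.add _ _ _ _))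
            (.seq _ _ _ _ _ (.add _ _ _ _) (.seq _ _ _ _ _ (.add _ _ _ _) (.sub _ _ _ _)))))), ?_⟩
        · simp [hws, e12, horc]
          simpa using fun h => hb (hbit.2 h)
        · refine ⟨?_, ?_, ?_, ?_, ?_, ?_, ?_, ?_, ?_, ?_⟩
          · simp [hws, e0]
          · simp [hws, e1]
          · simp [hws, e2]
          · simp [hws, e3, e7, windowCode, hb]
          · simp [hws, e4, e6]
          · simp [hws, e5, e6]
            rw [Nat.cast_sub (by omega), Nat.cast_sub (by omega)]
            push_cast
            ring
          · simp [hws, e6]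
          · simp [hws, e7]
          · simp [hws, e8]
            ring
          · simp [hws, e12])
    hI
  obtain ⟨y, hy, hI⟩ := hloop
  exact ⟨y, .seq _ _ _ _ _ hx' hy, hI.1, hI.2.1, hI.2.2.1, hI.2.2.2.1⟩

end

/-! ### Writing the output points into the registers -/

section

variable {Ω I : Type} [Encodable I] {P : ComputationalProblem Ω I} {β : Ω → ℕ → Bool} {q : ℕ → I}
  {out : ℕ × ℕ × ℕ × ℕ → List GaussCode} {Γ : List ℕ → Ω → HausdorffSpace}

/-- Copies the point in the registers `B`, `B + 1` to the places `1, …, k` of the output. -/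
def copyPoints (B : ℕ) : ℕ → RealProgram
  | 0 => .const 2 0
  | k + 1 => .seq (copyPoints B k) (.seq (.add (2 * k + 3) B 2) (.add (2 * k + 4) (B + 1) 2))

theorem copyPoints_runs (orc : ℕ → ℂ) (B k : ℕ) (hB : 2 * k + 2 < B) (x : ℕ → ℝ) :
    ∃ y, (copyPoints B k).Runs orc x y ∧ y 0 = x 0 ∧ y 2 = 0 ∧ (∀ r, 2 * k + 2 < r → y r = x r) ∧
      ∀ i, 0 < i → i ≤ k → y (2 * i + 1) = x B ∧ y (2 * i + 2) = x (B + 1) := by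
  induction k with
  | zero =>
    refine ⟨_, .const _ _ _, by simp, by simp, fun r hr => ?_, fun i h1 h2 => by omega⟩
    rw [Function.update_of_ne (by omega)]
  | succ k ih =>
    obtain ⟨y, h1, h2, h3, h4, h5⟩ := ih (by omega)
    refine ⟨_, .seq _ _ _ _ _ h1 (.seq _ _ _ _ _ (.add _ _ _ _) (.add _ _ _ _)), ?_, ?_,
      fun r hr => ?_, fun i hi hik => ?_⟩
    · rw [Function.update_of_ne (by omega), Function.update_of_ne (by omega), h2]
    · rw [Function.update_of_ne (by omega), Function.update_of_ne (by omega), h3]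
    · rw [Function.update_of_ne (by omega), Function.update_of_ne (by omega), h4 r (by omega)]
    · rcases Nat.lt_succ_iff_lt_or_eq.1 (Nat.lt_succ_of_le hik) with h | rfl
      · obtain ⟨a, b⟩ := h5 i hi (by omega)
        constructor
        · rw [Function.update_of_ne (by omega), Function.update_of_ne (by omega), a]
        · rw [Function.update_of_ne (by omega), Function.update_of_ne (by omega), b]
      · constructor
        · rw [Function.update_of_ne (by omega), show 2 * (k + 1) + 1 = 2 * k + 3 by ring,
            Function.update_self, h3, h4 B (by omega), add_zero]
        · rw [show 2 * (k + 1) + 2 = 2 * k + 4 by ring, Function.update_self,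
            Function.update_of_ne (by omega), Function.update_of_ne (by omega), h3,
            h4 (B + 1) (by omega), add_zero]

/-- Stores `(x_a - x_b) / (x_d + 1)` at the address in `x₉`, and increases the address. -/
def storeQuotient (a b d : ℕ) : RealProgram :=
  .seq (.sub 14 a b) (.seq (.add 15 d 6) (.seq (.div 14 14 15) (.seq (.store 9 14) (.add 9 9 6))))

theorem storeQuotient_runs (orc : ℕ → ℂ) {a b d m : ℕ} {x : ℕ → ℝ} (hd : d ≠ 14) (hm : 26 ≤ m)
    (h6 : x 6 = 1) (h9 : x 9 = m) (hne : x d + 1 ≠ 0) :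
    ∃ y, (storeQuotient a b d).Runs orc x y ∧ y m = (x a - x b) / (x d + 1) ∧
      y 9 = ((m + 1 : ℕ) : ℝ) ∧ ∀ r, r ≠ 9 → r ≠ 14 → r ≠ 15 → r ≠ m → y r = x r := by
  have e : ∀ r, r < 26 → r ≠ m := fun r hr => by omega
  refine ⟨_, .seq _ _ _ _ _ (.sub _ _ _ _) (.seq _ _ _ _ _ (.add _ _ _ _) (.seq _ _ _ _ _
    (.div _ _ _ _ ?_) (.seq _ _ _ _ _ (.store _ _ m _ ?_) (.add _ _ _ _)))), ?_, ?_,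
      fun r h1 h2 h3 h4 => ?_⟩
  · simpa [hd, h6] using hne
  · simp [h9]
  · rw [Function.update_of_ne (by omega), Function.update_self, Function.update_self]
    simp [hd, h6]
  · simp [e, h9, h6]
  · rw [Function.update_of_ne h1, Function.update_of_ne h4, Function.update_of_ne h2,
      Function.update_of_ne h3, Function.update_of_ne h2]

/-- Writes the points of `out` from an address `B` on, which can be chosen arbitrarily large. -/
theorem exists_program_writePoints (hout : Primrec out) :
    ∃ R₀, ∀ B, R₀ ≤ B → ∃ p : RealProgram, ∀ (orc : ℕ → ℂ) (n₃ n₂ n₁ W : ℕ) (x : ℕ → ℝ),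
      x 0 = n₃ → x 1 = n₂ → x 2 = n₁ → x 3 = W →
      ∃ y, p.Runs orc x y ∧ y 13 = (out (n₃, n₂, n₁, W)).length ∧
        ∀ i < (out (n₃, n₂, n₁, W)).length,
          y (B + 2 * i) = (gaussOfCode ((out (n₃, n₂, n₁, W)).getD i default)).re ∧
          y (B + 2 * i + 1) = (gaussOfCode ((out (n₃, n₂, n₁, W)).getD i default)).im := by
  have hv : ∀ (m : ℕ) (i : Fin m), Primrec fun v : List.Vector ℕ m => v.get i := fun m i =>
    Primrec.vector_get.comp Primrec.id (Primrec.const i)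
  have hlen : Primrec fun v : List.Vector ℕ 4 =>
      (out (v.get 0, v.get 1, v.get 2, v.get 3)).length :=
    Primrec.list_length.comp (hout.comp
      ((hv 4 0).pair ((hv 4 1).pair ((hv 4 2).pair (hv 4 3)))))
  have hent : ∀ i : Fin 6, Primrec fun v : List.Vector ℕ 5 =>
      codeEntry i ((out (v.get 0, v.get 1, v.get 2, v.get 3)).getD (v.get 4) default) := fun i =>
    (primrec_codeEntry i).comp ((Primrec.list_getD default).comp (hout.comp
      ((hv 5 0).pair ((hv 5 1).pair ((hv 5 2).pair (hv 5 3))))) (hv 5 4))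
  obtain ⟨p, R, hp⟩ := realComputable_of_primrec hlen (fun i => i) 13 20
    (fun i => by omega) (by norm_num)
  obtain ⟨p', R', hp'⟩ := exists_program_tuple (fun i => realComputable_of_primrec (hent i))
    (fun i => i) 20 (fun i => by omega) 6 le_rfl
  -- Addresses from here on lie beyond the work space of `p'`, so points already stored survive the
  -- later rounds of the loop.
  refine ⟨R' + 26, fun B hB => ?_⟩
  -- Registers: `4` the index of the point, `5` the countdown, `6` one, `9` the next address, `13`
  -- the number of points, `20` to `25` the six numbers of a code.
  let body : RealProgram := .seq p' (.seq (storeQuotient 20 21 22) (.seq (storeQuotient 23 24 25)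
    (.seq (.add 4 4 6) (.sub 5 5 6))))
  refine ⟨.seq (.seq p (.seq (.const 4 0) (.seq (.const 6 1) (.seq (.const 7 0) (.seq (.const 9 B)
    (.add 5 13 7)))))) (.whilePos 5 body), fun orc n₃ n₂ n₁ W x h0 h1 h2 h3 => ?_⟩
  set L := out (n₃, n₂, n₁, W) with hL
  let Inv : ℕ → (ℕ → ℝ) → Prop := fun k s => s 0 = (n₃ : ℝ) ∧ s 1 = (n₂ : ℝ) ∧ s 2 = (n₁ : ℝ) ∧
    s 3 = (W : ℝ) ∧ s 4 = (k : ℝ) ∧ s 5 = ((L.length - k : ℕ) : ℝ) ∧ s 6 = 1 ∧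
    s 9 = ((B + 2 * k : ℕ) : ℝ) ∧ s 13 = (L.length : ℝ) ∧
    ∀ i < k, s (B + 2 * i) = (gaussOfCode (L.getD i default)).re ∧
      s (B + 2 * i + 1) = (gaussOfCode (L.getD i default)).im
  obtain ⟨x', hx', hI⟩ : ∃ x', RealProgram.Runs orc (.seq p (.seq (.const 4 0) (.seq (.const 6 1)
      (.seq (.const 7 0) (.seq (.const 9 B) (.add 5 13 7)))))) x x' ∧ Inv 0 x' := by
    obtain ⟨w, hw1, hw2, hw3⟩ := hp orc x (n₃ ::ᵥ n₂ ::ᵥ n₁ ::ᵥ W ::ᵥ .nil) (by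
      intro i
      fin_cases i
      · exact h0
      · exact h1
      · exact h2
      · exact h3)
    have hw2' : w 13 = (L.length : ℝ) := hw2
    have hws : ∀ r, r < 13 → w r = x r := fun r hr => hw3 r (by omega) (Or.inl (by omega))
    refine ⟨_, .seq _ _ _ _ _ hw1 (.seq _ _ _ _ _ (.const _ _ _) (.seq _ _ _ _ _ (.const _ _ _)
      (.seq _ _ _ _ _ (.const _ _ _) (.seq _ _ _ _ _ (.const _ _ _) (.add _ _ _ _))))),
      ?_, ?_, ?_, ?_, ?_, ?_, ?_, ?_, ?_, fun i hi => absurd hi (Nat.not_lt_zero i)⟩ <;>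
    simp [hws, hw2', h0, h1, h2, h3]
  obtain ⟨y, hy, hI⟩ := exists_runs_while (orc := orc) (p := body) (c := 5) (Inv := Inv) L.length
    (fun k _ s hs => hs.2.2.2.2.2.1) (fun k hk s hs => by
      obtain ⟨e0, e1, e2, e3, e4, e5, e6, e9, e13, epts⟩ := hs
      obtain ⟨w, hw1, hw2, hw3⟩ := hp' orc s (n₃ ::ᵥ n₂ ::ᵥ n₁ ::ᵥ W ::ᵥ k ::ᵥ .nil) (by
        intro i
        fin_cases i
        · exact e0
        · exact e1
        · exact e2
        · exact e3
        · exact e4)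
      have hws : ∀ r, r < 20 → w r = s r := fun r hr => hw3 r (Or.inl hr)
      set c := L.getD k default with hc
      have w0 : w 20 = (c.1.1 : ℝ) := hw2 0 (by norm_num)
      have w1 : w 21 = (c.1.2.1 : ℝ) := hw2 1 (by norm_num)
      have w2 : w 22 = (c.1.2.2 : ℝ) := hw2 2 (by norm_num)
      have w3 : w 23 = (c.2.1 : ℝ) := hw2 3 (by norm_num)
      have w4 : w 24 = (c.2.2.1 : ℝ) := hw2 4 (by norm_num)
      have w5 : w 25 = (c.2.2.2 : ℝ) := hw2 5 (by norm_num)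
      have hne1 : (c.1.2.2 : ℝ) + 1 ≠ 0 := by positivity
      have hne2 : (c.2.2.2 : ℝ) + 1 ≠ 0 := by positivity
      obtain ⟨s₁, hs1, t1, t2, t3⟩ := storeQuotient_runs orc (a := 20) (b := 21) (d := 22)
        (m := B + 2 * k) (x := w) (by norm_num) (by omega) (by rw [hws 6 (by norm_num), e6])
        (by rw [hws 9 (by norm_num), e9]) (by rw [w2]; exact hne1)
      have hs₁ : ∀ r, r < 26 → r ≠ 9 → r ≠ 14 → r ≠ 15 → s₁ r = w r := fun r h1 h2 h3 h4 =>
        t3 r h2 h3 h4 (by omega)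
      obtain ⟨s₂, hs2, v1, v2, v3⟩ := storeQuotient_runs orc (a := 23) (b := 24) (d := 25)
        (m := B + 2 * k + 1) (x := s₁) (by norm_num) (by omega)
        (by rw [hs₁ 6 (by norm_num) (by norm_num) (by norm_num) (by norm_num),
          hws 6 (by norm_num), e6]) t2
        (by rw [hs₁ 25 (by norm_num) (by norm_num) (by norm_num) (by norm_num), w5]; exact hne2)
      have hs₂ : ∀ r, r < 14 → r ≠ 9 → s₂ r = s r := fun r h1 h2 => by
        rw [v3 r h2 (by omega) (by omega) (by omega),
          hs₁ r (by omega) h2 (by omega) (by omega), hws r (by omega)]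
      refine ⟨_, .seq _ _ _ _ _ hw1 (.seq _ _ _ _ _ hs1 (.seq _ _ _ _ _ hs2
        (.seq _ _ _ _ _ (.add _ _ _ _) (.sub _ _ _ _)))), ?_, ?_, ?_, ?_, ?_, ?_, ?_, ?_, ?_,
        fun i hi => ?_⟩
      · simp [hs₂, e0]
      · simp [hs₂, e1]
      · simp [hs₂, e2]
      · simp [hs₂, e3]
      · simp [hs₂, e4, e6]
      · simp [hs₂, e5, e6]
        rw [Nat.cast_sub (by omega), Nat.cast_sub (by omega)]
        push_cast
        ring
      · simp [hs₂, e6]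
      · rw [Function.update_of_ne (by norm_num), Function.update_of_ne (by norm_num), v2]
        congr 1
      · simp [hs₂, e13]
      · rw [Function.update_of_ne (by omega), Function.update_of_ne (by omega),
          Function.update_of_ne (by omega), Function.update_of_ne (by omega)]
        rcases Nat.lt_succ_iff_lt_or_eq.1 hi with h | rfl
        · rw [v3 _ (by omega) (by omega) (by omega) (by omega),
            t3 _ (by omega) (by omega) (by omega) (by omega), hw3 _ (Or.inr (by omega)),
            v3 _ (by omega) (by omega) (by omega) (by omega),
            t3 _ (by omega) (by omega) (by omega) (by omega), hw3 _ (Or.inr (by omega))]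
          exact epts i h
        · rw [v3 _ (by omega) (by omega) (by omega) (by omega), t1, v1, w0, w1, w2,
            hs₁ 23 (by norm_num) (by norm_num) (by norm_num) (by norm_num),
            hs₁ 24 (by norm_num) (by norm_num) (by norm_num) (by norm_num),
            hs₁ 25 (by norm_num) (by norm_num) (by norm_num) (by norm_num), w3, w4, w5,
            gaussOfCode_eq, ← hc]
          exact ⟨rfl, rfl⟩)
    hI
  exact ⟨y, .seq _ _ _ _ _ hx' hy, hI.2.2.2.2.2.2.2.2.1, hI.2.2.2.2.2.2.2.2.2⟩

theorem IsBinaryModel.isBSSComputable (hP : IsBinaryModel P β q) (hΓ : IsWindowOutput β out Γ)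
    (hout : Primrec out) (hne : ∀ t, out t ≠ []) : IsBSSComputable P 3 Γ := by
  obtain ⟨p, hp⟩ := exists_program_readWindow hP
  obtain ⟨R, hR⟩ := exists_program_writePoints hout
  -- Point `j` belongs in the registers `2j + 1` and `2j + 2`, so `B` is the first register of point
  -- `R'`. The lower places overlap the work space and are filled with copies of the first point,
  -- which does not change the set of output points.
  set R' := R + 20 with hR'
  set B := 2 * R' + 1 with hB
  obtain ⟨p', hp'⟩ := hR B (by omega)
  -- Register `2` serves as the zero for copying and also belongs to point `0`, so point `0` is
  -- written last.
  refine ⟨.seq p (.seq p' (.seq (.const 10 R') (.seq (.add 0 13 10) (.seq (copyPoints B (R' - 1))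
    (.seq (.add 1 B 2) (.add 2 (B + 1) 2)))))), fun A l hl => ?_⟩
  obtain ⟨n₃, n₂, n₁, rfl⟩ := exists_eq_of_length_eq_three hl
  obtain ⟨x, hx, x0, x1, x2, x3⟩ := hp A n₃ n₂ n₁
    (fun r => (([n₃, n₂, n₁].getD r 0 : ℕ) : ℝ)) rfl rfl rfl
  obtain ⟨y, hy, y13, ypts⟩ := hp' (P.realOracle A) n₃ n₂ n₁ _ x x0 x1 x2 x3
  set L := out (n₃, n₂, n₁, windowCode (β A) n₁) with hL
  have hLpos : 0 < L.length := List.length_pos_iff.2 (hne _)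
  set y' := Function.update (Function.update y 10 (((R' : ℕ) : ℚ) : ℝ)) 0
    (Function.update y 10 (((R' : ℕ) : ℚ) : ℝ) 13 + Function.update y 10 (((R' : ℕ) : ℚ) : ℝ) 10)
    with hy'
  obtain ⟨w, hw, w0, w2, wr, wpts⟩ := copyPoints_runs (P.realOracle A) B (R' - 1) (by omega) y'
  have hy'r : ∀ r, B ≤ r → y' r = y r := fun r hr => by
    rw [hy', Function.update_of_ne (by omega), Function.update_of_ne (by omega)]
  have hwr : ∀ r, B ≤ r → w r = y r := fun r hr => by rw [wr r (by omega), hy'r r hr]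
  have hpoint : ∀ j < L.length + R', ∃ i < L.length, gaussOfCode (L.getD i default) =
      ⟨Function.update (Function.update w 1 (w B + w 2)) 2
          (Function.update w 1 (w B + w 2) (B + 1) + Function.update w 1 (w B + w 2) 2) (2 * j + 1),
        Function.update (Function.update w 1 (w B + w 2)) 2
          (Function.update w 1 (w B + w 2) (B + 1) + Function.update w 1 (w B + w 2) 2)
          (2 * j + 2)⟩ ∧ (R' ≤ j → i = j - R') := by
    intro j hj
    rcases lt_or_ge j R' with h | h
    · refine ⟨0, hLpos, ?_, fun h' => by omega⟩
      obtain ⟨a, b⟩ := ypts 0 hLpos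
      rw [mul_zero, add_zero] at a b
      rcases Nat.eq_zero_or_pos j with rfl | h0
      · apply Complex.ext
        · simp [w2, hwr B le_rfl, a]
        · simp [w2, hwr (B + 1) (by omega), b]
      · obtain ⟨c, d⟩ := wpts j h0 (by omega)
        apply Complex.ext
        · simp only
          rw [Function.update_of_ne (by omega), Function.update_of_ne (by omega), c,
            hy'r B le_rfl, a]
        · simp only
          rw [Function.update_of_ne (by omega), Function.update_of_ne (by omega), d,
            hy'r (B + 1) (by omega), b]
    · refine ⟨j - R', by omega, ?_, fun _ => rfl⟩
      obtain ⟨a, b⟩ := ypts (j - R') (by omega)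
      apply Complex.ext
      · simp only
        rw [Function.update_of_ne (by omega), Function.update_of_ne (by omega), hwr _ (by omega), ← a]
        congr 1
        omega
      · simp only
        rw [Function.update_of_ne (by omega), Function.update_of_ne (by omega), hwr _ (by omega), ← b]
        congr 1
        omega
  refine ⟨_, L.length + R', .seq _ _ _ _ _ hx (.seq _ _ _ _ _ hy (.seq _ _ _ _ _ (.const _ _ _)
    (.seq _ _ _ _ _ (.add _ _ _ _) (.seq _ _ _ _ _ hw (.seq _ _ _ _ _ (.add _ _ _ _)
      (.add _ _ _ _)))))), ?_, ?_⟩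
  · simp [w0, hy', y13]
  · rw [hΓ]
    ext z
    constructor
    · rintro ⟨c, hc, rfl⟩
      rw [← hL] at hc
      obtain ⟨i, hi, rfl⟩ := List.mem_iff_getElem.1 hc
      obtain ⟨i', -, h1, h2⟩ := hpoint (i + R') (by omega)
      refine ⟨i + R', by omega, ?_⟩
      rw [← h1, h2 (by omega), Nat.add_sub_cancel, List.getD_eq_getElem _ _ hi]
    · rintro ⟨j, hj, rfl⟩
      obtain ⟨i, hi, h1, -⟩ := hpoint j hj
      refine ⟨L.getD i default, ?_, h1⟩
      rw [List.getD_eq_getElem _ _ hi]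
      exact List.getElem_mem hi

end

/-! ## The algorithm -/

/-- Codes for Gaussian integers: `(a, b, c, d)` stands for `(a - b) + (c - d) i`. -/
abbrev IntCode : Type := ℕ × ℕ × ℕ × ℕ

namespace IntCode

/-- The Gaussian integer with a given code. -/
noncomputable def val (x : IntCode) : ℂ := ⟨(x.1 : ℝ) - x.2.1, (x.2.2.1 : ℝ) - x.2.2.2⟩

/-- The sum of Gaussian integers. -/
def add (x y : IntCode) : IntCode :=
  (x.1 + y.1, x.2.1 + y.2.1, x.2.2.1 + y.2.2.1, x.2.2.2 + y.2.2.2)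

/-- The negative of a Gaussian integer. -/
def neg (x : IntCode) : IntCode := (x.2.1, x.1, x.2.2.2, x.2.2.1)

/-- The complex conjugate of a Gaussian integer. -/
def conj (x : IntCode) : IntCode := (x.1, x.2.1, x.2.2.2, x.2.2.1)

/-- The multiple of a Gaussian integer. -/
def scale (n : ℕ) (x : IntCode) : IntCode := (n * x.1, n * x.2.1, n * x.2.2.1, n * x.2.2.2)

/-- The product of Gaussian integers. -/
def mul (x y : IntCode) : IntCode :=
  (x.1 * y.1 + x.2.1 * y.2.1 + (x.2.2.1 * y.2.2.2 + x.2.2.2 * y.2.2.1),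
    x.1 * y.2.1 + x.2.1 * y.1 + (x.2.2.1 * y.2.2.1 + x.2.2.2 * y.2.2.2),
    x.1 * y.2.2.1 + x.2.1 * y.2.2.2 + (x.2.2.1 * y.1 + x.2.2.2 * y.2.1),
    x.1 * y.2.2.2 + x.2.1 * y.2.2.1 + (x.2.2.1 * y.2.1 + x.2.2.2 * y.1))

/-- The square of the difference of two natural numbers. -/
def sqDiff (a b : ℕ) : ℕ := (a - b) * (a - b) + (b - a) * (b - a)

/-- The square of the absolute value of a Gaussian integer. -/
def normSq (x : IntCode) : ℕ := sqDiff x.1 x.2.1 + sqDiff x.2.2.1 x.2.2.2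

/-- The sum of the first `n` terms of a sequence. -/
def sum (f : ℕ → IntCode) : ℕ → IntCode
  | 0 => (0, 0, 0, 0)
  | n + 1 => add (sum f n) (f n)

theorem val_add (x y : IntCode) : (add x y).val = x.val + y.val := by
  apply Complex.ext <;> simp [val, add] <;> ring

theorem val_neg (x : IntCode) : (neg x).val = -x.val := by
  apply Complex.ext <;> simp [val, neg]

theorem val_conj (x : IntCode) : (conj x).val = starRingEnd ℂ x.val := by
  apply Complex.ext <;> simp [val, conj]

theorem val_scale (n : ℕ) (x : IntCode) : (scale n x).val = n * x.val := by
  apply Complex.ext <;> simp [val, scale] <;> ring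

theorem val_mul (x y : IntCode) : (mul x y).val = x.val * y.val := by
  apply Complex.ext <;> simp [val, mul] <;> ring

/-- Subtraction in ℕ is truncated, so at least one of the two summands vanishes and the other is the
square. -/
theorem cast_sqDiff (a b : ℕ) : (sqDiff a b : ℝ) = ((a : ℝ) - b) ^ 2 := by
  unfold sqDiff
  rcases le_total a b with h | h
  · rw [Nat.sub_eq_zero_of_le h]
    push_cast [Nat.cast_sub h]
    ring
  · rw [Nat.sub_eq_zero_of_le h]
    push_cast [Nat.cast_sub h]
    ring

theorem cast_normSq (x : IntCode) : (normSq x : ℝ) = ‖x.val‖ ^ 2 := by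
  rw [normSq, Nat.cast_add, cast_sqDiff, cast_sqDiff, Complex.sq_norm, Complex.normSq_apply, val]
  ring

theorem val_sum (f : ℕ → IntCode) (n : ℕ) : (sum f n).val = ∑ i ∈ Finset.range n, (f i).val := by
  induction n with
  | zero => apply Complex.ext <;> simp [val, sum]
  | succ n ih => rw [sum, val_add, ih, Finset.sum_range_succ]

section Primrec

variable {α : Type} [Primcodable α]

theorem primrec_fst {f : α → IntCode} (hf : Primrec f) : Primrec fun a => (f a).1 :=
  Primrec.fst.comp hf

theorem primrec_snd {f : α → IntCode} (hf : Primrec f) : Primrec fun a => (f a).2.1 :=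
  Primrec.fst.comp (Primrec.snd.comp hf)

theorem primrec_third {f : α → IntCode} (hf : Primrec f) : Primrec fun a => (f a).2.2.1 :=
  Primrec.fst.comp (Primrec.snd.comp (Primrec.snd.comp hf))

theorem primrec_fourth {f : α → IntCode} (hf : Primrec f) : Primrec fun a => (f a).2.2.2 :=
  Primrec.snd.comp (Primrec.snd.comp (Primrec.snd.comp hf))

theorem primrec_add {f g : α → IntCode} (hf : Primrec f) (hg : Primrec g) :
    Primrec fun a => add (f a) (g a) :=
  (Primrec.nat_add.comp (primrec_fst hf) (primrec_fst hg)).pair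
    ((Primrec.nat_add.comp (primrec_snd hf) (primrec_snd hg)).pair
      ((Primrec.nat_add.comp (primrec_third hf) (primrec_third hg)).pair
        (Primrec.nat_add.comp (primrec_fourth hf) (primrec_fourth hg))))

theorem primrec_neg {f : α → IntCode} (hf : Primrec f) : Primrec fun a => neg (f a) :=
  (primrec_snd hf).pair ((primrec_fst hf).pair ((primrec_fourth hf).pair (primrec_third hf)))

theorem primrec_conj {f : α → IntCode} (hf : Primrec f) : Primrec fun a => conj (f a) :=
  (primrec_fst hf).pair ((primrec_snd hf).pair ((primrec_fourth hf).pair (primrec_third hf)))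

theorem primrec_scale {n : α → ℕ} {f : α → IntCode} (hn : Primrec n) (hf : Primrec f) :
    Primrec fun a => scale (n a) (f a) :=
  (Primrec.nat_mul.comp hn (primrec_fst hf)).pair
    ((Primrec.nat_mul.comp hn (primrec_snd hf)).pair
      ((Primrec.nat_mul.comp hn (primrec_third hf)).pair
        (Primrec.nat_mul.comp hn (primrec_fourth hf))))

theorem primrec_mul {f g : α → IntCode} (hf : Primrec f) (hg : Primrec g) :
    Primrec fun a => mul (f a) (g a) := by
  have key : ∀ {u₁ v₁ u₂ v₂ u₃ v₃ u₄ v₄ : α → ℕ}, Primrec u₁ → Primrec v₁ → Primrec u₂ →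
      Primrec v₂ → Primrec u₃ → Primrec v₃ → Primrec u₄ → Primrec v₄ → Primrec fun a =>
        u₁ a * v₁ a + u₂ a * v₂ a + (u₃ a * v₃ a + u₄ a * v₄ a) :=
    fun h₁ k₁ h₂ k₂ h₃ k₃ h₄ k₄ => Primrec.nat_add.comp
      (Primrec.nat_add.comp (Primrec.nat_mul.comp h₁ k₁) (Primrec.nat_mul.comp h₂ k₂))
      (Primrec.nat_add.comp (Primrec.nat_mul.comp h₃ k₃) (Primrec.nat_mul.comp h₄ k₄))
  have f₁ := primrec_fst hf
  have f₂ := primrec_snd hf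
  have f₃ := primrec_third hf
  have f₄ := primrec_fourth hf
  have g₁ := primrec_fst hg
  have g₂ := primrec_snd hg
  have g₃ := primrec_third hg
  have g₄ := primrec_fourth hg
  exact (key f₁ g₁ f₂ g₂ f₃ g₄ f₄ g₃).pair ((key f₁ g₂ f₂ g₁ f₃ g₃ f₄ g₄).pair
    ((key f₁ g₃ f₂ g₄ f₃ g₁ f₄ g₂).pair (key f₁ g₄ f₂ g₃ f₃ g₂ f₄ g₁)))

theorem primrec_normSq {f : α → IntCode} (hf : Primrec f) : Primrec fun a => normSq (f a) := by
  have key : ∀ {u v : α → ℕ}, Primrec u → Primrec v → Primrec fun a => sqDiff (u a) (v a) :=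
    fun hu hv => Primrec.nat_add.comp
      (Primrec.nat_mul.comp (Primrec.nat_sub.comp hu hv) (Primrec.nat_sub.comp hu hv))
      (Primrec.nat_mul.comp (Primrec.nat_sub.comp hv hu) (Primrec.nat_sub.comp hv hu))
  exact Primrec.nat_add.comp (key (primrec_fst hf) (primrec_snd hf))
    (key (primrec_third hf) (primrec_fourth hf))

theorem primrec_sum {f : α → ℕ → IntCode} {n : α → ℕ} (hf : Primrec₂ f) (hn : Primrec n) :
    Primrec fun a => sum (f a) (n a) := by
  have hstep : Primrec₂ fun (a : α) (p : ℕ × IntCode) => add p.2 (f a p.1) :=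
    primrec_add (Primrec.snd.comp Primrec.snd)
      (hf.comp Primrec.fst (Primrec.fst.comp Primrec.snd))
  refine (Primrec.nat_rec' hn (Primrec.const ((0, 0, 0, 0) : IntCode)) hstep).of_eq fun a => ?_
  induction n a with
  | zero => rfl
  | succ m ih => exact congrArg (fun s => add s (f a m)) ih

end Primrec

end IntCode

theorem primrec_sum_range {α : Type} [Primcodable α] {f : α → ℕ → ℕ} {n : α → ℕ}
    (hf : Primrec₂ f) (hn : Primrec n) :
    Primrec fun a => ∑ i ∈ Finset.range (n a), f a i := by
  have hstep : Primrec₂ fun (a : α) (p : ℕ × ℕ) => p.2 + f a p.1 :=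
    Primrec.nat_add.comp (Primrec.snd.comp Primrec.snd)
      (hf.comp Primrec.fst (Primrec.fst.comp Primrec.snd))
  refine (Primrec.nat_rec' hn (Primrec.const 0) hstep).of_eq fun a => ?_
  induction n a with
  | zero => rfl
  | succ m ih =>
    rw [Finset.sum_range_succ, ← ih]

/-- The list of coordinates of the `k`-th finitely supported vector. -/
def vectorList (k : ℕ) : List IntCode := (Encodable.decode k : Option (List IntCode)).getD []

/-- The coordinates of the `k`-th finitely supported vector. -/
def vectorEntry (k c : ℕ) : IntCode := (vectorList k).getD c (0, 0, 0, 0)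

/-- The `m`-th Gaussian integer. -/
def gridCode (m : ℕ) : IntCode := (Encodable.decode m : Option IntCode).getD (0, 0, 0, 0)

/-- The position of the `(r, c)`-entry of the matrix of the Koopman operator, or of its adjoint. -/
def entryIndex (adj : Bool) (r c : ℕ) : ℕ := if adj then Nat.pair r c else Nat.pair c r

/-- The bit of `W` at a given position. -/
def bitOf (W i : ℕ) : ℕ := W / 2 ^ i % 2

/-- The `r`-th coordinate of `2 ^ (n + 2) (A - z) v`, where `v` is the `k`-th vector, `z` is the
`m`-th grid point of mesh `2 ^ (-n - 2)`, and `A` is the matrix with the bits `W`. For the adjoint,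
`z` is replaced by its conjugate. -/
def windowResidual (adj : Bool) (n m k W r : ℕ) : IntCode :=
  IntCode.add (IntCode.scale (2 ^ (n + 2)) (IntCode.sum (fun c =>
    IntCode.scale (bitOf W (entryIndex adj r c)) (vectorEntry k c)) (vectorList k).length))
    (IntCode.neg (IntCode.mul (if adj then (gridCode m).conj else gridCode m) (vectorEntry k r)))

/-- The test whether the `k`-th vector shows that the `m`-th grid point is close to the spectrum. -/
def WindowTest (adj : Bool) (n m k W N : ℕ) : Prop :=
  ∑ r ∈ Finset.range N, (windowResidual adj n m k W r).normSq <
    16 * ∑ r ∈ Finset.range N, (vectorEntry k r).normSq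

instance (adj : Bool) (n m k W N : ℕ) : Decidable (WindowTest adj n m k W N) :=
  inferInstanceAs (Decidable (_ < _))

/-- The `m`-th grid point is accepted because of one of the first `b` vectors. -/
def WindowAccepts (both : Bool) (n b N W m : ℕ) : Prop :=
  ∃ k < b, WindowTest false n m k W N ∨ (both = true ∧ WindowTest true n m k W N)

instance (both : Bool) (n b N W m : ℕ) : Decidable (WindowAccepts both n b N W m) :=
  inferInstanceAs (Decidable (∃ k < b, _))

/-- The code of the `m`-th grid point of mesh `2 ^ (-n - 2)`. -/
def gridPointCode (n m : ℕ) : GaussCode :=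
  (((gridCode m).1, (gridCode m).2.1, 2 ^ (n + 2) - 1),
    ((gridCode m).2.2.1, (gridCode m).2.2.2, 2 ^ (n + 2) - 1))

/-- The accepted grid points. -/
def acceptedList (both : Bool) (t : ℕ × ℕ × ℕ × ℕ) : List GaussCode :=
  (List.range t.2.1).filterMap fun m =>
    if WindowAccepts both t.1 t.2.1 t.2.2.1 t.2.2.2 m then some (gridPointCode t.1 m) else none

/-- The output of the algorithm: the accepted grid points, or the point `0` if there are none. -/
def algorithmOutput (both : Bool) (t : ℕ × ℕ × ℕ × ℕ) : List GaussCode :=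
  if (acceptedList both t).length = 0 then [((0, 0, 0), (0, 0, 0))] else acceptedList both t

theorem algorithmOutput_ne_nil (both : Bool) (t : ℕ × ℕ × ℕ × ℕ) : algorithmOutput both t ≠ [] := by
  unfold algorithmOutput
  split_ifs with h
  · simp
  · exact fun h' => h (by simp [h'])

/-! ### Primitive recursiveness of the algorithm -/

theorem primrec_vectorList : Primrec vectorList :=
  Primrec.option_getD.comp Primrec.decode (Primrec.const [])

theorem primrec_vectorEntry : Primrec₂ vectorEntry :=
  (Primrec.list_getD (0, 0, 0, 0)).comp (primrec_vectorList.comp Primrec.fst) Primrec.snd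

theorem primrec_gridCode : Primrec gridCode :=
  Primrec.option_getD.comp Primrec.decode (Primrec.const (0, 0, 0, 0))

theorem primrec_entryIndex (adj : Bool) : Primrec₂ (entryIndex adj) := by
  cases adj with
  | true => exact Primrec₂.natPair
  | false => exact Primrec₂.natPair.swap

theorem primrec_bitOf : Primrec₂ bitOf :=
  Primrec.nat_mod.comp (Primrec.nat_div.comp Primrec.fst (primrec_two_pow.comp Primrec.snd))
    (Primrec.const 2)

section

variable {α : Type} [Primcodable α] {n m k W N b r : α → ℕ}

theorem primrec_mesh (hn : Primrec n) : Primrec fun a => 2 ^ (n a + 2) :=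
  primrec_two_pow.comp (Primrec.succ.comp (Primrec.succ.comp hn))

theorem primrec_windowResidual (adj : Bool) (hn : Primrec n) (hm : Primrec m) (hk : Primrec k)
    (hW : Primrec W) (hr : Primrec r) :
    Primrec fun a => windowResidual adj (n a) (m a) (k a) (W a) (r a) := by
  have hterm : Primrec₂ fun (a : α) (c : ℕ) =>
      IntCode.scale (bitOf (W a) (entryIndex adj (r a) c)) (vectorEntry (k a) c) :=
    IntCode.primrec_scale (primrec_bitOf.comp (hW.comp Primrec.fst)
      ((primrec_entryIndex adj).comp (hr.comp Primrec.fst) Primrec.snd))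
      (primrec_vectorEntry.comp (hk.comp Primrec.fst) Primrec.snd)
  refine IntCode.primrec_add (IntCode.primrec_scale (primrec_mesh hn) (IntCode.primrec_sum
    hterm (Primrec.list_length.comp (primrec_vectorList.comp hk))))
    (IntCode.primrec_neg (IntCode.primrec_mul ?_ (primrec_vectorEntry.comp hk hr)))
  cases adj with
  | true => exact IntCode.primrec_conj (primrec_gridCode.comp hm)
  | false => exact primrec_gridCode.comp hm

theorem primrecPred_windowTest (adj : Bool) (hn : Primrec n) (hm : Primrec m) (hk : Primrec k)
    (hW : Primrec W) (hN : Primrec N) :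
    PrimrecPred fun a => WindowTest adj (n a) (m a) (k a) (W a) (N a) := by
  have h1 : Primrec₂ fun (a : α) (r : ℕ) => (windowResidual adj (n a) (m a) (k a) (W a) r).normSq :=
    IntCode.primrec_normSq (primrec_windowResidual adj (hn.comp Primrec.fst) (hm.comp Primrec.fst)
      (hk.comp Primrec.fst) (hW.comp Primrec.fst) Primrec.snd)
  have h2 : Primrec₂ fun (a : α) (r : ℕ) => (vectorEntry (k a) r).normSq :=
    IntCode.primrec_normSq (primrec_vectorEntry.comp (hk.comp Primrec.fst) Primrec.snd)
  exact Primrec.nat_lt.comp (primrec_sum_range h1 hN)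
    (Primrec.nat_mul.comp (Primrec.const 16) (primrec_sum_range h2 hN))

theorem primrecPred_windowAccepts (both : Bool) (hn : Primrec n) (hb : Primrec b) (hN : Primrec N)
    (hW : Primrec W) (hm : Primrec m) :
    PrimrecPred fun a => WindowAccepts both (n a) (b a) (N a) (W a) (m a) := by
  have hR : PrimrecRel fun (k : ℕ) (a : α) => WindowTest false (n a) (m a) k (W a) (N a) ∨
      (both = true ∧ WindowTest true (n a) (m a) k (W a) (N a)) := by
    refine PrimrecPred.or (primrecPred_windowTest false (hn.comp Primrec.snd) (hm.comp Primrec.snd)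
      Primrec.fst (hW.comp Primrec.snd) (hN.comp Primrec.snd)) ?_
    cases both with
    | true =>
      exact (primrecPred_windowTest true (hn.comp Primrec.snd) (hm.comp Primrec.snd)
        Primrec.fst (hW.comp Primrec.snd) (hN.comp Primrec.snd)).of_eq fun _ => by simp
    | false =>
      -- `0 < 0` plays the role of the false predicate.
      exact (Primrec.nat_lt.comp (Primrec.const 0) (Primrec.const 0)).of_eq fun _ => by simp
  exact (hR.exists_mem_list.comp (Primrec.list_range.comp hb) Primrec.id).of_eq fun a => by
    simp [WindowAccepts]

theorem primrec_gridPointCode (hn : Primrec n) (hm : Primrec m) :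
    Primrec fun a => gridPointCode (n a) (m a) := by
  have h1 := primrec_gridCode.comp hm
  have h2 : Primrec fun a => 2 ^ (n a + 2) - 1 := Primrec.pred.comp (primrec_mesh hn)
  exact ((IntCode.primrec_fst h1).pair ((IntCode.primrec_snd h1).pair h2)).pair
    ((IntCode.primrec_third h1).pair ((IntCode.primrec_fourth h1).pair h2))

end

theorem primrec_algorithmOutput (both : Bool) : Primrec (algorithmOutput both) := by
  have hacc : Primrec (acceptedList both) := by
    have t1 : Primrec fun p : (ℕ × ℕ × ℕ × ℕ) × ℕ => p.1 := Primrec.fst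
    refine Primrec.listFilterMap (Primrec.list_range.comp (Primrec.fst.comp Primrec.snd))
      (Primrec.ite (primrecPred_windowAccepts both (IntCode.primrec_fst t1)
        (IntCode.primrec_snd t1) (IntCode.primrec_third t1) (IntCode.primrec_fourth t1) Primrec.snd)
        (Primrec.option_some.comp (primrec_gridPointCode (IntCode.primrec_fst t1) Primrec.snd))
        (Primrec.const none))
  exact Primrec.ite (Primrec.eq.comp (Primrec.list_length.comp hacc) (Primrec.const 0))
    (Primrec.const _) hacc

/-! ## Approximate eigenvectors -/

section

variable {E : Type*} [NormedAddCommGroup E] [NormedSpace ℂ E]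

/-- There is an `ε`-approximate eigenvector of `T` at `z`. -/
def HasApproxEigenvector (T : E →L[ℂ] E) (z : ℂ) (ε : ℝ) : Prop :=
  ∃ x, ‖T x - z • x‖ < ε * ‖x‖

/-- Otherwise `T - z` is bounded below by `ε`, and `T - w` by `ε - |w - z| > 0`. -/
theorem hasApproxEigenvector_of_dist_lt {T : E →L[ℂ] E} {w z : ℂ} {ε : ℝ}
    (hw : w ∈ approximatePointSpectrum T) (h : dist w z < ε) : HasApproxEigenvector T z ε := by
  by_contra hc
  unfold HasApproxEigenvector at hc
  push Not at hc
  refine (notMem_approximatePointSpectrum_iff T w).2 ⟨ε - dist w z, by linarith, fun x => ?_⟩ hw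
  have h2 : ‖T x - z • x‖ ≤ ‖T x - w • x‖ + ‖(w - z) • x‖ := by
    refine le_trans (le_of_eq ?_) (norm_add_le _ _)
    rw [sub_smul]
    congr 1
    abel
  rw [norm_smul] at h2
  rw [dist_eq_norm]
  linarith [hc x]

/-- This bound makes the set of accepted grid points finite, and gives the compactness used in the
next lemma. -/
theorem HasApproxEigenvector.norm_lt {T : E →L[ℂ] E} {z : ℂ} {ε : ℝ}
    (h : HasApproxEigenvector T z ε) : ‖z‖ < ‖T‖ + ε := by
  obtain ⟨x, hx⟩ := h
  have hx0 : 0 < ‖x‖ := by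
    rw [norm_pos_iff]
    rintro rfl
    simp at hx
  have h1 := norm_sub_norm_le (z • x) (T x)
  rw [norm_sub_rev, norm_smul] at h1
  have h2 := T.le_opNorm x
  have h3 : ‖z‖ * ‖x‖ < (‖T‖ + ε) * ‖x‖ := by nlinarith
  exact lt_of_mul_lt_mul_right h3 hx0.le

/-- Points with good approximate eigenvectors are close to the approximate point spectrum. -/
theorem exists_dist_lt_of_hasApproxEigenvector (T : E →L[ℂ] E) {δ : ℝ} (hδ : 0 < δ) :
    ∃ ε > 0, ∀ z, HasApproxEigenvector T z ε → ∃ w ∈ approximatePointSpectrum T, dist z w < δ := by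
  by_contra! hc
  have hpos : ∀ n : ℕ, (0 : ℝ) < 1 / ((n : ℝ) + 1) := fun n => by positivity
  choose z hz hfar using fun n : ℕ => hc (1 / ((n : ℝ) + 1)) (hpos n)
  have hbdd : ∀ n, z n ∈ Metric.closedBall (0 : ℂ) (‖T‖ + 1) := fun n => by
    rw [mem_closedBall_zero_iff]
    refine (hz n).norm_lt.le.trans ?_
    gcongr
    rw [div_le_one (by positivity)]
    linarith [(Nat.cast_nonneg n : (0 : ℝ) ≤ n)]
  -- The limit `w` lies in the approximate point spectrum: the approximate eigenvector at `z (φ n)`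
  -- serves for `w` with error `1/(φ n + 1) + |z (φ n) - w|`. This contradicts `hfar`.
  obtain ⟨w, -, φ, hφ, hlim⟩ := (isCompact_closedBall (0 : ℂ) (‖T‖ + 1)).tendsto_subseq hbdd
  have hw : w ∈ approximatePointSpectrum T := by
    by_contra hw
    obtain ⟨c, hcpos, hlow⟩ := (notMem_approximatePointSpectrum_iff T w).1 hw
    have hsum : Tendsto (fun n => 1 / ((φ n : ℝ) + 1) + dist (z (φ n)) w) atTop (𝓝 (0 + 0)) :=
      ((tendsto_one_div_add_atTop_nhds_zero_nat (𝕜 := ℝ)).comp hφ.tendsto_atTop).add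
        (tendsto_iff_dist_tendsto_zero.1 hlim)
    rw [add_zero] at hsum
    obtain ⟨n, hn⟩ := (hsum.eventually (gt_mem_nhds hcpos)).exists
    obtain ⟨x, hx⟩ := hz (φ n)
    have h2 : ‖T x - w • x‖ ≤ ‖T x - z (φ n) • x‖ + ‖(z (φ n) - w) • x‖ := by
      refine le_trans (le_of_eq ?_) (norm_add_le _ _)
      rw [sub_smul]
      congr 1
      abel
    rw [norm_smul] at h2
    rw [dist_eq_norm] at hn
    have := hlow x
    nlinarith [norm_nonneg x]
  obtain ⟨n, hn⟩ := ((tendsto_iff_dist_tendsto_zero.1 hlim).eventually (gt_mem_nhds hδ)).exists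
  exact absurd hn (not_lt.2 (hfar (φ n) w hw))

end

/-- The spectrum of an operator on a Hilbert space consists of its approximate point spectrum and
the complex conjugates of the approximate point spectrum of the adjoint. -/
theorem mem_spectrum_iff_approximatePointSpectrum {H : Type*} [NormedAddCommGroup H]
    [InnerProductSpace ℂ H] [CompleteSpace H] (T : H →L[ℂ] H) (z : ℂ) :
    z ∈ spectrum ℂ T ↔ z ∈ approximatePointSpectrum T ∨
      starRingEnd ℂ z ∈ approximatePointSpectrum (ContinuousLinearMap.adjoint T) := by
  constructor
  · intro hz
    by_contra! hc
    obtain ⟨c, hc0, hlow⟩ := (notMem_approximatePointSpectrum_iff _ _).1 hc.1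
    obtain ⟨c', hc0', hlow'⟩ := (notMem_approximatePointSpectrum_iff _ _).1 hc.2
    set S : H →L[ℂ] H := T - z • 1 with hS
    have hSx : ∀ x, S x = T x - z • x := fun x => by simp [hS]
    have hadj : ∀ x, ContinuousLinearMap.adjoint S x =
        ContinuousLinearMap.adjoint T x - starRingEnd ℂ z • x := fun x => by
      refine ext_inner_left ℂ fun y => ?_
      rw [ContinuousLinearMap.adjoint_inner_right, hSx, inner_sub_left, inner_sub_right,
        ContinuousLinearMap.adjoint_inner_right, inner_smul_left, inner_smul_right]
    -- A lower bound for `S` makes it injective with closed range; a lower bound for its adjoint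
    -- makes the range dense.
    have hanti : AntilipschitzWith ⟨c⁻¹, by positivity⟩ S := by
      refine AddMonoidHomClass.antilipschitz_of_bound S fun x => ?_
      change ‖x‖ ≤ c⁻¹ * ‖S x‖
      rw [hSx, le_inv_mul_iff₀ hc0]
      exact hlow x
    have hker : LinearMap.ker (ContinuousLinearMap.adjoint S : H →ₗ[ℂ] H) = ⊥ := by
      rw [LinearMap.ker_eq_bot']
      intro x hx
      have h1 : ContinuousLinearMap.adjoint S x = 0 := hx
      have h2 := hlow' x
      rw [← hadj, h1, norm_zero] at h2
      exact norm_le_zero_iff.1 (nonpos_of_mul_nonpos_right h2 hc0')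
    have hrange : LinearMap.range (S : H →ₗ[ℂ] H) = ⊤ := by
      have hclosed : IsClosed (LinearMap.range (S : H →ₗ[ℂ] H) : Set H) := by
        have := hanti.isClosed_range S.uniformContinuous
        exact this
      have horth : (LinearMap.range (S : H →ₗ[ℂ] H))ᗮ = ⊥ := by
        rw [← hker]
        exact S.orthogonal_range
      rw [← hclosed.submodule_topologicalClosure_eq, Submodule.topologicalClosure_eq_top_iff]
      exact horth
    have hunit : IsUnit S := by
      rw [ContinuousLinearMap.isUnit_iff_bijective]
      exact ⟨hanti.injective, LinearMap.range_eq_top.1 hrange⟩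
    refine spectrum.mem_iff.1 hz ?_
    rw [← neg_sub, Algebra.algebraMap_eq_smul_one]
    exact hunit.neg
  · rintro (h | h)
    · exact approximatePointSpectrum_subset_spectrum T h
    · have := approximatePointSpectrum_subset_spectrum _ h
      rw [← ContinuousLinearMap.star_eq_adjoint] at this
      have h2 := spectrum.star_mem_resolventSet_iff (R := ℂ) (a := star T) (r := z)
      rw [star_star] at h2
      by_contra hz
      have hz' : z ∈ resolventSet ℂ T := by
        rwa [spectrum, Set.notMem_compl_iff] at hz
      exact this (h2.2 hz')

/-! ## Finitely supported vectors -/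

/-- The `k`-th finitely supported vector. -/
noncomputable def finiteVector (k : ℕ) : EllTwo :=
  ∑ c ∈ Finset.range (vectorList k).length, lp.single 2 c (vectorEntry k c).val

theorem vectorEntry_val_eq_zero {k c : ℕ} (h : (vectorList k).length ≤ c) :
    (vectorEntry k c).val = 0 := by
  rw [vectorEntry, List.getD_eq_default _ _ h]
  apply Complex.ext <;> simp [IntCode.val]

theorem finiteVector_apply (k r : ℕ) : finiteVector k r = (vectorEntry k r).val := by
  rw [finiteVector, lp.coeFn_sum, Finset.sum_apply]
  simp only [lp.single_apply, Pi.single_apply]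
  rw [Finset.sum_ite_eq]
  split_ifs with h
  · rfl
  · exact (vectorEntry_val_eq_zero (by simpa using h)).symm

/-- A Gaussian integer close to `N w`. -/
noncomputable def roundCode (N : ℕ) (w : ℂ) : IntCode :=
  (⌊N * w.re⌋.toNat, (-⌊N * w.re⌋).toNat, ⌊N * w.im⌋.toNat, (-⌊N * w.im⌋).toNat)

theorem val_roundCode (N : ℕ) (w : ℂ) :
    (roundCode N w).val = ⟨(⌊N * w.re⌋ : ℝ), (⌊N * w.im⌋ : ℝ)⟩ := by
  have h : ∀ n : ℤ, ((n.toNat : ℕ) : ℝ) - ((-n).toNat : ℕ) = n := fun n => by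
    have := Int.toNat_sub_toNat_neg n
    exact_mod_cast this
  apply Complex.ext
  · exact h _
  · exact h _

theorem dist_roundCode_le {N : ℕ} (hN : 0 < N) (w : ℂ) :
    dist ((roundCode N w).val / N) w ≤ 2 / N := by
  have hN' : (0 : ℝ) < N := Nat.cast_pos.2 hN
  have h : ∀ t : ℝ, |(⌊N * t⌋ : ℝ) / N - t| ≤ 1 / N := fun t => by
    rw [div_sub' hN'.ne', abs_div, abs_of_pos hN']
    refine div_le_div_of_nonneg_right ?_ hN'.le
    rw [abs_sub_comm, abs_le]
    constructor
    · linarith [Int.floor_le (N * t)]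
    · linarith [Int.lt_floor_add_one (N * t)]
  rw [dist_eq_norm]
  refine (Complex.norm_le_abs_re_add_abs_im _).trans ?_
  rw [val_roundCode]
  have e1 : ((⟨(⌊N * w.re⌋ : ℝ), (⌊N * w.im⌋ : ℝ)⟩ : ℂ) / N - w).re = ⌊N * w.re⌋ / N - w.re := by
    simp
  have e2 : ((⟨(⌊N * w.re⌋ : ℝ), (⌊N * w.im⌋ : ℝ)⟩ : ℂ) / N - w).im = ⌊N * w.im⌋ / N - w.im := by
    simp
  rw [e1, e2, show (2 : ℝ) / N = 1 / N + 1 / N by ring]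
  exact add_le_add (h _) (h _)

/-- An approximate eigenvector can be chosen among the multiples of the vectors
`finiteVector k`. -/
theorem HasApproxEigenvector.exists_finiteVector {T : EllTwo →L[ℂ] EllTwo} {z : ℂ} {ε : ℝ}
    (h : HasApproxEigenvector T z ε) :
    ∃ k, ‖T (finiteVector k) - z • finiteVector k‖ < ε * ‖finiteVector k‖ := by
  obtain ⟨x, hx⟩ := h
  -- The condition is open and invariant under non-zero multiples: `x` may be truncated, rounded to
  -- denominator `N + 1`, and multiplied by `N + 1`.
  have hopen : IsOpen {y : EllTwo | ‖T y - z • y‖ < ε * ‖y‖} :=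
    isOpen_lt (by fun_prop) (by fun_prop)
  have h1 : Tendsto (fun s : ℕ => ∑ c ∈ Finset.range s, lp.single 2 c (x c)) atTop (𝓝 x) :=
    (lp.hasSum_single (by simp) x).tendsto_sum_nat
  obtain ⟨s, hs⟩ := (h1.eventually (hopen.mem_nhds hx)).exists
  have h2 : Tendsto (fun N : ℕ => ∑ c ∈ Finset.range s,
      (lp.single 2 c ((roundCode (N + 1) (x c)).val / ((N + 1 : ℕ) : ℂ)) : EllTwo)) atTop
      (𝓝 (∑ c ∈ Finset.range s, lp.single 2 c (x c))) := by
    refine tendsto_finsetSum _ fun c _ => ?_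
    refine ((lp.isometry_single (E := fun _ : ℕ => ℂ) (p := 2) c).continuous.tendsto _).comp ?_
    rw [tendsto_iff_dist_tendsto_zero]
    refine squeeze_zero (fun _ => dist_nonneg) (fun N => dist_roundCode_le N.succ_pos (x c)) ?_
    have := (tendsto_one_div_add_atTop_nhds_zero_nat (𝕜 := ℝ)).const_mul 2
    simpa [div_eq_mul_inv] using this
  obtain ⟨N, hN⟩ := (h2.eventually (hopen.mem_nhds hs)).exists
  refine ⟨Encodable.encode ((List.range s).map fun c => roundCode (N + 1) (x c)), ?_⟩
  set k := Encodable.encode ((List.range s).map fun c => roundCode (N + 1) (x c)) with hk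
  have hlist : vectorList k = (List.range s).map fun c => roundCode (N + 1) (x c) := by
    rw [vectorList, hk, Encodable.encodek, Option.getD_some]
  have hvec : finiteVector k = ((N + 1 : ℕ) : ℂ) • ∑ c ∈ Finset.range s,
      (lp.single 2 c ((roundCode (N + 1) (x c)).val / ((N + 1 : ℕ) : ℂ)) : EllTwo) := by
    rw [finiteVector, Finset.smul_sum, hlist, List.length_map, List.length_range]
    refine Finset.sum_congr rfl fun c hc => ?_
    rw [← lp.single_smul, smul_eq_mul, mul_div_cancel₀ _ (Nat.cast_ne_zero.2 N.succ_ne_zero),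
      vectorEntry, hlist, List.getD_eq_getElem _ _ (by simpa using hc)]
    simp
  have hpos : (0 : ℝ) < ‖((N + 1 : ℕ) : ℂ)‖ := by
    rw [norm_pos_iff]
    exact Nat.cast_ne_zero.2 N.succ_ne_zero
  rw [hvec, map_smul, smul_comm z, ← smul_sub, norm_smul, norm_smul, mul_left_comm]
  exact mul_lt_mul_of_pos_left hN hpos

theorem norm_sq_eq_sum_of_eq_zero (x : EllTwo) {R : ℕ} (h : ∀ r, R ≤ r → x r = 0) :
    ‖x‖ ^ 2 = ∑ r ∈ Finset.range R, ‖x r‖ ^ 2 := by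
  have h2 : (0 : ℝ) < (2 : ENNReal).toReal := by simp
  have := lp.norm_rpow_eq_tsum h2 x
  simp only [ENNReal.toReal_ofNat, Real.rpow_ofNat] at this
  rw [this, tsum_eq_sum fun r hr => ?_]
  rw [h r (by simpa using hr)]
  simp

/-! ## Correctness of the test -/

open Classical in
/-- The operator `A` has a matrix of zeros and ones, with ones at the places in `a`. -/
def HasBinaryMatrix (A : EllTwo →L[ℂ] EllTwo) (a : ℕ → ℕ → Prop) : Prop :=
  ∀ r c, A (lp.single 2 c 1) r = if a r c then 1 else 0

/-- Columns are square summable, so the ones in them are finite in number. This spares a further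
limit over the rows. -/
theorem HasBinaryMatrix.finite_column {A : EllTwo →L[ℂ] EllTwo} {a : ℕ → ℕ → Prop}
    (h : HasBinaryMatrix A a) (c : ℕ) : {r | a r c}.Finite := by
  classical
  have hs : Summable fun r => ‖A (lp.single 2 c 1) r‖ ^ (2 : ℝ) := by
    simpa using (lp.memℓp (A (lp.single 2 c 1))).summable (by simp)
  have := hs.tendsto_cofinite_zero.eventually (gt_mem_nhds (zero_lt_one' ℝ))
  refine Set.Finite.subset this fun r hr => ?_
  have hr' : a r c := hr
  simp [h r c, hr']

open Classical in
theorem HasBinaryMatrix.finiteVector_apply {A : EllTwo →L[ℂ] EllTwo} {a : ℕ → ℕ → Prop}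
    (h : HasBinaryMatrix A a) (k r : ℕ) : A (finiteVector k) r =
      ∑ c ∈ Finset.range (vectorList k).length,
        (if a r c then 1 else 0) * (vectorEntry k c).val := by
  rw [finiteVector, map_sum, lp.coeFn_sum, Finset.sum_apply]
  refine Finset.sum_congr rfl fun c _ => ?_
  have : (lp.single 2 c (vectorEntry k c).val : EllTwo) =
      (vectorEntry k c).val • lp.single 2 c 1 := by
    rw [← lp.single_smul, smul_eq_mul, mul_one]
  rw [this, map_smul, lp.coeFn_smul, Pi.smul_apply, h r c, smul_eq_mul, mul_comm]

theorem bitOf_windowCode (β : ℕ → Bool) (N i : ℕ) :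
    bitOf (windowCode β N) i = if i < N ∧ β i = true then 1 else 0 := by
  have h := testBit_windowCode β N i
  rw [Nat.testBit_eq_decide_div_mod_eq] at h
  have h2 : bitOf (windowCode β N) i = 1 ↔ i < N ∧ β i = true := by
    unfold bitOf
    rw [← decide_eq_true_iff (p := windowCode β N / 2 ^ i % 2 = 1), h]
    simp
  split_ifs with hi
  · exact h2.2 hi
  · have h3 : bitOf (windowCode β N) i < 2 := Nat.mod_lt _ (by norm_num)
    have h4 : bitOf (windowCode β N) i ≠ 1 := fun e => hi (h2.1 e)
    omega

/-- The `m`-th grid point of mesh `2 ^ (-n - 2)`. -/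
noncomputable def gridPoint (n m : ℕ) : ℂ := (gridCode m).val / (2 ^ (n + 2) : ℕ)

/-- For large windows the test compares the norms of `(A - z) v` and of `v`. -/
theorem HasBinaryMatrix.eventually_windowTest_iff {A : EllTwo →L[ℂ] EllTwo} {β : ℕ → Bool}
    {adj : Bool} (h : HasBinaryMatrix A fun r c => β (entryIndex adj r c) = true) (n m k : ℕ) :
    ∀ᶠ N in atTop, WindowTest adj n m k (windowCode β N) N ↔
      ‖A (finiteVector k) - (if adj then starRingEnd ℂ (gridPoint n m) else gridPoint n m) •
        finiteVector k‖ < (1 / 2) ^ n * ‖finiteVector k‖ := by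
  classical
  set z := if adj then starRingEnd ℂ (gridPoint n m) else gridPoint n m with hz
  set ℓ := (vectorList k).length with hℓ
  -- The vector meets only the columns below `ℓ`, and all ones in these columns lie in the rows
  -- below `R`.
  obtain ⟨R, hR⟩ : ∃ R, ∀ c < ℓ, ∀ r, β (entryIndex adj r c) = true → r < R := by
    choose b hb using fun c => (h.finite_column c).bddAbove
    refine ⟨(Finset.range ℓ).sup b + 1, fun c hc r hr => Nat.lt_succ_of_le ?_⟩
    exact (hb c hr).trans (Finset.le_sup (Finset.mem_range.2 hc))
  have hev : ∀ᶠ N in atTop, ∀ r ∈ Finset.range (max R ℓ), ∀ c ∈ Finset.range ℓ,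
      entryIndex adj r c < N := by
    rw [Finset.eventually_all]
    intro r _
    rw [Finset.eventually_all]
    exact fun c _ => eventually_gt_atTop _
  filter_upwards [hev, eventually_ge_atTop (max R ℓ)] with N hN hNR
  have hD : ((2 ^ (n + 2) : ℕ) : ℂ) ≠ 0 := Nat.cast_ne_zero.2 (by positivity)
  have hzD : ((2 ^ (n + 2) : ℕ) : ℂ) * z = (if adj then (gridCode m).conj else gridCode m).val := by
    rw [hz, gridPoint]
    cases adj with
    | true =>
      simp only [if_true, map_div₀, Complex.conj_natCast, IntCode.val_conj]
      rw [mul_div_cancel₀ _ hD]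
    | false =>
      simp only [Bool.false_eq_true, if_false]
      rw [mul_div_cancel₀ _ hD]
  have hres : ∀ r, (windowResidual adj n m k (windowCode β N) r).val =
      (2 ^ (n + 2) : ℕ) * (A (finiteVector k) - z • finiteVector k) r := by
    intro r
    have hsum : ∑ c ∈ Finset.range ℓ, (IntCode.scale (bitOf (windowCode β N) (entryIndex adj r c))
        (vectorEntry k c)).val = A (finiteVector k) r := by
      rw [h.finiteVector_apply]
      refine Finset.sum_congr rfl fun c hc => ?_
      rw [IntCode.val_scale, bitOf_windowCode]
      -- A one lies in a row below `R` and hence in the window; a zero is read as `0` inside and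
      -- outside the window.
      by_cases hb : β (entryIndex adj r c) = true
      · have h1 : r < R := hR c (Finset.mem_range.1 hc) r hb
        have h2 := hN r (Finset.mem_range.2 (lt_of_lt_of_le h1 (le_max_left _ _))) c hc
        simp [hb, h2]
      · simp [hb]
    rw [windowResidual, IntCode.val_add, IntCode.val_scale, IntCode.val_neg, IntCode.val_mul,
      IntCode.val_sum, hsum, ← hzD, lp.coeFn_sub, Pi.sub_apply, lp.coeFn_smul, Pi.smul_apply,
      _root_.finiteVector_apply, smul_eq_mul]
    ring
  have hv0 : ∀ r, N ≤ r → finiteVector k r = 0 := fun r hr => by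
    rw [_root_.finiteVector_apply]
    exact vectorEntry_val_eq_zero ((le_max_right R ℓ).trans (hNR.trans hr))
  have hw0 : ∀ r, N ≤ r → (A (finiteVector k) - z • finiteVector k) r = 0 := fun r hr => by
    rw [lp.coeFn_sub, Pi.sub_apply, lp.coeFn_smul, Pi.smul_apply, hv0 r hr, smul_zero, sub_zero,
      h.finiteVector_apply]
    refine Finset.sum_eq_zero fun c hc => ?_
    rw [if_neg, zero_mul]
    intro hb
    have := hR c (Finset.mem_range.1 hc) r hb
    have := le_max_left R ℓ
    omega
  have e1 : ((∑ r ∈ Finset.range N, (windowResidual adj n m k (windowCode β N) r).normSq : ℕ) : ℝ) =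
      (2 ^ (n + 2) * ‖A (finiteVector k) - z • finiteVector k‖) ^ 2 := by
    rw [mul_pow, norm_sq_eq_sum_of_eq_zero _ hw0, Finset.mul_sum, Nat.cast_sum]
    refine Finset.sum_congr rfl fun r _ => ?_
    rw [IntCode.cast_normSq, hres, norm_mul, mul_pow]
    congr 2
    simp
  -- The residual carries the factor `2^(n+2) = 4 * 2^n`; the `4` is matched by `16 = 4^2` on the
  -- squared norm of the vector.
  have e2 : ((16 * ∑ r ∈ Finset.range N, (vectorEntry k r).normSq : ℕ) : ℝ) =
      (4 * ‖finiteVector k‖) ^ 2 := by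
    rw [mul_pow, norm_sq_eq_sum_of_eq_zero _ hv0, Nat.cast_mul, Nat.cast_sum]
    congr 1
    · norm_num
    · refine Finset.sum_congr rfl fun r _ => ?_
      rw [IntCode.cast_normSq, _root_.finiteVector_apply]
  rw [WindowTest, ← Nat.cast_lt (α := ℝ), e1, e2,
    pow_lt_pow_iff_left₀ (by positivity) (by positivity) two_ne_zero]
  have hp : (0 : ℝ) < 2 ^ n := by positivity
  rw [one_div, inv_pow, inv_mul_eq_div, lt_div_iff₀ hp, pow_add]
  constructor <;> intro hlt <;> linarith

/-! ## Koopman operators have binary matrices -/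

open Classical in
/-- The graph of a discrete system as a binary sequence. -/
noncomputable def graphBits (F : DiscreteSystem) (i : ℕ) : Bool :=
  decide (F.1 i.unpair.2 = (i.unpair.1 : ℕ∞))

theorem koopman_single_apply (F : DiscreteSystem) (r c : ℕ) :
    koopman F (lp.single 2 c 1) r = if graphBits F (Nat.pair c r) = true then 1 else 0 := by
  rw [koopman_apply, koopmanAction, graphBits, Nat.unpair_pair]
  simp only [decide_eq_true_eq]
  cases hF : F.1 r with
  | top => simp
  | coe i =>
    by_cases hic : i = c
    · simp [hic]
    · simp [hic, lp.single_apply]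

theorem hasBinaryMatrix_koopman (F : DiscreteSystem) :
    HasBinaryMatrix (koopman F) fun r c => graphBits F (entryIndex false r c) = true := by
  intro r c
  rw [koopman_single_apply]
  by_cases h : graphBits F (Nat.pair c r) = true <;> simp [entryIndex, h]

theorem hasBinaryMatrix_adjoint_koopman (F : DiscreteSystem) :
    HasBinaryMatrix (ContinuousLinearMap.adjoint (koopman F))
      fun r c => graphBits F (entryIndex true r c) = true := by
  intro r c
  have h1 : inner ℂ (lp.single 2 r 1 : EllTwo)
      (ContinuousLinearMap.adjoint (koopman F) (lp.single 2 c 1)) =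
      ContinuousLinearMap.adjoint (koopman F) (lp.single 2 c 1) r := by
    rw [lp.inner_single_left]
    simp
  rw [← h1, ContinuousLinearMap.adjoint_inner_right, lp.inner_single_right, koopman_single_apply]
  simp only [entryIndex, if_true]
  split_ifs <;> simp

/-! ## The tower -/

open Classical in
/-- A finite non-empty set as an element of the Hausdorff space; other sets are sent to `{0}`. -/
noncomputable def finiteCompact (s : Set ℂ) : HausdorffSpace :=
  if h : s.Finite ∧ s.Nonempty then ⟨⟨s, h.1.isCompact⟩, h.2⟩ else {0}

theorem coe_finiteCompact {s : Set ℂ} (h : s.Finite) (h' : s.Nonempty) :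
    (finiteCompact s : Set ℂ) = s := by
  rw [finiteCompact, dif_pos ⟨h, h'⟩]
  rfl

theorem coe_finiteCompact_empty : (finiteCompact ∅ : Set ℂ) = {0} := by
  rw [finiteCompact, dif_neg fun h => Set.not_nonempty_empty h.2]
  rfl

/-- The `k`-th finitely supported vector is an approximate eigenvector for the `m`-th grid point, of
the Koopman operator or, if `both` is true, of its adjoint. -/
def Accepts (both : Bool) (F : DiscreteSystem) (n k m : ℕ) : Prop :=
  ‖koopman F (finiteVector k) - gridPoint n m • finiteVector k‖ < (1 / 2) ^ n * ‖finiteVector k‖ ∨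
    (both = true ∧ ‖ContinuousLinearMap.adjoint (koopman F) (finiteVector k) -
      starRingEnd ℂ (gridPoint n m) • finiteVector k‖ < (1 / 2) ^ n * ‖finiteVector k‖)

/-- The grid points accepted by one of the first `b` vectors, among the first `b` grid points. -/
def acceptedUpTo (both : Bool) (F : DiscreteSystem) (n b : ℕ) : Set ℂ :=
  {z | ∃ m < b, (∃ k < b, Accepts both F n k m) ∧ gridPoint n m = z}

/-- The accepted grid points. -/
def acceptedPoints (both : Bool) (F : DiscreteSystem) (n : ℕ) : Set ℂ :=
  {z | ∃ m, (∃ k, Accepts both F n k m) ∧ gridPoint n m = z}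

/-- The grid points accepted by the algorithm. -/
def acceptedByWindow (both : Bool) (F : DiscreteSystem) (n b N : ℕ) : Set ℂ :=
  {z | ∃ m < b, WindowAccepts both n b N (windowCode (graphBits F) N) m ∧ gridPoint n m = z}

/-- The tower of algorithms. -/
noncomputable def koopmanTower (Ξ : DiscreteSystem → HausdorffSpace) (both : Bool) :
    List ℕ → DiscreteSystem → HausdorffSpace
  | [n], F => finiteCompact (acceptedPoints both F n)
  | [n, b], F => finiteCompact (acceptedUpTo both F n b)
  | [n, b, N], F => finiteCompact (acceptedByWindow both F n b N)
  | _, F => Ξ F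

theorem gaussOfCode_gridPointCode (n m : ℕ) : gaussOfCode (gridPointCode n m) = gridPoint n m := by
  have h : (1 : ℕ) ≤ 2 ^ (n + 2) := Nat.one_le_two_pow
  rw [gaussOfCode_eq, gridPoint, IntCode.val]
  simp only [gridPointCode]
  rw [Nat.cast_sub h, Nat.cast_one, sub_add_cancel]
  apply Complex.ext
  · rw [Complex.div_natCast_re]
  · rw [Complex.div_natCast_im]

/-- The set-valued tower is the list-valued algorithm; both fall back to `{0}` when nothing is
accepted. -/
theorem isWindowOutput_koopmanTower {Ω : Type} (π : Ω → DiscreteSystem)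
    (Ξ : DiscreteSystem → HausdorffSpace) (both : Bool) :
    IsWindowOutput (fun A => graphBits (π A)) (algorithmOutput both)
      (fun l A => koopmanTower Ξ both l (π A)) := by
  intro A n b N
  change (finiteCompact (acceptedByWindow both (π A) n b N) : Set ℂ) = _
  have hlist : ∀ z, z ∈ acceptedByWindow both (π A) n b N ↔
      ∃ c ∈ acceptedList both (n, b, N, windowCode (graphBits (π A)) N), gaussOfCode c = z := by
    intro z
    constructor
    · rintro ⟨m, hm, hacc, rfl⟩
      refine ⟨gridPointCode n m, List.mem_filterMap.2 ⟨m, List.mem_range.2 hm, ?_⟩,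
        gaussOfCode_gridPointCode n m⟩
      exact if_pos hacc
    · rintro ⟨c, hc, rfl⟩
      obtain ⟨m, hm, hmc⟩ := List.mem_filterMap.1 hc
      split_ifs at hmc with hacc
      obtain rfl := Option.some.inj hmc
      exact ⟨m, List.mem_range.1 hm, hacc, (gaussOfCode_gridPointCode n m).symm⟩
  unfold algorithmOutput
  split_ifs with h0
  · have hempty : acceptedByWindow both (π A) n b N = ∅ := by
      rw [Set.eq_empty_iff_forall_notMem]
      intro z hz
      obtain ⟨c, hc, -⟩ := (hlist z).1 hz
      rw [List.length_eq_zero_iff.1 h0] at hc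
      exact List.not_mem_nil hc
    rw [hempty, coe_finiteCompact_empty]
    ext z
    have : gaussOfCode ((0, 0, 0), (0, 0, 0)) = 0 := by
      rw [gaussOfCode_eq]
      apply Complex.ext <;> simp
    simp [this, eq_comm]
  · obtain ⟨c, hc⟩ := List.length_pos_iff_exists_mem.1 (Nat.pos_of_ne_zero h0)
    rw [coe_finiteCompact ?_ ⟨_, (hlist _).2 ⟨c, hc, rfl⟩⟩]
    · ext z
      exact hlist z
    · refine ((List.finite_toSet (acceptedList both
        (n, b, N, windowCode (graphBits (π A)) N))).image gaussOfCode).subset fun z hz => ?_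
      obtain ⟨c, hc, hcz⟩ := (hlist z).1 hz
      exact ⟨c, hc, hcz⟩

/-- Only finitely many tests occur for fixed `b`, and each is exact for large windows. -/
theorem eventually_acceptedByWindow_eq (both : Bool) (F : DiscreteSystem) (n b : ℕ) :
    ∀ᶠ N in atTop, acceptedByWindow both F n b N = acceptedUpTo both F n b := by
  have hev : ∀ᶠ N in atTop, ∀ m ∈ Finset.range b, ∀ k ∈ Finset.range b,
      ((WindowTest false n m k (windowCode (graphBits F) N) N ∨
        (both = true ∧ WindowTest true n m k (windowCode (graphBits F) N) N)) ↔
        Accepts both F n k m) := by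
    rw [Finset.eventually_all]
    intro m _
    rw [Finset.eventually_all]
    intro k _
    filter_upwards [(hasBinaryMatrix_koopman F).eventually_windowTest_iff n m k,
      (hasBinaryMatrix_adjoint_koopman F).eventually_windowTest_iff n m k] with N h1 h2
    rw [h1, h2]
    rfl
  filter_upwards [hev] with N hN
  ext z
  refine exists_congr fun m => and_congr_right fun hm => and_congr_left fun _ => ?_
  refine exists_congr fun k => and_congr_right fun hk => ?_
  exact hN m (Finset.mem_range.2 hm) k (Finset.mem_range.2 hk)

theorem acceptedUpTo_subset (both : Bool) (F : DiscreteSystem) (n b : ℕ) :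
    acceptedUpTo both F n b ⊆ acceptedPoints both F n := by
  rintro z ⟨m, -, ⟨k, -, h⟩, hz⟩
  exact ⟨m, ⟨k, h⟩, hz⟩

/-- Grid points in bounded sets. -/
theorem finite_gridPoint (n : ℕ) (C : ℝ) : {z | ∃ m, gridPoint n m = z ∧ ‖z‖ ≤ C}.Finite := by
  have hD : (0 : ℝ) < (2 ^ (n + 2) : ℕ) := by positivity
  obtain ⟨M, hM⟩ := exists_nat_ge (C * (2 ^ (n + 2) : ℕ))
  refine ((Set.toFinite (Set.Icc (-M : ℤ) M ×ˢ Set.Icc (-M : ℤ) M)).image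
    (fun p : ℤ × ℤ => (⟨(p.1 : ℝ), (p.2 : ℝ)⟩ : ℂ) / (2 ^ (n + 2) : ℕ))).subset ?_
  rintro z ⟨m, rfl, hz⟩
  set x := gridCode m with hx
  have hval : x.val = (⟨(((x.1 : ℤ) - x.2.1 : ℤ) : ℝ), (((x.2.2.1 : ℤ) - x.2.2.2 : ℤ) : ℝ)⟩ : ℂ) := by
    rw [IntCode.val]
    push_cast
    rfl
  have hnorm : ‖x.val‖ ≤ M := by
    rw [gridPoint, norm_div, Complex.norm_natCast, div_le_iff₀ hD] at hz
    exact hz.trans hM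
  have hbound : ∀ i : ℤ, |(i : ℝ)| ≤ ‖x.val‖ → i ∈ Set.Icc (-M : ℤ) M := fun i hi => by
    have h1 : |(i : ℝ)| ≤ ((M : ℤ) : ℝ) := by simpa using hi.trans hnorm
    rw [← Int.cast_abs, Int.cast_le, abs_le] at h1
    exact h1
  refine ⟨((x.1 : ℤ) - x.2.1, (x.2.2.1 : ℤ) - x.2.2.2), ⟨hbound _ ?_, hbound _ ?_⟩, ?_⟩
  · have := Complex.abs_re_le_norm x.val
    rw [hval] at this ⊢
    exact this
  · have := Complex.abs_im_le_norm x.val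
    rw [hval] at this ⊢
    exact this
  · rw [gridPoint, ← hx, hval]

/-- The points of the set that the tower computes: `both` selects the spectrum. -/
def IsKoopmanTarget (Ξ : DiscreteSystem → HausdorffSpace) (both : Bool) : Prop :=
  ∀ F z, z ∈ Ξ F ↔ z ∈ approximatePointSpectrum (koopman F) ∨ (both = true ∧
    starRingEnd ℂ z ∈ approximatePointSpectrum (ContinuousLinearMap.adjoint (koopman F)))

/-! ### Convergence of the tower -/

section

variable {Ξ : DiscreteSystem → HausdorffSpace} {both : Bool}

theorem finite_acceptedPoints (both : Bool) (F : DiscreteSystem) (n : ℕ) :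
    (acceptedPoints both F n).Finite := by
  refine (finite_gridPoint n (max ‖koopman F‖ ‖ContinuousLinearMap.adjoint (koopman F)‖ +
    (1 / 2) ^ n)).subset ?_
  rintro z ⟨m, ⟨k, h⟩, rfl⟩
  refine ⟨m, rfl, ?_⟩
  rcases h with h | ⟨-, h⟩
  · have := HasApproxEigenvector.norm_lt ⟨_, h⟩
    linarith [le_max_left ‖koopman F‖ ‖ContinuousLinearMap.adjoint (koopman F)‖]
  · have := HasApproxEigenvector.norm_lt ⟨_, h⟩
    rw [RCLike.norm_conj] at this
    linarith [le_max_right ‖koopman F‖ ‖ContinuousLinearMap.adjoint (koopman F)‖]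

/-- There are finitely many accepted points, so some `b` exceeds an index and a witness for each of
them. -/
theorem eventually_acceptedUpTo_eq (both : Bool) (F : DiscreteSystem) (n : ℕ) :
    ∀ᶠ b in atTop, acceptedUpTo both F n b = acceptedPoints both F n := by
  have hev : ∀ᶠ b in atTop, ∀ z ∈ acceptedPoints both F n, z ∈ acceptedUpTo both F n b := by
    rw [Filter.eventually_all_finite (finite_acceptedPoints both F n)]
    rintro z ⟨m, ⟨k, h⟩, hz⟩
    filter_upwards [eventually_gt_atTop m, eventually_gt_atTop k] with b hm hk
    exact ⟨m, hm, ⟨k, hk, h⟩, hz⟩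
  filter_upwards [hev] with b hb
  exact (acceptedUpTo_subset both F n b).antisymm hb

/-- Every point of the target set is close to an accepted point. -/
theorem IsKoopmanTarget.exists_acceptedPoints (hΞ : IsKoopmanTarget Ξ both) (F : DiscreteSystem)
    (n : ℕ) {w : ℂ} (hw : w ∈ Ξ F) : ∃ z ∈ acceptedPoints both F n, dist w z ≤ (1 / 2) ^ n := by
  have hD : 0 < 2 ^ (n + 2) := by positivity
  set m := Encodable.encode (roundCode (2 ^ (n + 2)) w) with hm
  have hgrid : gridPoint n m = (roundCode (2 ^ (n + 2)) w).val / (2 ^ (n + 2) : ℕ) := by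
    rw [gridPoint, gridCode, hm, Encodable.encodek, Option.getD_some]
  -- Rounding costs at most `2 * 2^(-n-2) = 2^(-n-1)`. The strict inequality makes the rounded point
  -- accepted.
  have hdist : dist w (gridPoint n m) < (1 / 2) ^ n := by
    rw [dist_comm, hgrid]
    refine (dist_roundCode_le hD w).trans_lt ?_
    rw [one_div, inv_pow, div_lt_iff₀ (by positivity), inv_mul_eq_div, lt_div_iff₀ (by positivity)]
    push_cast
    rw [pow_add]
    have : (0 : ℝ) < 2 ^ n := by positivity
    linarith
  refine ⟨gridPoint n m, ⟨m, ?_, rfl⟩, hdist.le⟩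
  rcases (hΞ F w).1 hw with h | ⟨hb, h⟩
  · obtain ⟨k, hk⟩ := (hasApproxEigenvector_of_dist_lt h hdist).exists_finiteVector
    exact ⟨k, Or.inl hk⟩
  · have hdist' : dist (starRingEnd ℂ w) (starRingEnd ℂ (gridPoint n m)) < (1 / 2) ^ n := by
      rwa [Complex.dist_conj_conj]
    obtain ⟨k, hk⟩ := (hasApproxEigenvector_of_dist_lt h hdist').exists_finiteVector
    exact ⟨k, Or.inr ⟨hb, hk⟩⟩

theorem IsKoopmanTarget.coe_finiteCompact_acceptedPoints (hΞ : IsKoopmanTarget Ξ both)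
    (F : DiscreteSystem) (n : ℕ) :
    (finiteCompact (acceptedPoints both F n) : Set ℂ) = acceptedPoints both F n := by
  refine coe_finiteCompact (finite_acceptedPoints both F n) ?_
  obtain ⟨w, hw⟩ := (Ξ F).nonempty
  obtain ⟨z, hz, -⟩ := hΞ.exists_acceptedPoints F n hw
  exact ⟨z, hz⟩

/-- Accepted points are eventually close to the target set. -/
theorem IsKoopmanTarget.eventually_exists_dist_lt (hΞ : IsKoopmanTarget Ξ both)
    (F : DiscreteSystem) {δ : ℝ} (hδ : 0 < δ) :
    ∀ᶠ n in atTop, ∀ z ∈ acceptedPoints both F n, ∃ w ∈ Ξ F, dist z w < δ := by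
  obtain ⟨ε, hε, h1⟩ := exists_dist_lt_of_hasApproxEigenvector (koopman F) hδ
  obtain ⟨ε', hε', h2⟩ := exists_dist_lt_of_hasApproxEigenvector
    (ContinuousLinearMap.adjoint (koopman F)) hδ
  have hlim : Tendsto (fun n : ℕ => (1 / 2 : ℝ) ^ n) atTop (𝓝 0) :=
    tendsto_pow_atTop_nhds_zero_of_lt_one (by norm_num) (by norm_num)
  filter_upwards [hlim.eventually (gt_mem_nhds hε), hlim.eventually (gt_mem_nhds hε')] with n hn hn'
  rintro z ⟨m, ⟨k, h⟩, rfl⟩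
  rcases h with h | ⟨hb, h⟩
  · obtain ⟨w, hw, hd⟩ := h1 (gridPoint n m)
      ⟨finiteVector k, h.trans_le (mul_le_mul_of_nonneg_right hn.le (norm_nonneg _))⟩
    exact ⟨w, (hΞ F w).2 (Or.inl hw), hd⟩
  · obtain ⟨w, hw, hd⟩ := h2 (starRingEnd ℂ (gridPoint n m))
      ⟨finiteVector k, h.trans_le (mul_le_mul_of_nonneg_right hn'.le (norm_nonneg _))⟩
    refine ⟨starRingEnd ℂ w, (hΞ F _).2 (Or.inr ⟨hb, by rwa [Complex.conj_conj]⟩), ?_⟩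
    rwa [← Complex.dist_conj_conj, Complex.conj_conj]

theorem IsKoopmanTarget.tendsto_koopmanTower (hΞ : IsKoopmanTarget Ξ both) (F : DiscreteSystem) :
    Tendsto (fun n => finiteCompact (acceptedPoints both F n)) atTop (𝓝 (Ξ F)) := by
  rw [Metric.tendsto_atTop']
  intro δ hδ
  have hlim : Tendsto (fun n : ℕ => (1 / 2 : ℝ) ^ n) atTop (𝓝 0) :=
    tendsto_pow_atTop_nhds_zero_of_lt_one (by norm_num) (by norm_num)
  obtain ⟨N, hN⟩ := eventually_atTop.1 ((hΞ.eventually_exists_dist_lt F (half_pos hδ)).and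
    (hlim.eventually (gt_mem_nhds (half_pos hδ))))
  refine ⟨N, fun n hn => lt_of_le_of_lt ?_ (half_lt_self hδ)⟩
  obtain ⟨h1, h2⟩ := hN n hn.le
  refine Metric.hausdorffDist_le_of_mem_dist (half_pos hδ).le (fun z hz => ?_) fun w hw => ?_
  · rw [hΞ.coe_finiteCompact_acceptedPoints] at hz
    obtain ⟨w, hw, hd⟩ := h1 z hz
    exact ⟨w, hw, hd.le⟩
  · obtain ⟨z, hz, hd⟩ := hΞ.exists_acceptedPoints F n hw
    exact ⟨z, by rwa [hΞ.coe_finiteCompact_acceptedPoints], hd.trans h2.le⟩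

/-- The tower is an arithmetic `Π₃`-tower for every input model of the system. -/
theorem IsKoopmanTarget.inPi {Ω I : Type} [Encodable I] {P : ComputationalProblem Ω I}
    (hΞ : IsKoopmanTarget Ξ both) (π : Ω → DiscreteSystem) (hπ : ∀ A, P.Ξ A = Ξ (π A)) {q : ℕ → I}
    (hq : IsBinaryModel P (fun A => graphBits (π A)) q) :
    (∃ Γ, IsTowerOfType .arithmetic P 3 Γ) ∧ InPi .arithmetic P 3 := by
  have hout := isWindowOutput_koopmanTower π Ξ both
  have htower : IsTowerOfType .arithmetic P 3 (fun l A => koopmanTower Ξ both l (π A)) := by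
    refine ⟨⟨fun l hl => hq.isGeneralAlgorithm hout hl, fun A => (hπ A).symm, fun l hl A => ?_⟩,
      hq.isBSSComputable hout (primrec_algorithmOutput both) (algorithmOutput_ne_nil both),
      fun _ => hq.isTuringComputable hout (primrec_algorithmOutput both)⟩
    match l, hl with
    | [], _ => exact hΞ.tendsto_koopmanTower (π A)
    | [n], _ =>
      refine tendsto_const_nhds.congr' ?_
      filter_upwards [eventually_acceptedUpTo_eq both (π A) n] with b hb
      exact congrArg finiteCompact hb.symm
    | [n, b], _ =>
      refine tendsto_const_nhds.congr' ?_
      filter_upwards [eventually_acceptedByWindow_eq both (π A) n b] with N hN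
      exact congrArg finiteCompact hN.symm
  -- The enclosing set is `Γ_n ∪ Ξ`. It is close to `Γ_n` because every point of Ξ is within
  -- `2^(-n)` of an accepted point.
  refine ⟨⟨_, htower⟩, SCI_le htower, _, fun n A => finiteCompact (acceptedPoints both (π A) n) ⊔
    Ξ (π A), htower, fun A n => ⟨?_, ?_⟩⟩
  · rw [hπ, TopologicalSpace.NonemptyCompacts.coe_sup]
    exact Set.subset_union_right
  · refine Metric.hausdorffDist_le_of_mem_dist (by positivity) (fun z hz => ?_) fun w hw => ?_
    · rw [TopologicalSpace.NonemptyCompacts.coe_sup] at hz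
      rcases hz with hz | hz
      · exact ⟨z, hz, by simp⟩
      · obtain ⟨w, hw, hd⟩ := hΞ.exists_acceptedPoints (π A) n hz
        refine ⟨w, ?_, hd⟩
        change w ∈ (finiteCompact (acceptedPoints both (π A) n) : Set ℂ)
        rwa [hΞ.coe_finiteCompact_acceptedPoints]
    · refine ⟨w, ?_, by simp⟩
      rw [TopologicalSpace.NonemptyCompacts.coe_sup]
      exact Or.inl hw

end

/-! ## Input models -/

theorem graphBits_iff_sample (F : DiscreteSystem) (k : ℕ) :
    (graphBits F k = true → sample F k.unpair = 1) ∧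
      (¬ graphBits F k = true → sample F k.unpair = 0) := by
  simp only [graphBits, decide_eq_true_eq, sample]
  exact ⟨fun h => if_pos h, fun h => if_neg h⟩

theorem isBinaryModel_sampleProblem (Ξ : DiscreteSystem → HausdorffSpace) :
    IsBinaryModel (sampleProblem Ξ) graphBits Nat.unpair where
  primrec := Primrec.id.of_eq fun k => (Nat.pair_unpair k).symm
  bit F k := by
    change _ ↔ 1 / 2 < (sample F k.unpair).re
    by_cases h : graphBits F k = true
    · rw [(graphBits_iff_sample F k).1 h]
      exact iff_of_true h (by norm_num)
    · rw [(graphBits_iff_sample F k).2 h]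
      exact iff_of_false h (by norm_num)

/-- Accuracy `2^(-2)` suffices to tell `0` from `1` by the threshold `1/2`, so one approximation of
each evaluation is read. -/
theorem isBinaryModel_inexact (Ξ : DiscreteSystem → HausdorffSpace) (S : Set ℂ) :
    IsBinaryModel ((sampleProblem Ξ).inexact S) (fun a => graphBits a.2.choose)
      (fun k => (k.unpair, 2)) where
  primrec := (Primrec₂.natPair.comp Primrec.id (Primrec.const 2)).of_eq fun k =>
    congrArg (Nat.pair · 2) (Nat.pair_unpair k).symm
  bit a k := by
    change _ ↔ 1 / 2 < (a.1 (k.unpair, 2)).re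
    have h1 : dist (a.1 (k.unpair, 2)) (sample a.2.choose k.unpair) ≤ (1 / 2) ^ 2 :=
      (a.2.choose_spec k.unpair 2).2
    have h2 := (Complex.abs_re_le_norm _).trans ((dist_eq_norm _ _).symm.trans_le h1)
    rw [Complex.sub_re, abs_le] at h2
    by_cases h : graphBits a.2.choose k = true
    · rw [(graphBits_iff_sample _ k).1 h, Complex.one_re] at h2
      exact iff_of_true h (by linarith [h2.1])
    · rw [(graphBits_iff_sample _ k).2 h, Complex.zero_re] at h2
      exact iff_of_false h (by linarith [h2.2])

theorem sample_mem_gaussRationals (F : DiscreteSystem) (ij : ℕ × ℕ) :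
    sample F ij ∈ gaussRationals := by
  unfold sample
  split_ifs
  · exact ⟨1, 0, by simp⟩
  · exact ⟨0, 0, by simp⟩

theorem exists_isKoopmanTarget {Ξ : DiscreteSystem → HausdorffSpace}
    (hΞ : Ξ = koopmanSpectrum ∨ Ξ = koopmanApproximatePointSpectrum) :
    ∃ both, IsKoopmanTarget Ξ both := by
  rcases hΞ with rfl | rfl
  · refine ⟨true, fun F z => ?_⟩
    simp only [true_and]
    exact mem_spectrum_iff_approximatePointSpectrum (koopman F) z
  · refine ⟨false, fun F z => ?_⟩
    simp only [Bool.false_eq_true, false_and, or_false]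
    exact Iff.rfl

theorem theorem3 (Ξ : DiscreteSystem → HausdorffSpace)
    (hΞ : Ξ = koopmanSpectrum ∨ Ξ = koopmanApproximatePointSpectrum) :
    -- no height-two tower of general algorithms, even with exact input
    ¬ InDelta .general (sampleProblem Ξ) 3 ∧
    -- arithmetic `Π₃`-towers with exact input and with inexact input (complex or rational)
    InPi .arithmetic (sampleProblem Ξ) 3 ∧
    InPi .arithmetic ((sampleProblem Ξ).inexact Set.univ) 3 ∧
    InPi .arithmetic ((sampleProblem Ξ).inexact gaussRationals) 3 ∧
    -- the SCI is three, for either type of tower and either kind of input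
    (∀ α : TowerType, SCI α (sampleProblem Ξ) = 3 ∧
      SCI α ((sampleProblem Ξ).inexact Set.univ) = 3 ∧
      SCI α ((sampleProblem Ξ).inexact gaussRationals) = 3) := by
  have hlow : ¬ ∃ Γ, IsTower (sampleProblem Ξ) 2 Γ := by
    rcases hΞ with rfl | rfl
    · exact not_exists_isTower_two (fun F => approximatePointSpectrum_subset_spectrum _)
        fun F => subset_rfl
    · exact not_exists_isTower_two (fun F => subset_rfl)
        fun F => approximatePointSpectrum_subset_spectrum _
  have hlow' : ∀ S : Set ℂ, (∀ F ij, sample F ij ∈ S) →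
      ¬ ∃ Γ, IsTower ((sampleProblem Ξ).inexact S) 2 Γ := fun S hS ⟨Γ, hΓ⟩ =>
    hlow (hΓ.exists_of_inexact hS)
  obtain ⟨both, hboth⟩ := exists_isKoopmanTarget hΞ
  obtain ⟨⟨Γ, hΓ⟩, hPi⟩ := hboth.inPi id (fun _ => rfl) (isBinaryModel_sampleProblem Ξ)
  have hinexact : ∀ S : Set ℂ, (∃ Γ, IsTowerOfType .arithmetic ((sampleProblem Ξ).inexact S) 3 Γ) ∧
      InPi .arithmetic ((sampleProblem Ξ).inexact S) 3 := fun S =>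
    hboth.inPi (fun a => a.2.choose) (fun _ => rfl) (isBinaryModel_inexact Ξ S)
  have hSCI : ∀ {Ω I : Type} [Encodable I] {P : ComputationalProblem Ω I},
      (¬ ∃ Γ, IsTower P 2 Γ) → (∃ Γ, IsTowerOfType .arithmetic P 3 Γ) → ∀ α, SCI α P = 3 := by
    rintro Ω I _ P h2 ⟨Γ, hΓ⟩ α
    refine le_antisymm ?_ (lt_SCI h2 α)
    cases α with
    | general => exact SCI_le (α := .general) hΓ.isTower
    | arithmetic => exact SCI_le hΓ
  refine ⟨fun h => ?_, hPi, (hinexact _).2, (hinexact _).2, fun α =>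
    ⟨hSCI hlow ⟨Γ, hΓ⟩ α, hSCI (hlow' _ fun _ _ => Set.mem_univ _) (hinexact _).1 α,
      hSCI (hlow' _ sample_mem_gaussRationals) (hinexact _).1 α⟩⟩
  have h3 := lt_SCI hlow .general
  exact absurd (h3.trans h) (by norm_num)
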